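/- Let $n\in\{2,3\}$ and let $\|\cdot\|$ be the Euclidean norm on $\mathbb R^n$. Let $x^o\in\mathbb R^n$ be a source and let $(a_i)_{i\ge 0}$ be a bounded sequence of sensor positions in $\mathbb R^n$ with reference sensor $a_0=0$ and $a_i\ne x^o$ for all $i\ge 0$. The measurements are $$d_i=\|a_i-x^o\|-\|x^o\|+r_i,\qquad i=1,2,\dots,$$ where $r_1,r_2,\dots$ are i.i.d. $\mathcal N(0,\sigma^2)$. Let $\mu$ be a probability measure on $\mathbb R^n$ with distribution function $F_\mu(z)=\mu\{a: a\preceq z\}$ ($\preceq$ coordinatewise) such that $\frac1m\#\{1\le i\le m: a_i\preceq z\}\to F_\mu(z)$ for every $z\in\mathbb R^n$. Assume that $\mu(S)\neq1$ whenever (i) $S$ is a hyperbola ($n=2$), resp. a two-sheeted hyperboloid of revolution ($n=3$), that passes through $a_0$ and has $x^o$ as a focus; or (ii) $S$ is a line ($n=2$), resp. a plane ($n=3$). Let the parameter set $\Theta\ni x^o$ be either a compact subset of $\mathbb R^n$, or $\Theta=\mathbb R^n$; in the latter case assume also that $\mu(S)\ne1$ for every parabola, resp. paraboloid of revolution, $S$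 that passes through $a_0$ and has focus $x^o$. Let $\hat x^{\rm ML}_m$ be (measurable) maximum likelihood estimates: almost surely, for all sufficiently large $m$, $\hat x^{\rm ML}_m$ is a global minimizer over $x\in\Theta$ of $$\frac1m\sum_{i=1}^m\bigl(d_i+\|x\|-\|a_i-x\|\bigr)^2 .$$ Then $\hat x^{\rm ML}_m\to x^o$ almost surely as $m\to\infty$. Moreover, suppose that $x^o$ is an interior point of $\Theta$, that $\mu(\{x^o\})=0$, and that $\mu(S)\neq1$ for every $S\ni a_0$ that is the union of two non-collinear rays emanating from $x^o$ ($n=2$), resp. one nappe of a circular cone with vertex $x^o$ and half-angle in $(0,\pi/2)$ ($n=3$) (these are the degenerate hyperbolas/hyperboloids whose two foci coincide at $x^o$). Put $f_i(x)=\|a_i-x\|-\|x\|$. Then the limits $$[M(x^o)]_{jk}=\lim_{m\to\infty}\frac1m\sum_{i=1}^m\frac{\partial f_i}{\partial x_j}(x^o)\,\frac{\partial f_i}{\partial x_k}(x^o)$$ exist, the matrix $M(x^o)$ is positive definite, and $$\sqrt m\,(\hat x^{\rm ML}_m-x^o)\longrightarrow\mathcal N\bigl(0,\sigma^2M(x^o)^{-1}\bigr)\quad\text{in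 distribution as } m\to\infty .$$ -/

import Mathlib

open MeasureTheory ProbabilityTheory Filter Topology
open scoped NNReal

noncomputable section

namespace TDOA

/-- The space `ℝⁿ` with its Euclidean norm. -/
abbrev Space (n : ℕ) : Type := EuclideanSpace ℝ (Fin n)

variable {n : ℕ}

/-- The noiseless range difference at `x` between a sensor at `b` and the reference sensor
at the origin: `‖b - x‖ - ‖x‖`. -/
def rangeDiff (b x : Space n) : ℝ := ‖b - x‖ - ‖x‖

/-- The measurement `d_i = ‖a_i - xo‖ - ‖xo‖ + r_i`. -/
def measurement (a : ℕ → Space n) (xo : Space n) (r : ℕ → ℝ) (i : ℕ) : ℝ :=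
  rangeDiff (a i) xo + r i

/-- The least-squares objective
`(1/m) ∑_{i=1}^m (d_i + ‖x‖ - ‖a_i - x‖)²` for measurements `d`. -/
def objective (a : ℕ → Space n) (d : ℕ → ℝ) (m : ℕ) (x : Space n) : ℝ :=
  (1 / (m : ℝ)) * ∑ i ∈ Finset.Icc 1 m, (d i + ‖x‖ - ‖a i - x‖) ^ 2

/-- `x` is a maximum likelihood estimate over the parameter set `Θ` from the first `m`
measurements: a global minimizer over `Θ` of the least-squares objective. -/
def IsMLEstimate (Θ : Set (Space n)) (a : ℕ → Space n) (d : ℕ → ℝ) (m : ℕ) (x : Space n) :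
    Prop :=
  x ∈ Θ ∧ ∀ y ∈ Θ, objective a d m x ≤ objective a d m y

open Classical in
/-- The sample distribution function `F_m(z) = #{i ∈ {1,…,m} : a_i ≼ z} / m`, where `≼` is the
coordinatewise order. -/
def sampleDistribution (a : ℕ → Space n) (m : ℕ) (z : Space n) : ℝ :=
  (((Finset.Icc 1 m).filter fun i => ∀ j, a i j ≤ z j).card : ℝ) / (m : ℝ)

/-- The distribution function of a measure: `F_μ(z) = μ {a : a ≼ z}`. -/
def distributionFunction (μ : Measure (Space n)) (z : Space n) : ℝ :=
  μ.real {b | ∀ j, b j ≤ z j}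

/-- An affine hyperplane: a line in the plane, a plane in space. -/
def IsHyperplane (S : Set (Space n)) : Prop :=
  ∃ (v : Space n) (c : ℝ), v ≠ 0 ∧ S = {z | inner ℝ v z = c}

/-- A (nondegenerate) hyperbola, resp. two-sheeted hyperboloid of revolution, both branches,
one focus of which is `F`: the points whose distances to `F` and to a second focus `F'`
differ by the constant `c`, where `0 < c < ‖F - F'‖`. -/
def IsHyperboloidWithFocus (F : Space n) (S : Set (Space n)) : Prop :=
  ∃ (F' : Space n) (c : ℝ), 0 < c ∧ c < dist F F' ∧ S = {z | |dist z F - dist z F'| = c}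

/-- A parabola, resp. paraboloid of revolution, with focus `F` and directrix
`{z : ⟨u, z⟩ = p}`, `u` a unit vector and `F` not on the directrix. -/
def IsParaboloidWithFocus (F : Space n) (S : Set (Space n)) : Prop :=
  ∃ (u : Space n) (p : ℝ), ‖u‖ = 1 ∧ inner ℝ u F ≠ p ∧ S = {z | dist z F = |inner ℝ u z - p|}

/-- One nappe of a circular cone with vertex `V` and half-angle strictly between `0` and `π/2`;
in the plane, the union of two rays from `V` that are not on one line. -/
def IsConeWithVertex (V : Space n) (S : Set (Space n)) : Prop :=
  ∃ (u : Space n) (c : ℝ), ‖u‖ = 1 ∧ 0 < c ∧ c < 1 ∧ S = {z | inner ℝ u (z - V) = c * dist z V}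

/-- `L` is the tail product of the sequences `(p_i)_{i ≥ 1}` and `(q_i)_{i ≥ 1}`:
the limit of `t⁻¹ ∑_{i=1}^t p_i q_i`. -/
def HasTailProduct (p q : ℕ → ℝ) (L : ℝ) : Prop :=
  Tendsto (fun t : ℕ => (t : ℝ)⁻¹ * ∑ i ∈ Finset.Icc 1 t, p i * q i) atTop (𝓝 L)

/-- The partial derivative `∂ f_i / ∂ x_j` at `x`, where `f_i(x) = ‖a_i - x‖ - ‖x‖`. -/
def partialRangeDiff (a : ℕ → Space n) (x : Space n) (j : Fin n) (i : ℕ) : ℝ :=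
  fderiv ℝ (rangeDiff (a i)) x (EuclideanSpace.single j 1)

/-- `M` is the matrix of the tail products of the sequences of partial derivatives at `x`. -/
def IsTailGram (a : ℕ → Space n) (x : Space n) (M : Matrix (Fin n) (Fin n) ℝ) : Prop :=
  ∀ j k, HasTailProduct (partialRangeDiff a x j) (partialRangeDiff a x k) (M j k)

end TDOA

end

/-! Subtracting the objective at the source `xo` from the objective at `x` leaves the average of
`(rangeDiff z xo - rangeDiff z x) ^ 2` over the sensors `z` plus a term linear in the noise.
Almost surely the noise averages out simultaneously against all continuous functions on the compact
closure of the sensors, because these form a separable space.  Hence a limit point `x` of the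
estimates has `rangeDiff · x = rangeDiff · xo` `μ`-almost everywhere, which confines `μ` to a
hyperboloid or a hyperplane; estimates that escape to infinity in the direction `u` give
`rangeDiff · xo = -⟪u, ·⟫` in the limit, hence a paraboloid.

On the scale `m ^ (-1/2)` the excess of the objective is, up to a uniformly small remainder, the
quadratic `⟪h, G h⟫ - 2 ⟪h, s⟫` with `G` the Gram operator of the gradients and `s` the score.
The range differences are not differentiable at the sensors, which may accumulate at `xo`, so the
remainder in the noise is controlled by chaining along the lattices `4⁻ᵏ ℤⁿ`, whose increments are
Gaussian.  The minimizer is therefore close in probability to `G⁻¹ s`, which is Gaussian with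
covariance tending to `σ² G⁻¹`. -/

noncomputable section

namespace TDOA

open scoped ENNReal BoundedContinuousFunction

/-! ### White noise -/

/-- A sequence of independent centred Gaussian variables with common variance `v`, the model of
the measurement errors. -/
structure IsWhiteNoise {Ω : Type*} [MeasurableSpace Ω] (ξ : ℕ → Ω → ℝ) (v : ℝ≥0)
    (P : Measure Ω) : Prop where
  indep : iIndepFun ξ P
  hasLaw : ∀ i, HasLaw (ξ i) (gaussianReal 0 v) P

theorem abs_average_mul_sub_le {c d x : ℕ → ℝ} {η A : ℝ} {m : ℕ} (hcd : ∀ i, |c i - d i| ≤ η)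
    (hA : (m : ℝ)⁻¹ * ∑ i ∈ Finset.range m, |x i| ≤ A) :
    |(m : ℝ)⁻¹ * ∑ i ∈ Finset.range m, c i * x i - (m : ℝ)⁻¹ * ∑ i ∈ Finset.range m, d i * x i| ≤
      η * A := by
  have hη : 0 ≤ η := (abs_nonneg _).trans (hcd 0)
  rw [← mul_sub, ← Finset.sum_sub_distrib, abs_mul, abs_of_nonneg (by positivity : 0 ≤ (m : ℝ)⁻¹)]
  calc (m : ℝ)⁻¹ * |∑ i ∈ Finset.range m, (c i * x i - d i * x i)|
      ≤ (m : ℝ)⁻¹ * ∑ i ∈ Finset.range m, η * |x i| := by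
        gcongr
        refine (Finset.abs_sum_le_sum_abs _ _).trans (Finset.sum_le_sum fun i _ => ?_)
        rw [← sub_mul, abs_mul]
        exact mul_le_mul_of_nonneg_right (hcd i) (abs_nonneg _)
    _ ≤ η * A := by
        rw [← Finset.mul_sum, mul_left_comm]
        exact mul_le_mul_of_nonneg_left hA hη

namespace IsWhiteNoise

variable {Ω : Type*} [MeasurableSpace Ω] {P : Measure Ω} {ξ : ℕ → Ω → ℝ} {v : ℝ≥0}

theorem aemeasurable (h : IsWhiteNoise ξ v P) (i : ℕ) : AEMeasurable (ξ i) P :=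
  (h.hasLaw i).aemeasurable

theorem aemeasurable_sum (h : IsWhiteNoise ξ v P) (s : Finset ℕ) (c : ℕ → ℝ) :
    AEMeasurable (fun ω => ∑ i ∈ s, c i * ξ i ω) P :=
  Finset.aemeasurable_fun_sum _ fun i _ => (h.aemeasurable i).const_mul (c i)

theorem hasLaw_sum (h : IsWhiteNoise ξ v P) (s : Finset ℕ) (c : ℕ → ℝ) :
    HasLaw (fun ω => ∑ i ∈ s, c i * ξ i ω)
      (gaussianReal 0 ((∑ i ∈ s, c i ^ 2).toNNReal * v)) P := by
  have := (h.hasLaw 0).isProbabilityMeasure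
  have hindep : iIndepFun (fun i ω => c i * ξ i ω) P :=
    h.indep.comp (fun i x => c i * x) fun i => measurable_const_mul (c i)
  have hterm (i : ℕ) : P.map (fun ω => c i * ξ i ω) =
      gaussianReal 0 ((c i ^ 2).toNNReal * v) := by
    rw [(gaussianReal_const_mul (h.hasLaw i) (c i)).map_eq, mul_zero,
      Real.toNNReal_of_nonneg (sq_nonneg (c i))]
  refine ⟨h.aemeasurable_sum s c, ?_⟩
  induction s using Finset.induction_on with
  | empty => simp
  | insert i s hi ih =>
    have hadd := gaussianReal_add_gaussianReal_of_indepFun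
      (hindep.indepFun_finsetSum_of_notMem₀ (fun i => (h.aemeasurable i).const_mul (c i)) hi).symm
      (hterm i) (by simpa only [Finset.sum_fn] using ih)
    simp only [Finset.sum_insert hi]
    rw [Real.toNNReal_add (sq_nonneg _) (Finset.sum_nonneg fun _ _ => sq_nonneg _), add_mul]
    simpa only [Finset.sum_fn, add_zero, Pi.add_def] using hadd

theorem eLpNorm_sum (h : IsWhiteNoise ξ v P) (q : ℝ≥0∞) (s : Finset ℕ) (c : ℕ → ℝ) :
    eLpNorm (fun ω => ∑ i ∈ s, c i * ξ i ω) q P =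
      ENNReal.ofReal √(∑ i ∈ s, c i ^ 2) * eLpNorm id q (gaussianReal 0 v) := by
  have hS : 0 ≤ ∑ i ∈ s, c i ^ 2 := Finset.sum_nonneg fun _ _ => sq_nonneg _
  have hscale : gaussianReal 0 ((∑ i ∈ s, c i ^ 2).toNNReal * v) =
      (gaussianReal 0 v).map (√(∑ i ∈ s, c i ^ 2) * ·) := by
    rw [gaussianReal_map_const_mul, mul_zero]
    congr 2
    ext
    simp [Real.sq_sqrt hS, hS]
  calc eLpNorm (fun ω => ∑ i ∈ s, c i * ξ i ω) q P
      = eLpNorm id q (P.map fun ω => ∑ i ∈ s, c i * ξ i ω) :=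
        (eLpNorm_map_measure aestronglyMeasurable_id (h.aemeasurable_sum s c)).symm
    _ = eLpNorm (√(∑ i ∈ s, c i ^ 2) • id) q (gaussianReal 0 v) := by
        rw [(h.hasLaw_sum s c).map_eq, hscale,
          eLpNorm_map_measure aestronglyMeasurable_id (by fun_prop)]
        rfl
    _ = _ := by
        rw [eLpNorm_const_smul, Real.enorm_of_nonneg (Real.sqrt_nonneg _)]

theorem lintegral_enorm_average_pow_four_le (h : IsWhiteNoise ξ v P) {c : ℕ → ℝ} {C : ℝ}
    (hc : ∀ i, |c i| ≤ C) (m : ℕ) :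
    ∫⁻ ω, ‖(m : ℝ)⁻¹ * ∑ i ∈ Finset.range m, c i * ξ i ω‖ₑ ^ 4 ∂P ≤
      ENNReal.ofReal (C ^ 4 * ((m : ℝ) ^ 2)⁻¹) * eLpNorm id 4 (gaussianReal 0 v) ^ 4 := by
  have hweights : √(∑ i ∈ Finset.range m, ((m : ℝ)⁻¹ * c i) ^ 2) ^ 4 ≤
      C ^ 4 * ((m : ℝ) ^ 2)⁻¹ := by
    have hsum : ∑ i ∈ Finset.range m, ((m : ℝ)⁻¹ * c i) ^ 2 ≤ C ^ 2 * (m : ℝ)⁻¹ :=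
      calc ∑ i ∈ Finset.range m, ((m : ℝ)⁻¹ * c i) ^ 2
          ≤ ∑ i ∈ Finset.range m, (m : ℝ)⁻¹ ^ 2 * C ^ 2 := by
            gcongr with i _
            rw [mul_pow]
            exact mul_le_mul_of_nonneg_left (sq_le_sq.2 ((hc i).trans (le_abs_self C)))
              (sq_nonneg _)
        _ = C ^ 2 * (m : ℝ)⁻¹ := by
            rcases eq_or_ne m 0 with rfl | hm
            · simp
            · simp only [Finset.sum_const, Finset.card_range, nsmul_eq_mul]
              field_simp
    have hsq := Real.sq_sqrt (Finset.sum_nonneg fun i (_ : i ∈ Finset.range m) =>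
      sq_nonneg ((m : ℝ)⁻¹ * c i))
    rw [show (4 : ℕ) = 2 * 2 from rfl, pow_mul, hsq]
    calc _ ≤ (C ^ 2 * (m : ℝ)⁻¹) ^ 2 := by
          gcongr
      _ = _ := by ring
  calc ∫⁻ ω, ‖(m : ℝ)⁻¹ * ∑ i ∈ Finset.range m, c i * ξ i ω‖ₑ ^ 4 ∂P
      = eLpNorm (fun ω => ∑ i ∈ Finset.range m, (m : ℝ)⁻¹ * c i * ξ i ω) 4 P ^ 4 := by
        have hpow := eLpNorm_nnreal_pow_eq_lintegral (p := 4) (μ := P)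
          (f := fun ω => ∑ i ∈ Finset.range m, (m : ℝ)⁻¹ * c i * ξ i ω) (by norm_num)
        simpa only [mul_assoc, ← Finset.mul_sum, NNReal.coe_ofNat, ENNReal.rpow_ofNat,
          ENNReal.coe_ofNat] using hpow.symm
    _ = ENNReal.ofReal (√(∑ i ∈ Finset.range m, ((m : ℝ)⁻¹ * c i) ^ 2) ^ 4) *
          eLpNorm id 4 (gaussianReal 0 v) ^ 4 := by
        rw [h.eLpNorm_sum 4 _ fun i => (m : ℝ)⁻¹ * c i, mul_pow,
          ENNReal.ofReal_pow (Real.sqrt_nonneg _)]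
    _ ≤ ENNReal.ofReal (C ^ 4 * ((m : ℝ) ^ 2)⁻¹) * eLpNorm id 4 (gaussianReal 0 v) ^ 4 := by
        gcongr

theorem ae_tendsto_average_mul (h : IsWhiteNoise ξ v P) {c : ℕ → ℝ} {C : ℝ}
    (hc : ∀ i, |c i| ≤ C) :
    ∀ᵐ ω ∂P, Tendsto (fun m : ℕ => (m : ℝ)⁻¹ * ∑ i ∈ Finset.range m, c i * ξ i ω) atTop
      (𝓝 0) := by
  have hmeas (m : ℕ) : AEMeasurable
      (fun ω => ‖(m : ℝ)⁻¹ * ∑ i ∈ Finset.range m, c i * ξ i ω‖ₑ ^ 4) P :=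
    (((h.aemeasurable_sum _ c).const_mul _).enorm).pow_const 4
  have hfin : ∫⁻ ω, ∑' m : ℕ, ‖(m : ℝ)⁻¹ * ∑ i ∈ Finset.range m, c i * ξ i ω‖ₑ ^ 4 ∂P ≠ ⊤ := by
    rw [lintegral_tsum hmeas]
    refine ne_top_of_le_ne_top ?_
      (ENNReal.tsum_le_tsum (h.lintegral_enorm_average_pow_four_le hc))
    rw [ENNReal.tsum_mul_right]
    refine ENNReal.mul_ne_top ?_ (ENNReal.pow_ne_top (memLp_id_gaussianReal' 4 (by simp)).2.ne)
    exact ((Real.summable_nat_pow_inv.2 one_lt_two).mul_left _).tsum_ofReal_ne_top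
  filter_upwards [ae_lt_top' (AEMeasurable.tsum hmeas) hfin] with ω hω
  have hpow := ENNReal.tendsto_atTop_zero_of_tsum_ne_top hω.ne
  rw [tendsto_zero_iff_enorm_tendsto_zero]
  have hroot := hpow.ennrpow_const ((4 : ℕ) : ℝ)⁻¹
  rw [ENNReal.zero_rpow_of_pos (by positivity)] at hroot
  exact hroot.congr fun m => ENNReal.pow_rpow_inv_natCast four_ne_zero _

theorem integrable (h : IsWhiteNoise ξ v P) (i : ℕ) : Integrable (ξ i) P :=
  (((h.hasLaw i).map_eq ▸ (memLp_id_gaussianReal 1).integrable le_rfl :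
    Integrable id (P.map (ξ i)))).comp_aemeasurable (h.aemeasurable i)

theorem exists_ae_eventually_average_abs_le (h : IsWhiteNoise ξ v P) :
    ∃ A : ℝ, ∀ᵐ ω ∂P, ∀ᶠ m : ℕ in atTop,
      (m : ℝ)⁻¹ * ∑ i ∈ Finset.range m, |ξ i ω| ≤ A := by
  have hlln := strong_law_ae_real (fun i ω => |ξ i ω|) (h.integrable 0).abs
    (fun i j hij => (h.indep.indepFun hij).comp measurable_abs measurable_abs)
    (fun i => ((h.hasLaw i).identDistrib (h.hasLaw 0)).comp measurable_abs)
  refine ⟨∫ ω, |ξ 0 ω| ∂P + 1, hlln.mono fun ω hω => ?_⟩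
  filter_upwards [hω.eventually_le_const (lt_add_one _)] with m hm
  rwa [inv_mul_eq_div]

theorem ae_forall_tendsto_average_mul (h : IsWhiteNoise ξ v P) {E : Type*} [TopologicalSpace E]
    [SecondCountableTopology E] [LocallyCompactSpace E] {K : Set E} (hK : IsCompact K)
    {b : ℕ → E} (hb : ∀ i, b i ∈ K) :
    ∀ᵐ ω ∂P, ∀ φ : C(E, ℝ),
      Tendsto (fun m : ℕ => (m : ℝ)⁻¹ * ∑ i ∈ Finset.range m, φ (b i) * ξ i ω) atTop (𝓝 0) := by
  have hdense : ∀ᵐ ω ∂P, ∀ k : ℕ, Tendsto (fun m : ℕ => (m : ℝ)⁻¹ * ∑ i ∈ Finset.range m,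
      TopologicalSpace.denseSeq C(E, ℝ) k (b i) * ξ i ω) atTop (𝓝 0) := by
    refine ae_all_iff.2 fun k => ?_
    obtain ⟨C, hC⟩ := hK.exists_bound_of_continuousOn
      (TopologicalSpace.denseSeq C(E, ℝ) k).continuous.continuousOn
    exact h.ae_tendsto_average_mul fun i => hC _ (hb i)
  obtain ⟨A, hA⟩ := h.exists_ae_eventually_average_abs_le
  filter_upwards [hdense, hA] with ω hω hAω φ
  rw [Metric.tendsto_nhds]
  intro ε hε
  obtain ⟨η, hη, hηA⟩ : ∃ η > 0, η * A < ε / 2 := by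
    refine ⟨ε / (2 * (|A| + 1)), by positivity, ?_⟩
    rw [div_mul_eq_mul_div, div_lt_div_iff₀ (by positivity) two_pos]
    nlinarith [le_abs_self A]
  have hnear := Metric.tendstoUniformlyOn_iff.1
    (ContinuousMap.tendsto_iff_forall_isCompact_tendstoUniformlyOn.1
      (tendsto_id (x := 𝓝 φ)) K hK) η hη
  obtain ⟨k, hk⟩ := (TopologicalSpace.denseRange_denseSeq C(E, ℝ)).mem_nhds hnear
  filter_upwards [hAω, Metric.tendsto_nhds.1 (hω k) (ε / 2) (half_pos hε)] with m hAm hm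
  have hsub := abs_average_mul_sub_le (fun i => (hk (b i) (hb i)).le) hAm
  rw [Real.dist_0_eq_abs] at hm ⊢
  rw [id_eq] at hsub
  linarith [abs_sub_abs_le_abs_sub
    ((m : ℝ)⁻¹ * ∑ i ∈ Finset.range m, φ (b i) * ξ i ω)
    ((m : ℝ)⁻¹ * ∑ i ∈ Finset.range m, TopologicalSpace.denseSeq C(E, ℝ) k (b i) * ξ i ω)]

end IsWhiteNoise

/-! ### Equidistributed sequences -/

section Equidistribution

/-- The average of `φ` over the first `m` points of the sequence `b`. -/
def average {E : Type*} (b : ℕ → E) (m : ℕ) (φ : E → ℝ) : ℝ :=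
  (m : ℝ)⁻¹ * ∑ i ∈ Finset.range m, φ (b i)

theorem average_sub {E : Type*} (b : ℕ → E) (m : ℕ) (φ ψ : E → ℝ) :
    average b m (fun z => φ z - ψ z) = average b m φ - average b m ψ := by
  rw [average, average, average, Finset.sum_sub_distrib, mul_sub]

/-- The sequence `b` is bounded and its empirical distributions converge weakly to `μ`. -/
structure IsEquidistributed {E : Type*} [PseudoMetricSpace E] [MeasurableSpace E] (b : ℕ → E)
    (μ : Measure E) : Prop where
  isBounded_range : Bornology.IsBounded (Set.range b)
  tendsto_average_boundedContinuous : ∀ φ : E →ᵇ ℝ,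
    Tendsto (fun m => average b m φ) atTop (𝓝 (∫ z, φ z ∂μ))

namespace IsEquidistributed

variable {E : Type*} [PseudoMetricSpace E] [MeasurableSpace E] [OpensMeasurableSpace E]
  {b : ℕ → E} {μ : Measure E}

theorem ae_mem_closure_range [IsFiniteMeasure μ] (h : IsEquidistributed b μ) :
    ∀ᵐ z ∂μ, z ∈ closure (Set.range b) := by
  let φ : E →ᵇ ℝ := BoundedContinuousFunction.ofNormedAddCommGroup
    (fun z => min 1 (Metric.infDist z (Set.range b)))
    (continuous_const.min (Metric.continuous_infDist_pt _)) 1 fun z => by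
      rw [Real.norm_of_nonneg (le_min zero_le_one Metric.infDist_nonneg)]
      exact min_le_left _ _
  have hφ : ∀ i, φ (b i) = 0 := fun i => by
    simp [φ, Metric.infDist_zero_of_mem (Set.mem_range_self i)]
  have hint : ∫ z, φ z ∂μ = 0 := by
    refine tendsto_nhds_unique (h.tendsto_average_boundedContinuous φ) ?_
    simp only [average, hφ, Finset.sum_const_zero, mul_zero, tendsto_const_nhds]
  have hzero := (integral_eq_zero_iff_of_nonneg
    (fun z => le_min zero_le_one Metric.infDist_nonneg) (φ.integrable μ)).1 hint
  filter_upwards [hzero] with z hz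
  rw [Metric.mem_closure_iff_infDist_zero (Set.range_nonempty b)]
  rcases min_choice 1 (Metric.infDist z (Set.range b)) with hmin | hmin
  · exact absurd (hmin.symm.trans hz) one_ne_zero
  · exact hmin.symm.trans hz

theorem integrable_of_continuous [ProperSpace E] [IsFiniteMeasure μ] (h : IsEquidistributed b μ)
    {φ : E → ℝ} (hφ : Continuous φ) : Integrable φ μ := by
  obtain ⟨C, hC⟩ := h.isBounded_range.isCompact_closure.exists_bound_of_continuousOn hφ.continuousOn
  exact .of_bound hφ.aestronglyMeasurable C (h.ae_mem_closure_range.mono hC)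

theorem tendsto_average [ProperSpace E] [IsFiniteMeasure μ] (h : IsEquidistributed b μ)
    {φ : E → ℝ} (hφ : Continuous φ) :
    Tendsto (fun m => average b m φ) atTop (𝓝 (∫ z, φ z ∂μ)) := by
  have := isCompact_iff_compactSpace.1 h.isBounded_range.isCompact_closure
  obtain ⟨ψ, -, hψ⟩ := BoundedContinuousFunction.exists_norm_eq_domRestrict_eq_of_closed
    (.mkOfCompact ⟨(closure (Set.range b)).domRestrict φ, hφ.continuousOn.domRestrict⟩)
    isClosed_closure
  have heq : Set.EqOn ψ φ (closure (Set.range b)) := fun z hz => DFunLike.congr_fun hψ ⟨z, hz⟩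
  have hlim := h.tendsto_average_boundedContinuous ψ
  rw [integral_congr_ae (h.ae_mem_closure_range.mono heq)] at hlim
  refine hlim.congr fun m => ?_
  simp only [average, heq (subset_closure (Set.mem_range_self _))]

end IsEquidistributed

variable {n : ℕ} {b : ℕ → Space n} {μ : Measure (Space n)}

/-- The box `∏ j, (u j, v j]`, with lower bounds imposed only for the coordinates in `J`, so that
induction on `J` leads from the orthants of a distribution function to boxes. -/
def halfOpenBox (J : Finset (Fin n)) (u v : Fin n → ℝ) : Set (Space n) :=
  {z | (∀ j ∈ J, u j < z j) ∧ ∀ j, z j ≤ v j}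

theorem measurableSet_halfOpenBox (J : Finset (Fin n)) (u v : Fin n → ℝ) :
    MeasurableSet (halfOpenBox J u v) := by
  simp only [halfOpenBox, Set.ofPred_and, Set.ofPred_forall]
  exact (Finset.measurableSet_biInter _ fun j _ =>
      measurableSet_lt (by fun_prop) (by fun_prop)).inter
    (MeasurableSet.iInter fun j => measurableSet_le (by fun_prop) (by fun_prop))

theorem halfOpenBox_insert (J : Finset (Fin n)) (j : Fin n) {u v : Fin n → ℝ} (hj : u j ≤ v j) :
    halfOpenBox (insert j J) u v =
      halfOpenBox J u v \ halfOpenBox J u (Function.update v j (u j)) := by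
  ext z
  have hupdate : (∀ k, z k ≤ Function.update v j (u j) k) ↔
      z j ≤ u j ∧ ∀ k, k ≠ j → z k ≤ v k := by
    refine ⟨fun h => ⟨by simpa using h j, fun k hk => by simpa [hk] using h k⟩, fun h k => ?_⟩
    rcases eq_or_ne k j with rfl | hk
    · simpa using h.1
    · simpa [hk] using h.2 k hk
  simp only [halfOpenBox, Set.mem_sdiff, Set.mem_ofPred_eq, hupdate, Finset.forall_mem_insert]
  grind

theorem isPiSystem_halfOpenBox :
    IsPiSystem {s : Set (Space n) | ∃ u v : Fin n → ℝ, (∀ j, u j ≤ v j) ∧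
      s = halfOpenBox Finset.univ u v} := by
  rintro _ ⟨u, v, -, rfl⟩ _ ⟨u', v', -, rfl⟩ ⟨z, hz, hz'⟩
  refine ⟨fun j => max (u j) (u' j), fun j => min (v j) (v' j), fun j => ?_, ?_⟩
  · exact (max_lt (hz.1 j (Finset.mem_univ j)) (hz'.1 j (Finset.mem_univ j))).le.trans
      (le_min (hz.2 j) (hz'.2 j))
  · ext w
    simp only [halfOpenBox, Finset.mem_univ, Set.mem_inter_iff, Set.mem_ofPred_eq, max_lt_iff,
      le_min_iff, true_imp_iff, forall_and]
    tauto

theorem exists_halfOpenBox_mem_nhds {s : Set (Space n)} {x : Space n} (hs : s ∈ 𝓝 x) :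
    ∃ u v : Fin n → ℝ, (∀ j, u j ≤ v j) ∧
      halfOpenBox Finset.univ u v ∈ 𝓝 x ∧ halfOpenBox Finset.univ u v ⊆ s := by
  let e : Space n ≃ₜ (Fin n → ℝ) := (EuclideanSpace.equiv (Fin n) ℝ).toHomeomorph
  have hs' : e.symm ⁻¹' s ∈ 𝓝 (e x) := e.symm.continuous.continuousAt.preimage_mem_nhds (by simpa)
  obtain ⟨δ, hδ, hball⟩ := Metric.nhds_basis_closedBall.mem_iff.1 hs'
  refine ⟨fun j => x j - δ, fun j => x j + δ, fun j => by linarith, ?_, fun z hz => ?_⟩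
  · filter_upwards [e.continuous.continuousAt (Metric.ball_mem_nhds (e x) hδ)] with z hz
    have hcoord (j : Fin n) : -δ < z j - x j ∧ z j - x j < δ :=
      abs_lt.1 ((dist_pi_lt_iff hδ).1 hz j)
    exact ⟨fun j _ => by linarith [(hcoord j).1], fun j => by linarith [(hcoord j).2]⟩
  · refine (e.symm_apply_apply z) ▸ hball ((dist_pi_le_iff hδ.le).2 fun j => ?_)
    have hlower : x j - δ < z j := hz.1 j (Finset.mem_univ j)
    have hupper : z j ≤ x j + δ := hz.2 j
    exact abs_le.2 ⟨(by linarith : -δ ≤ z j - x j), (by linarith : z j - x j ≤ δ)⟩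

theorem tendsto_average_halfOpenBox [IsFiniteMeasure μ]
    (hμ : ∀ z : Space n, Tendsto (fun m => average b m ({y | ∀ j, y j ≤ z j}.indicator 1)) atTop
      (𝓝 (distributionFunction μ z)))
    (J : Finset (Fin n)) {u v : Fin n → ℝ} (huv : ∀ j ∈ J, u j ≤ v j) :
    Tendsto (fun m => average b m ((halfOpenBox J u v).indicator 1)) atTop
      (𝓝 (μ.real (halfOpenBox J u v))) := by
  induction J using Finset.induction_on generalizing v with
  | empty => simpa [halfOpenBox, distributionFunction] using hμ (WithLp.toLp 2 v)
  | insert j J hj ih =>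
    have hjv : u j ≤ v j := huv j (Finset.mem_insert_self _ _)
    have hJ (k : Fin n) (hk : k ∈ J) : u k ≤ v k := huv k (Finset.mem_insert_of_mem hk)
    have hsub : halfOpenBox J u (Function.update v j (u j)) ⊆ halfOpenBox J u v :=
      fun z hz => ⟨hz.1, fun k => (hz.2 k).trans (update_le_self_iff.2 hjv k)⟩
    have hlim := (ih hJ).sub (ih (v := Function.update v j (u j)) fun k hk => by
      rw [Function.update_of_ne (ne_of_mem_of_not_mem hk hj)]; exact hJ k hk)
    rw [halfOpenBox_insert J j hjv, measureReal_sdiff hsub (measurableSet_halfOpenBox _ _ _)]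
    refine hlim.congr fun m => ?_
    rw [← average_sub, Set.indicator_sdiff hsub]
    rfl

/-- The empirical distribution of the first `m + 1` points of `b`; the shift avoids the empty
average at `m = 0`, which has total mass `0`. -/
def empiricalMeasure (b : ℕ → Space n) (m : ℕ) : ProbabilityMeasure (Space n) :=
  ⟨((m + 1 : ℝ≥0)⁻¹) • ∑ i ∈ Finset.range (m + 1), Measure.dirac (b i), ⟨by
    simp only [Measure.smul_apply, Measure.coe_finsetSum, Finset.sum_apply, measure_univ,
      Finset.sum_const, Finset.card_range, nsmul_eq_mul, mul_one]
    rw [ENNReal.smul_def, smul_eq_mul, ENNReal.coe_inv (by positivity)]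
    push_cast
    exact ENNReal.inv_mul_cancel (by positivity) (by finiteness)⟩⟩

theorem integral_empiricalMeasure (b : ℕ → Space n) (m : ℕ) (φ : Space n → ℝ) :
    ∫ z, φ z ∂(empiricalMeasure b m : Measure (Space n)) = average b (m + 1) φ := by
  rw [empiricalMeasure, ProbabilityMeasure.coe_mk, integral_smul_nnreal_measure,
    integral_finsetSum_measure fun i _ => integrable_dirac (by simp)]
  simp [average, NNReal.smul_def]

theorem tendsto_empiricalMeasure [IsProbabilityMeasure μ]
    (hμ : ∀ z : Space n, Tendsto (fun m => average b m ({y | ∀ j, y j ≤ z j}.indicator 1)) atTop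
      (𝓝 (distributionFunction μ z))) :
    Tendsto (empiricalMeasure b) atTop (𝓝 ⟨μ, inferInstance⟩) := by
  refine isPiSystem_halfOpenBox.tendsto_probabilityMeasure_of_tendsto_of_mem ?_ ?_ ?_
  · rintro _ ⟨u, v, -, rfl⟩
    exact measurableSet_halfOpenBox _ _ _
  · intro s hs x hx
    obtain ⟨u, v, huv, hmem, hsub⟩ := exists_halfOpenBox_mem_nhds (hs.mem_nhds hx)
    exact ⟨_, ⟨u, v, huv, rfl⟩, hmem, hsub⟩
  · rintro _ ⟨u, v, huv, rfl⟩
    rw [← NNReal.tendsto_coe]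
    refine ((tendsto_average_halfOpenBox hμ Finset.univ fun j _ => huv j).comp
      (tendsto_add_atTop_nat 1)).congr fun m => ?_
    rw [Function.comp_apply, ← integral_empiricalMeasure,
      integral_indicator_one (measurableSet_halfOpenBox _ _ _)]
    rfl

theorem isEquidistributed_of_tendsto_distributionFunction [IsProbabilityMeasure μ]
    (hb : Bornology.IsBounded (Set.range b))
    (hμ : ∀ z : Space n, Tendsto (fun m => average b m ({y | ∀ j, y j ≤ z j}.indicator 1)) atTop
      (𝓝 (distributionFunction μ z))) :
    IsEquidistributed b μ := by
  refine ⟨hb, fun φ => (tendsto_add_atTop_iff_nat 1).1 ?_⟩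
  simpa only [integral_empiricalMeasure, ProbabilityMeasure.coe_mk] using
    ProbabilityMeasure.tendsto_iff_forall_integral_tendsto.1 (tendsto_empiricalMeasure hμ) φ

end Equidistribution

/-! ### Identifiability -/

section Geometry

variable {E : Type*} [NormedAddCommGroup E] [InnerProductSpace ℝ E]

theorem abs_norm_add_sub_norm_sub_inner_div_le {y : E} (hy : y ≠ 0) (h : E) :
    |‖y + h‖ - ‖y‖ - inner ℝ y h / ‖y‖| ≤ ‖h‖ ^ 2 / (2 * ‖y‖) := by
  have hpos : 0 < ‖y‖ := norm_pos_iff.2 hy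
  have hlower : inner ℝ y h / ‖y‖ ≤ ‖y + h‖ - ‖y‖ := by
    have := real_inner_le_norm y (y + h)
    rw [inner_add_right, real_inner_self_eq_norm_sq] at this
    rw [div_le_iff₀ hpos]
    linarith
  have hupper : ‖y + h‖ - ‖y‖ ≤ inner ℝ y h / ‖y‖ + ‖h‖ ^ 2 / (2 * ‖y‖) := by
    have : inner ℝ y h / ‖y‖ + ‖h‖ ^ 2 / (2 * ‖y‖) = (‖y + h‖ ^ 2 - ‖y‖ ^ 2) / (2 * ‖y‖) := by
      rw [norm_add_sq_real]
      field_simp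
      ring
    rw [this, le_div_iff₀ (by positivity)]
    linarith [sq_nonneg (‖y + h‖ - ‖y‖)]
  rw [abs_of_nonneg (by linarith)]
  linarith

theorem exists_ne_zero_inner_eq_zero [FiniteDimensional ℝ E] (hE : 2 ≤ Module.finrank ℝ E)
    (w : E) : ∃ v : E, v ≠ 0 ∧ inner ℝ v w = 0 := by
  have hspan : (ℝ ∙ w)ᗮ ≠ ⊥ := fun h => by
    have hle := finrank_span_le_card (R := ℝ) ({w} : Set E)
    rw [Submodule.orthogonal_eq_bot_iff.1 h, finrank_top, Set.toFinset_card,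
      Set.card_singleton] at hle
    omega
  obtain ⟨v, hv, hv0⟩ := Submodule.exists_mem_ne_zero_of_ne_bot hspan
  exact ⟨v, hv0, Submodule.mem_orthogonal_singleton_iff_inner_left.1 hv⟩

theorem exists_sub_eq_smul_of_norm_sub_eq_add {x y z : E} (hne : x ≠ y)
    (h : ‖z - x‖ = ‖z - y‖ + ‖x - y‖) : ∃ t : ℝ, z - y = t • (x - y) := by
  have hray : SameRay ℝ (y - x) (z - y) := by
    rw [sameRay_iff_norm_add, show y - x + (z - y) = z - x by abel, h, norm_sub_rev y x, add_comm]
  obtain ⟨t, -, ht⟩ := hray.exists_nonneg_left (sub_ne_zero.2 hne.symm)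
  exact ⟨-t, by rw [← ht, neg_smul, ← smul_neg, neg_sub]⟩

theorem exists_sub_eq_smul_of_abs_norm_sub_sub_eq {x y z : E} (hne : x ≠ y)
    (h : |‖z - x‖ - ‖z - y‖| = ‖x - y‖) : ∃ t : ℝ, z - y = t • (x - y) := by
  rcases abs_eq (norm_nonneg _) |>.1 h with hpos | hneg
  · exact exists_sub_eq_smul_of_norm_sub_eq_add hne (by linarith)
  · obtain ⟨t, ht⟩ := exists_sub_eq_smul_of_norm_sub_eq_add (z := z) hne.symm
      (by rw [norm_sub_rev y x]; linarith)
    refine ⟨1 - t, ?_⟩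
    rw [sub_smul, one_smul, ← neg_sub y x, smul_neg, ← ht]
    abel

theorem eq_norm_smul_of_inner_eq_norm {v y : E} (hv : ‖v‖ = 1) (h : inner ℝ v y = ‖y‖) :
    y = ‖y‖ • v := by
  have := inner_eq_norm_mul_iff_real (x := v) (y := y)
  rw [hv, one_mul, one_smul] at this
  exact (this.1 h).symm

theorem inner_sub_eq_zero_of_norm_sub_eq {x y z : E} (hxy : ‖x‖ = ‖y‖)
    (h : ‖z - x‖ = ‖z - y‖) : inner ℝ (x - y) z = 0 := by
  have hsq : ‖z - x‖ ^ 2 = ‖z - y‖ ^ 2 := by rw [h]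
  rw [norm_sub_sq_real, norm_sub_sq_real, hxy] at hsq
  rw [inner_sub_left, real_inner_comm, real_inner_comm z y]
  linarith

end Geometry

section Identifiability

theorem not_ae_mem_of_measure_ne_one {α : Type*} [MeasurableSpace α] {μ : Measure α}
    [IsProbabilityMeasure μ] {S : Set α} (hS : μ S ≠ 1) : ¬ ∀ᵐ z ∂μ, z ∈ S := fun h => by
  have hae : S =ᵐ[μ] Set.univ := eventuallyEq_univ.2 h
  exact hS (by rw [measure_congr hae, measure_univ])

variable {n : ℕ} {μ : Measure (Space n)} [IsProbabilityMeasure μ] {xo : Space n}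

theorem not_ae_mem_line (hn : 2 ≤ n)
    (h_hyperplane : ∀ S : Set (Space n), IsHyperplane S → μ S ≠ 1) (p w : Space n) :
    ¬ ∀ᵐ z ∂μ, ∃ t : ℝ, z - p = t • w := by
  obtain ⟨v, hv, hvw⟩ := exists_ne_zero_inner_eq_zero (by simpa using hn) w
  refine mt (fun h => ?_) (not_ae_mem_of_measure_ne_one (h_hyperplane _ ⟨v, inner ℝ v p, hv, rfl⟩))
  filter_upwards [h] with z ⟨t, ht⟩
  rw [← sub_eq_zero, ← inner_sub_right, ht, inner_smul_right, hvw, mul_zero]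

theorem not_ae_rangeDiff_eq (hn : 2 ≤ n)
    (h_hyperboloid : ∀ S, IsHyperboloidWithFocus xo S → (0 : Space n) ∈ S → μ S ≠ 1)
    (h_hyperplane : ∀ S : Set (Space n), IsHyperplane S → μ S ≠ 1) {x : Space n} (hx : x ≠ xo) :
    ¬ ∀ᵐ z ∂μ, rangeDiff z xo = rangeDiff z x := by
  intro h
  have hdiff : ∀ᵐ z ∂μ, ‖z - x‖ - ‖z - xo‖ = ‖x‖ - ‖xo‖ := h.mono fun z hz => by
    simp only [rangeDiff] at hz
    linarith
  rcases eq_or_ne ‖x‖ ‖xo‖ with hnorm | hnorm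
  · refine not_ae_mem_of_measure_ne_one (h_hyperplane _ ⟨x - xo, 0, sub_ne_zero.2 hx, rfl⟩) ?_
    exact hdiff.mono fun z hz => inner_sub_eq_zero_of_norm_sub_eq hnorm (by linarith)
  rcases (abs_norm_sub_norm_le x xo).lt_or_eq with hlt | heq
  · refine not_ae_mem_of_measure_ne_one (h_hyperboloid _ ⟨x, |‖x‖ - ‖xo‖|,
      abs_pos.2 (sub_ne_zero.2 hnorm), by rwa [dist_comm, dist_eq_norm], rfl⟩ ?_) ?_
    · rw [Set.mem_ofPred_eq, dist_zero_left, dist_zero_left, abs_sub_comm]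
    · filter_upwards [hdiff] with z hz
      rw [dist_eq_norm, dist_eq_norm, abs_sub_comm, hz]
  · refine not_ae_mem_line hn h_hyperplane xo (x - xo) (hdiff.mono fun z hz => ?_)
    exact exists_sub_eq_smul_of_abs_norm_sub_sub_eq hx (by rw [hz, heq])

theorem not_ae_rangeDiff_eq_neg_inner (hn : 2 ≤ n)
    (h_hyperplane : ∀ S : Set (Space n), IsHyperplane S → μ S ≠ 1)
    (h_paraboloid : ∀ S, IsParaboloidWithFocus xo S → (0 : Space n) ∈ S → μ S ≠ 1)
    {u : Space n} (hu : ‖u‖ = 1) :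
    ¬ ∀ᵐ z ∂μ, rangeDiff z xo = -inner ℝ u z := by
  intro h
  have hdist : ∀ᵐ z ∂μ, ‖z - xo‖ = ‖xo‖ - inner ℝ u z := h.mono fun z hz => by
    simp only [rangeDiff] at hz
    linarith
  rcases eq_or_ne (inner ℝ u xo) ‖xo‖ with hc | hc
  · refine not_ae_mem_line hn h_hyperplane xo u (hdist.mono fun z hz => ⟨-‖xo - z‖, ?_⟩)
    rw [neg_smul, ← eq_norm_smul_of_inner_eq_norm hu, neg_sub]
    rw [inner_sub_right, hc, norm_sub_rev, hz]
  · refine not_ae_mem_of_measure_ne_one (h_paraboloid _ ⟨u, ‖xo‖, hu, hc, rfl⟩ (by simp)) ?_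
    filter_upwards [hdist] with z hz
    rw [abs_sub_comm, ← hz, abs_norm, dist_eq_norm]

theorem not_ae_inner_eq_mul_norm_of_nonneg (hn : 2 ≤ n)
    (h_hyperplane : ∀ S : Set (Space n), IsHyperplane S → μ S ≠ 1)
    (h_cone : ∀ S, IsConeWithVertex xo S → (0 : Space n) ∈ S → μ S ≠ 1) (hxo : xo ≠ 0)
    {v : Space n} (hv : ‖v‖ = 1) {c : ℝ} (hc0 : 0 ≤ c) (hc : inner ℝ v xo = c * ‖xo‖) :
    ¬ ∀ᵐ z ∂μ, inner ℝ v (xo - z) = c * ‖xo - z‖ := by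
  intro h
  have hc1 : c ≤ 1 := by
    have := real_inner_le_norm v xo
    rw [hc, hv] at this
    exact le_of_mul_le_mul_right this (norm_pos_iff.2 hxo)
  have hflip (z : Space n) : inner ℝ (-v) (z - xo) = inner ℝ v (xo - z) := by
    rw [inner_neg_left, ← inner_neg_right, neg_sub]
  rcases hc0.eq_or_lt with rfl | hpos
  · refine not_ae_mem_of_measure_ne_one
      (h_hyperplane _ ⟨v, inner ℝ v xo, norm_ne_zero_iff.1 (hv ▸ one_ne_zero), rfl⟩) ?_
    filter_upwards [h] with z hz
    rw [inner_sub_right, zero_mul] at hz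
    exact (sub_eq_zero.1 hz).symm
  rcases hc1.lt_or_eq with hlt | rfl
  · refine not_ae_mem_of_measure_ne_one
      (h_cone _ ⟨-v, c, by rwa [norm_neg], hpos, hlt, rfl⟩ ?_) ?_
    · rw [Set.mem_ofPred_eq, hflip, sub_zero, hc, dist_zero_left]
    · filter_upwards [h] with z hz
      rw [hflip, hz, dist_eq_norm, norm_sub_rev]
  · refine not_ae_mem_line hn h_hyperplane xo v (h.mono fun z hz => ⟨-‖xo - z‖, ?_⟩)
    rw [neg_smul, ← eq_norm_smul_of_inner_eq_norm hv (by rw [hz, one_mul]), neg_sub]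

theorem not_ae_inner_eq_mul_norm (hn : 2 ≤ n)
    (h_hyperplane : ∀ S : Set (Space n), IsHyperplane S → μ S ≠ 1)
    (h_cone : ∀ S, IsConeWithVertex xo S → (0 : Space n) ∈ S → μ S ≠ 1) (hxo : xo ≠ 0)
    {v : Space n} (hv : ‖v‖ = 1) {c : ℝ} (hc : inner ℝ v xo = c * ‖xo‖) :
    ¬ ∀ᵐ z ∂μ, inner ℝ v (xo - z) = c * ‖xo - z‖ := by
  rcases le_total 0 c with hc0 | hc0
  · exact not_ae_inner_eq_mul_norm_of_nonneg hn h_hyperplane h_cone hxo hv hc0 hc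
  · refine mt (fun h => ?_) (not_ae_inner_eq_mul_norm_of_nonneg hn h_hyperplane h_cone hxo
      (v := -v) (c := -c) (by rwa [norm_neg]) (neg_nonneg.2 hc0)
      (by rw [inner_neg_left, hc, neg_mul]))
    exact h.mono fun z hz => by rw [inner_neg_left, hz, neg_mul]

end Identifiability

section RangeDiff

variable {n : ℕ}

theorem abs_rangeDiff_sub_right_le (b x y : Space n) :
    |rangeDiff b x - rangeDiff b y| ≤ 2 * ‖x - y‖ := by
  have hnear := abs_norm_sub_norm_le (b - x) (b - y)
  have hnorm := abs_norm_sub_norm_le x y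
  rw [sub_sub_sub_cancel_left, norm_sub_rev y x] at hnear
  rw [rangeDiff, rangeDiff]
  rw [abs_le] at *
  constructor <;> linarith

end RangeDiff

/-! ### Consistency -/

section Consistency

theorem tendsto_average_sq_of_average_sq_add_le {E : Type*} {b : ℕ → E} {ξ : ℕ → ℝ} {A : ℝ}
    {l : Filter ℕ} {φ : ℕ → E → ℝ} {ψ : E → ℝ} {δ : ℕ → ℝ} (hδ : Tendsto δ l (𝓝 0))
    (hφψ : ∀ᶠ m in l, ∀ i, |φ m (b i) - ψ (b i)| ≤ δ m)
    (hξ : ∀ᶠ m : ℕ in l, (m : ℝ)⁻¹ * ∑ i ∈ Finset.range m, |ξ i| ≤ A)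
    (hψξ : Tendsto (fun m : ℕ => (m : ℝ)⁻¹ * ∑ i ∈ Finset.range m, ψ (b i) * ξ i) l (𝓝 0))
    (hle : ∀ᶠ m : ℕ in l, average b m (fun z => φ m z ^ 2) +
      2 * ((m : ℝ)⁻¹ * ∑ i ∈ Finset.range m, φ m (b i) * ξ i) ≤ 0) :
    Tendsto (fun m => average b m fun z => φ m z ^ 2) l (𝓝 0) := by
  have hbound : Tendsto (fun m : ℕ =>
      2 * (|(m : ℝ)⁻¹ * ∑ i ∈ Finset.range m, ψ (b i) * ξ i| + δ m * A)) l (𝓝 0) := by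
    simpa using ((hψξ.abs.add (hδ.mul_const A)).const_mul 2)
  refine tendsto_of_tendsto_of_tendsto_of_le_of_le' tendsto_const_nhds hbound
    (.of_forall fun m => mul_nonneg (by positivity) (Finset.sum_nonneg fun _ _ => sq_nonneg _)) ?_
  filter_upwards [hφψ, hξ, hle] with m hφψ hξ hle
  have hclose := (abs_le.1 (abs_average_mul_sub_le hφψ hξ)).1
  have hψ := neg_abs_le ((m : ℝ)⁻¹ * ∑ i ∈ Finset.range m, ψ (b i) * ξ i)
  linarith

variable {E : Type*} [PseudoMetricSpace E] [ProperSpace E] [MeasurableSpace E] [BorelSpace E]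
  {μ : Measure E} [IsFiniteMeasure μ] {b : ℕ → E}

theorem IsEquidistributed.ae_eq_zero_of_tendsto_average_sq (hb : IsEquidistributed b μ)
    {l : Filter ℕ} [l.NeBot] (hl : l ≤ atTop) {φ : ℕ → E → ℝ} {ψ : E → ℝ}
    (hψ : Continuous ψ) {δ : ℕ → ℝ} (hδ : Tendsto δ l (𝓝 0))
    (hφψ : ∀ᶠ m in l, ∀ i, |φ m (b i) - ψ (b i)| ≤ δ m)
    (hφ : Tendsto (fun m => average b m fun z => φ m z ^ 2) l (𝓝 0)) :
    ∀ᵐ z ∂μ, ψ z = 0 := by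
  have hψ2 : Continuous fun z => ψ z ^ 2 := hψ.pow 2
  have hbound : Tendsto (fun m => 2 * average b m (fun z => φ m z ^ 2) + 2 * δ m ^ 2) l (𝓝 0) := by
    simpa using (hφ.const_mul 2).add ((hδ.pow 2).const_mul 2)
  have hle : ∀ᶠ m in l, average b m (fun z => ψ z ^ 2) ≤
      2 * average b m (fun z => φ m z ^ 2) + 2 * δ m ^ 2 := by
    filter_upwards [hφψ, hl (eventually_gt_atTop 0)] with m hm hm0
    have hm0' : (m : ℝ) ≠ 0 := Nat.cast_ne_zero.2 hm0.ne'
    have hterm (i : ℕ) : ψ (b i) ^ 2 ≤ 2 * φ m (b i) ^ 2 + 2 * δ m ^ 2 := by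
      have hsq : (φ m (b i) - ψ (b i)) ^ 2 ≤ δ m ^ 2 := sq_le_sq.2 ((hm i).trans (le_abs_self _))
      linarith [sq_nonneg (2 * φ m (b i) - ψ (b i))]
    calc average b m (fun z => ψ z ^ 2)
        ≤ (m : ℝ)⁻¹ * ∑ i ∈ Finset.range m, (2 * φ m (b i) ^ 2 + 2 * δ m ^ 2) := by
          unfold average
          gcongr with i _
          exact hterm i
      _ = 2 * average b m (fun z => φ m z ^ 2) + 2 * δ m ^ 2 := by
          simp only [average, Finset.sum_add_distrib, ← Finset.mul_sum, Finset.sum_const,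
            Finset.card_range, nsmul_eq_mul]
          field_simp
  have hint : ∫ z, ψ z ^ 2 ∂μ = 0 :=
    (le_of_tendsto_of_tendsto ((hb.tendsto_average hψ2).mono_left hl) hbound hle).antisymm
      (integral_nonneg fun z => sq_nonneg _)
  rw [integral_eq_zero_iff_of_nonneg (fun z => sq_nonneg _) (hb.integrable_of_continuous hψ2)]
    at hint
  exact hint.mono fun z hz => pow_eq_zero_iff two_ne_zero |>.1 hz

theorem exists_tendsto_or_exists_tendsto_direction {ι F : Type*} [NormedAddCommGroup F]
    [NormedSpace ℝ F] [ProperSpace F] (U : Ultrafilter ι) (x : ι → F) :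
    (∃ y, Tendsto x U (𝓝 y)) ∨ Tendsto (fun i => ‖x i‖) U atTop ∧
      ∃ u : F, ‖u‖ = 1 ∧ Tendsto (fun i => ‖x i‖⁻¹ • x i) U (𝓝 u) := by
  have hcompact (C : ℝ) {y : ι → F} (hy : ∀ᶠ i in U, ‖y i‖ ≤ C) : ∃ z, Tendsto y U (𝓝 z) := by
    obtain ⟨z, -, hz⟩ := (isCompact_closedBall (0 : F) C).ultrafilter_le_nhds (U.map y)
      (le_principal_iff.2 (hy.mono fun i hi => mem_closedBall_zero_iff.2 hi))
    exact ⟨z, hz⟩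
  by_cases hbdd : ∃ C, ∀ᶠ i in U, ‖x i‖ ≤ C
  · exact .inl (hbdd.elim fun C hC => hcompact C hC)
  have hlarge : Tendsto (fun i => ‖x i‖) U atTop := tendsto_atTop.2 fun C =>
    (Ultrafilter.eventually_not.2 fun h => hbdd ⟨C, h⟩).mono fun i hi => (not_le.1 hi).le
  obtain ⟨u, hu⟩ := hcompact 1 (y := fun i => ‖x i‖⁻¹ • x i) (.of_forall fun i => by
    rw [norm_smul, norm_inv, norm_norm]
    exact inv_mul_le_one)
  refine .inr ⟨hlarge, u, tendsto_nhds_unique hu.norm (tendsto_const_nhds.congr' ?_), hu⟩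
  filter_upwards [hlarge.eventually_gt_atTop 0] with i hi
  rw [norm_smul, norm_inv, norm_norm, inv_mul_cancel₀ hi.ne']

end Consistency

section RangeDiffConsistency

variable {n : ℕ}

theorem continuous_rangeDiff_left (x : Space n) : Continuous fun b => rangeDiff b x := by
  unfold rangeDiff
  fun_prop

theorem abs_rangeDiff_add_inner_le {x : Space n} (hx : x ≠ 0) (b u : Space n) :
    |rangeDiff b x + inner ℝ u b| ≤
      ‖b‖ ^ 2 / (2 * ‖x‖) + ‖‖x‖⁻¹ • x - u‖ * ‖b‖ := by
  have hexpand := abs_norm_add_sub_norm_sub_inner_div_le hx (-b)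
  rw [norm_neg, inner_neg_right, ← sub_eq_add_neg, norm_sub_rev] at hexpand
  have hsplit : rangeDiff b x + inner ℝ u b = (‖b - x‖ - ‖x‖ - -inner ℝ x b / ‖x‖) -
      inner ℝ (‖x‖⁻¹ • x - u) b := by
    rw [inner_sub_left, real_inner_smul_left, rangeDiff, neg_div, div_eq_inv_mul]
    ring
  rw [hsplit]
  exact (abs_sub _ _).trans (add_le_add hexpand (abs_real_inner_le_norm _ _))

variable {b : ℕ → Space n} {μ : Measure (Space n)} [IsFiniteMeasure μ] {xo : Space n}

theorem IsEquidistributed.ae_rangeDiff_eq_of_average_sq_add_le (hb : IsEquidistributed b μ)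
    {l : Filter ℕ} [l.NeBot] (hl : l ≤ atTop) {x : ℕ → Space n} {ψ : Space n → ℝ}
    (hψ : Continuous ψ) {δ : ℕ → ℝ} (hδ : Tendsto δ l (𝓝 0))
    (hψδ : ∀ᶠ m in l, ∀ i, |rangeDiff (b i) (x m) - ψ (b i)| ≤ δ m) {ξ : ℕ → ℝ} {A : ℝ}
    (hξ : ∀ᶠ m : ℕ in l, (m : ℝ)⁻¹ * ∑ i ∈ Finset.range m, |ξ i| ≤ A)
    (hlaw : ∀ φ : C(Space n, ℝ), Tendsto
      (fun m : ℕ => (m : ℝ)⁻¹ * ∑ i ∈ Finset.range m, φ (b i) * ξ i) l (𝓝 0))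
    (hx : ∀ᶠ m : ℕ in l,
      average b m (fun z => (rangeDiff z xo - rangeDiff z (x m)) ^ 2) +
        2 * ((m : ℝ)⁻¹ *
          ∑ i ∈ Finset.range m, (rangeDiff (b i) xo - rangeDiff (b i) (x m)) * ξ i) ≤ 0) :
    ∀ᵐ z ∂μ, rangeDiff z xo = ψ z := by
  have hψ' : Continuous fun z => rangeDiff z xo - ψ z := (continuous_rangeDiff_left xo).sub hψ
  have hψδ' : ∀ᶠ m in l, ∀ i,
      |rangeDiff (b i) xo - rangeDiff (b i) (x m) - (rangeDiff (b i) xo - ψ (b i))| ≤ δ m :=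
    hψδ.mono fun m hm i => by rw [sub_sub_sub_cancel_left, abs_sub_comm]; exact hm i
  refine (hb.ae_eq_zero_of_tendsto_average_sq hl hψ' hδ
    (φ := fun m z => rangeDiff z xo - rangeDiff z (x m)) hψδ' ?_).mono fun z => sub_eq_zero.1
  exact tendsto_average_sq_of_average_sq_add_le hδ hψδ' hξ (hlaw ⟨_, hψ'⟩) hx

theorem IsEquidistributed.tendsto_of_average_rangeDiff_sq_add_le (hb : IsEquidistributed b μ)
    (hfin : ∀ x, x ≠ xo → ¬ ∀ᵐ z ∂μ, rangeDiff z xo = rangeDiff z x) {x : ℕ → Space n}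
    (hinf : (∃ C, ∀ᶠ m in atTop, ‖x m‖ ≤ C) ∨
      ∀ u : Space n, ‖u‖ = 1 → ¬ ∀ᵐ z ∂μ, rangeDiff z xo = -inner ℝ u z)
    {ξ : ℕ → ℝ} {A : ℝ}
    (hξ : ∀ᶠ m : ℕ in atTop, (m : ℝ)⁻¹ * ∑ i ∈ Finset.range m, |ξ i| ≤ A)
    (hlaw : ∀ φ : C(Space n, ℝ), Tendsto
      (fun m : ℕ => (m : ℝ)⁻¹ * ∑ i ∈ Finset.range m, φ (b i) * ξ i) atTop (𝓝 0))
    (hx : ∀ᶠ m : ℕ in atTop,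
      average b m (fun z => (rangeDiff z xo - rangeDiff z (x m)) ^ 2) +
        2 * ((m : ℝ)⁻¹ *
          ∑ i ∈ Finset.range m, (rangeDiff (b i) xo - rangeDiff (b i) (x m)) * ξ i) ≤ 0) :
    Tendsto x atTop (𝓝 xo) := by
  obtain ⟨R, hR⟩ := hb.isBounded_range.exists_norm_le
  rw [Set.forall_mem_range] at hR
  refine (tendsto_iff_ultrafilter _ _ _).2 fun U hU => ?_
  rcases exists_tendsto_or_exists_tendsto_direction U x with ⟨y, hy⟩ | ⟨hlarge, u, hu1, hu⟩
  · suffices y = xo by rwa [← this]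
    by_contra hne
    refine hfin y hne (hb.ae_rangeDiff_eq_of_average_sq_add_le hU (continuous_rangeDiff_left y)
      (δ := fun m => 2 * ‖x m - y‖) ?_ (.of_forall fun m i => abs_rangeDiff_sub_right_le _ _ _)
      (hU hξ) (fun φ => (hlaw φ).mono_left hU) (hU hx))
    simpa using ((hy.sub_const y).norm).const_mul 2
  · rcases hinf with ⟨C, hC⟩ | hinf
    · obtain ⟨m, hm, hm'⟩ := ((hlarge.eventually_gt_atTop C).and (hU hC)).exists
      exact absurd hm' (not_le.2 hm)
    refine (hinf u hu1 (hb.ae_rangeDiff_eq_of_average_sq_add_le hU (ψ := fun z => -inner ℝ u z)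
      (by fun_prop) (δ := fun m => R ^ 2 / (2 * ‖x m‖) + ‖‖x m‖⁻¹ • x m - u‖ * R) ?_ ?_
      (hU hξ) (fun φ => (hlaw φ).mono_left hU) (hU hx))).elim
    · simpa using ((hlarge.const_mul_atTop two_pos).const_div_atTop (R ^ 2)).add
        (((hu.sub_const u).norm).mul_const R)
    · filter_upwards [hlarge.eventually_gt_atTop 0] with m hm i
      rw [sub_neg_eq_add]
      refine (abs_rangeDiff_add_inner_le (norm_pos_iff.1 hm) _ _).trans ?_
      gcongr <;> exact hR i

end RangeDiffConsistency

/-! ### Chaining -/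

section Chaining

variable {T Ω : Type*} [MeasurableSpace Ω] {P : Measure Ω}

/-- The `ℓ^q` norm of the increments of `f` along the links `L`, which dominates each of them. -/
def linkNorm (L : Finset (T × T)) (q : ℕ) (f : T → ℝ) : ℝ≥0∞ :=
  (∑ p ∈ L, ‖f p.2 - f p.1‖ₑ ^ q) ^ (q : ℝ)⁻¹

/-- The sum of `linkNorm` over the levels of a chain, which dominates every value of `f` that can
be reached from a zero of `f` through links of successive levels. -/
def chainMajorant (L : ℕ → Finset (T × T)) (q : ℕ) (f : T → ℝ) : ℝ≥0∞ :=
  ∑' k, linkNorm (L k) q f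

theorem enorm_sub_le_linkNorm {L : Finset (T × T)} {q : ℕ} (hq : q ≠ 0) (f : T → ℝ) {p : T × T}
    (hp : p ∈ L) : ‖f p.2 - f p.1‖ₑ ≤ linkNorm L q f := by
  rw [linkNorm, ← ENNReal.pow_rpow_inv_natCast hq ‖f p.2 - f p.1‖ₑ]
  gcongr
  exact Finset.single_le_sum (f := fun p : T × T => ‖f p.2 - f p.1‖ₑ ^ q) (fun _ _ => zero_le) hp

theorem enorm_le_chainMajorant [TopologicalSpace T] {L : ℕ → Finset (T × T)} {q : ℕ}
    (hq : q ≠ 0) {f : T → ℝ} {t : T} (hf : ContinuousAt f t) {π : ℕ → T}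
    (hπ : Tendsto π atTop (𝓝 t)) (h0 : f (π 0) = 0) (hL : ∀ k, (π k, π (k + 1)) ∈ L k) :
    ‖f t‖ₑ ≤ chainMajorant L q f := by
  refine le_of_tendsto ((hf.tendsto.comp hπ).enorm) (.of_forall fun K => ?_)
  calc ‖f (π K)‖ₑ = ‖∑ k ∈ Finset.range K, (f (π (k + 1)) - f (π k))‖ₑ := by
        rw [Finset.sum_range_sub (fun k => f (π k)), h0, sub_zero]
    _ ≤ ∑ k ∈ Finset.range K, ‖f (π (k + 1)) - f (π k)‖ₑ := enorm_sum_le _ _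
    _ ≤ ∑ k ∈ Finset.range K, linkNorm (L k) q f :=
        Finset.sum_le_sum fun k _ => enorm_sub_le_linkNorm hq f (hL k)
    _ ≤ chainMajorant L q f := ENNReal.sum_le_tsum _

theorem eLpNorm_natCast_pow {ε : Type*} [ENorm ε] {q : ℕ} (hq : q ≠ 0) (Y : Ω → ε) :
    eLpNorm Y q P ^ q = ∫⁻ ω, ‖Y ω‖ₑ ^ q ∂P := by
  simpa using eLpNorm_nnreal_pow_eq_lintegral (f := Y) (μ := P) (p := q) (Nat.cast_ne_zero.2 hq)

variable {X : T → Ω → ℝ}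

theorem aemeasurable_linkNorm (hX : ∀ t, AEMeasurable (X t) P) (L : Finset (T × T)) (q : ℕ) :
    AEMeasurable (fun ω => linkNorm L q (X · ω)) P :=
  (Finset.aemeasurable_fun_sum L fun p _ =>
    ((hX p.2).sub (hX p.1)).enorm.pow_const q).pow_const _

theorem aemeasurable_chainMajorant (hX : ∀ t, AEMeasurable (X t) P)
    (L : ℕ → Finset (T × T)) (q : ℕ) : AEMeasurable (fun ω => chainMajorant L q (X · ω)) P :=
  AEMeasurable.tsum fun k => aemeasurable_linkNorm hX (L k) q

theorem lintegral_linkNorm_le [IsProbabilityMeasure P] (hX : ∀ t, AEMeasurable (X t) P)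
    (L : Finset (T × T)) {q : ℕ} (hq : q ≠ 0) :
    ∫⁻ ω, linkNorm L q (X · ω) ∂P ≤
      (∑ p ∈ L, eLpNorm (fun ω => X p.2 ω - X p.1 ω) q P ^ q) ^ (q : ℝ)⁻¹ := by
  have hmeas := aemeasurable_linkNorm hX L q
  have hmono : ∫⁻ ω, linkNorm L q (X · ω) ∂P ≤ eLpNorm (fun ω => linkNorm L q (X · ω)) q P := by
    simpa [eLpNorm_one_eq_lintegral_enorm] using
      eLpNorm_le_eLpNorm_of_exponent_le (p := 1) (q := q) (by exact_mod_cast hq.bot_lt)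
        hmeas.aestronglyMeasurable
  refine hmono.trans_eq ?_
  rw [← ENNReal.pow_rpow_inv_natCast hq (eLpNorm _ _ _), eLpNorm_natCast_pow hq]
  simp only [enorm_eq_self, linkNorm, ENNReal.rpow_inv_natCast_pow hq]
  rw [lintegral_finsetSum' _ fun p _ => ((hX p.2).sub (hX p.1)).enorm.pow_const q]
  simp only [eLpNorm_natCast_pow hq]

theorem lintegral_linkNorm_le_card_mul [IsProbabilityMeasure P] (hX : ∀ t, AEMeasurable (X t) P)
    {L : Finset (T × T)} {q : ℕ} (hq : q ≠ 0) {B : ℝ≥0∞}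
    (hB : ∀ p ∈ L, eLpNorm (fun ω => X p.2 ω - X p.1 ω) q P ≤ B) :
    ∫⁻ ω, linkNorm L q (X · ω) ∂P ≤ (L.card : ℝ≥0∞) ^ (q : ℝ)⁻¹ * B := by
  calc ∫⁻ ω, linkNorm L q (X · ω) ∂P
      ≤ (∑ p ∈ L, eLpNorm (fun ω => X p.2 ω - X p.1 ω) q P ^ q) ^ (q : ℝ)⁻¹ :=
        lintegral_linkNorm_le hX L hq
    _ ≤ (∑ _p ∈ L, B ^ q) ^ (q : ℝ)⁻¹ := by
        gcongr with p hp
        exact hB p hp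
    _ = (L.card : ℝ≥0∞) ^ (q : ℝ)⁻¹ * B := by
        rw [Finset.sum_const, nsmul_eq_mul, ENNReal.mul_rpow_of_nonneg _ _ (by positivity),
          ENNReal.pow_rpow_inv_natCast hq]

theorem lintegral_chainMajorant_le [IsProbabilityMeasure P] (hX : ∀ t, AEMeasurable (X t) P)
    {L : ℕ → Finset (T × T)} {q : ℕ} (hq : q ≠ 0) {B : ℕ → ℝ≥0∞}
    (hB : ∀ k, ∀ p ∈ L k, eLpNorm (fun ω => X p.2 ω - X p.1 ω) q P ≤ B k) :
    ∫⁻ ω, chainMajorant L q (X · ω) ∂P ≤ ∑' k, ((L k).card : ℝ≥0∞) ^ (q : ℝ)⁻¹ * B k := by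
  simp only [chainMajorant]
  rw [lintegral_tsum fun k => aemeasurable_linkNorm hX (L k) q]
  exact ENNReal.tsum_le_tsum fun k => lintegral_linkNorm_le_card_mul hX hq (hB k)

theorem tendsto_lintegral_chainMajorant [IsProbabilityMeasure P] {X : ℕ → T → Ω → ℝ}
    (hX : ∀ m t, AEMeasurable (X m t) P) {L : ℕ → Finset (T × T)} {q : ℕ} (hq : q ≠ 0)
    {B : ℕ → ℝ≥0∞}
    (hB : ∀ m k, ∀ p ∈ L k, eLpNorm (fun ω => X m p.2 ω - X m p.1 ω) q P ≤ B k)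
    (hsum : ∑' k, ((L k).card : ℝ≥0∞) ^ (q : ℝ)⁻¹ * B k ≠ ∞)
    (hlim : ∀ s t, Tendsto (fun m => eLpNorm (fun ω => X m s ω - X m t ω) q P) atTop (𝓝 0)) :
    Tendsto (fun m => ∫⁻ ω, chainMajorant L q (X m · ω) ∂P) atTop (𝓝 0) := by
  have hlevel (k : ℕ) :
      Tendsto (fun m => ∫⁻ ω, linkNorm (L k) q (X m · ω) ∂P) atTop (𝓝 0) := by
    have hbound : Tendsto (fun m => (∑ p ∈ L k,
        eLpNorm (fun ω => X m p.2 ω - X m p.1 ω) q P ^ q) ^ (q : ℝ)⁻¹) atTop (𝓝 0) := by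
      have hzero : (∑ _p ∈ L k, (0 : ℝ≥0∞) ^ q) ^ (q : ℝ)⁻¹ = 0 := by
        simp [hq, Nat.pos_of_ne_zero hq]
      rw [← hzero]
      exact (tendsto_finsetSum _ fun p _ =>
        ((ENNReal.continuous_pow q).tendsto 0).comp (hlim p.2 p.1)).ennrpow_const _
    exact tendsto_of_tendsto_of_tendsto_of_le_of_le tendsto_const_nhds hbound
      (fun _ => zero_le) fun m => lintegral_linkNorm_le (hX m) (L k) hq
  simp only [chainMajorant]
  simp_rw [lintegral_tsum fun k => aemeasurable_linkNorm (hX _) (L k) q,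
    ← lintegral_count fun k : ℕ => ∫⁻ ω, linkNorm (L k) q (X _ · ω) ∂P]
  rw [← lintegral_zero (μ := Measure.count (α := ℕ))]
  refine tendsto_lintegral_filter_of_dominated_convergence
    (fun k => ((L k).card : ℝ≥0∞) ^ (q : ℝ)⁻¹ * B k) (.of_forall fun m => .of_discrete)
    (.of_forall fun m => .of_forall fun k => lintegral_linkNorm_le_card_mul (hX m) hq (hB m k))
    (by rwa [lintegral_count]) (.of_forall hlevel)

end Chaining

section Grid

variable {n : ℕ}

/-- The point of the lattice `4⁻ᵏ ℤⁿ` nearest to `x`, coordinate by coordinate. -/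
def gridRound (k : ℕ) (x : Space n) : Space n :=
  WithLp.toLp 2 fun j => (round (4 ^ k * x j) : ℝ) / 4 ^ k

open Classical in
/-- The points of the lattice `4⁻ᵏ ℤⁿ` in the cube `[-1, 1]ⁿ`. -/
def grid (n k : ℕ) : Finset (Space n) :=
  (Fintype.piFinset fun _ => Finset.Icc (-4 ^ k : ℤ) (4 ^ k)).image fun z =>
    WithLp.toLp 2 fun j => (z j : ℝ) / 4 ^ k

open Classical in
/-- The links from `grid n k` to neighbouring points of `grid n (k + 1)`. -/
def gridLinks (n k : ℕ) : Finset (Space n × Space n) :=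
  (grid n k ×ˢ grid n (k + 1)).filter fun p => ‖p.2 - p.1‖ ≤ n / 4 ^ k

/-- The moment used for chaining in dimension `n`; it is so large that the `1 / q`-th power of the
number of links of length `4⁻ᵏ` is `O(2ᵏ)`. -/
def chainingExponent (n : ℕ) : ℕ := 4 * (n + 1)

theorem chainingExponent_ne_zero (n : ℕ) : chainingExponent n ≠ 0 := by
  simp [chainingExponent]

theorem norm_le_dim_mul {x : Space n} {c : ℝ} (hx : ∀ j, |x j| ≤ c) : ‖x‖ ≤ n * c := by
  calc ‖x‖ = ‖∑ j, x j • EuclideanSpace.basisFun (Fin n) ℝ j‖ := by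
        conv_lhs => rw [← (EuclideanSpace.basisFun (Fin n) ℝ).sum_repr x]
        simp only [EuclideanSpace.basisFun_repr]
    _ ≤ ∑ _j : Fin n, c := norm_sum_le_of_le _ fun j _ => by simpa [norm_smul] using hx j
    _ = n * c := by simp

theorem norm_gridRound_sub_le (k : ℕ) (x : Space n) :
    ‖gridRound k x - x‖ ≤ n * (1 / 2 / 4 ^ k) := by
  refine norm_le_dim_mul fun j => ?_
  have hcoord : (gridRound k x - x) j = (round (4 ^ k * x j) - 4 ^ k * x j) / 4 ^ k := by
    simp only [gridRound, PiLp.sub_apply]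
    field_simp
  rw [hcoord, abs_div, abs_of_pos (by positivity : (0 : ℝ) < 4 ^ k), abs_sub_comm]
  gcongr
  exact abs_sub_round _

theorem tendsto_gridRound (x : Space n) : Tendsto (gridRound · x) atTop (𝓝 x) := by
  rw [tendsto_iff_norm_sub_tendsto_zero]
  refine squeeze_zero (fun _ => norm_nonneg _) (norm_gridRound_sub_le · x) ?_
  simpa using ((tendsto_pow_atTop_atTop_of_one_lt (by norm_num : (1 : ℝ) < 4)).const_div_atTop
    (1 / 2)).const_mul (n : ℝ)

theorem gridRound_zero_eq_zero {x : Space n} (hx : ‖x‖ < 1 / 2) : gridRound 0 x = 0 := by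
  ext j
  have hj := abs_lt.1 ((PiLp.norm_apply_le x j).trans_lt hx)
  have : round (x j) = 0 := by
    rw [round_eq_zero_iff]
    exact ⟨by linarith [hj.1], hj.2⟩
  simp [gridRound, this]

theorem gridRound_mem_grid {x : Space n} (hx : ‖x‖ ≤ 1 / 2) (k : ℕ) :
    gridRound k x ∈ grid n k := by
  refine Finset.mem_image.2 ⟨fun j => round (4 ^ k * x j), ?_, rfl⟩
  simp only [Fintype.mem_piFinset, Finset.mem_Icc]
  intro j
  have h1 : (1 : ℝ) ≤ 4 ^ k := one_le_pow₀ (by norm_num)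
  have hj := abs_le.1 ((PiLp.norm_apply_le x j).trans hx)
  have hround := abs_le.1 (abs_sub_round ((4 : ℝ) ^ k * x j))
  constructor <;> rify <;> nlinarith

theorem gridRound_mem_gridLinks {x : Space n} (hx : ‖x‖ ≤ 1 / 2) (k : ℕ) :
    (gridRound k x, gridRound (k + 1) x) ∈ gridLinks n k := by
  refine Finset.mem_filter.2
    ⟨Finset.mk_mem_product (gridRound_mem_grid hx k) (gridRound_mem_grid hx (k + 1)), ?_⟩
  calc ‖gridRound (k + 1) x - gridRound k x‖
      ≤ ‖gridRound (k + 1) x - x‖ + ‖x - gridRound k x‖ := norm_sub_le_norm_sub_add_norm_sub _ _ _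
    _ ≤ n * (1 / 2 / 4 ^ (k + 1)) + n * (1 / 2 / 4 ^ k) := by
        rw [norm_sub_rev x]
        gcongr <;> exact norm_gridRound_sub_le _ _
    _ = 5 / 8 * (n / 4 ^ k) := by rw [pow_succ]; field_simp; ring
    _ ≤ n / 4 ^ k := mul_le_of_le_one_left (by positivity) (by norm_num)

theorem card_grid_le (n k : ℕ) : (grid n k).card ≤ (4 ^ (k + 1)) ^ n := by
  refine Finset.card_image_le.trans ?_
  rw [Fintype.card_piFinset_const, Int.card_Icc]
  gcongr
  have : (1 : ℤ) ≤ 4 ^ k := one_le_pow₀ (by norm_num)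
  rw [Int.toNat_le]
  push_cast
  rw [pow_succ]
  linarith

theorem card_gridLinks_rpow_le (n k : ℕ) :
    ((gridLinks n k).card : ℝ≥0∞) ^ (chainingExponent n : ℝ)⁻¹ ≤ 2 ^ (k + 2) := by
  have hcard : (gridLinks n k).card ≤ (2 ^ (k + 2)) ^ chainingExponent n :=
    calc (gridLinks n k).card ≤ (grid n k).card * (grid n (k + 1)).card :=
          (Finset.card_filter_le _ _).trans_eq (Finset.card_product _ _)
      _ ≤ (4 ^ (k + 1)) ^ n * (4 ^ (k + 2)) ^ n :=
          Nat.mul_le_mul (card_grid_le n k) (card_grid_le n (k + 1))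
      _ = 2 ^ (2 * (2 * k + 3) * n) := by
          rw [show 4 = 2 ^ 2 by norm_num, ← pow_mul, ← pow_mul, ← pow_mul, ← pow_mul, ← pow_add]
          ring_nf
      _ ≤ (2 ^ (k + 2)) ^ chainingExponent n := by
          rw [← pow_mul]
          refine Nat.pow_le_pow_right two_pos ?_
          rw [chainingExponent]
          nlinarith
  rw [← ENNReal.pow_rpow_inv_natCast (chainingExponent_ne_zero n) (2 ^ (k + 2))]
  gcongr
  exact_mod_cast hcard

theorem tsum_two_pow_mul_div_four_pow (c : ℝ≥0∞) :
    ∑' k : ℕ, 2 ^ (k + 2) * (c / 4 ^ k) = 8 * c := by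
  have hterm (k : ℕ) : (2 : ℝ≥0∞) ^ (k + 2) * (c / 4 ^ k) = 4 * c * 2⁻¹ ^ k := by
    have htwo : (2 : ℝ≥0∞) ^ k * (2 ^ k)⁻¹ = 1 := ENNReal.mul_inv_cancel (by simp) (by simp)
    have hfour : ((4 : ℝ≥0∞) ^ k)⁻¹ = (2 ^ k)⁻¹ * (2 ^ k)⁻¹ := by
      rw [← ENNReal.mul_inv (by simp) (by simp), ← mul_pow]
      norm_num
    calc (2 : ℝ≥0∞) ^ (k + 2) * (c / 4 ^ k) = 4 * c * (2 ^ k * (2 ^ k)⁻¹) * (2 ^ k)⁻¹ := by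
          rw [div_eq_mul_inv, hfour]
          ring
      _ = 4 * c * 2⁻¹ ^ k := by rw [htwo, mul_one, ENNReal.inv_pow]
  simp_rw [hterm]
  rw [ENNReal.tsum_mul_left, ENNReal.tsum_geometric, ENNReal.one_sub_inv_two, inv_inv]
  ring

/-- The chaining majorant of `f` along the lattices `4⁻ᵏ ℤⁿ`, dilated by `scale`. -/
def gridMajorant (scale : ℝ≥0) (f : Space n → ℝ) : ℝ≥0∞ :=
  chainMajorant (gridLinks n) (chainingExponent n) fun t => f (scale • t)

theorem enorm_le_gridMajorant {scale : ℝ≥0} {f : Space n → ℝ} (hf : Continuous f)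
    (h0 : f 0 = 0) {s : Space n} (hs : 2 * ‖s‖ < scale) : ‖f s‖ₑ ≤ gridMajorant scale f := by
  have hscale : 0 < scale := by exact_mod_cast (by positivity : 0 ≤ 2 * ‖s‖).trans_lt hs
  have hnorm : ‖scale⁻¹ • s‖ < 1 / 2 := by
    rw [NNReal.smul_def, norm_smul, NNReal.coe_inv, norm_inv, NNReal.norm_eq,
      inv_mul_lt_iff₀ (by exact_mod_cast hscale)]
    linarith
  have hle := enorm_le_chainMajorant (L := gridLinks n) (chainingExponent_ne_zero n)
    (hf.comp (continuous_const_smul scale)).continuousAt (tendsto_gridRound (scale⁻¹ • s))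
    (by simp [gridRound_zero_eq_zero hnorm, h0]) (gridRound_mem_gridLinks hnorm.le)
  simpa only [gridMajorant, Function.comp_def, smul_inv_smul₀ hscale.ne'] using hle

variable {Ω : Type*} [MeasurableSpace Ω] {P : Measure Ω}

theorem aemeasurable_gridMajorant {X : Space n → Ω → ℝ} (hX : ∀ s, AEMeasurable (X s) P)
    (scale : ℝ≥0) : AEMeasurable (fun ω => gridMajorant scale (X · ω)) P :=
  aemeasurable_chainMajorant (fun t => hX (scale • t)) _ _

theorem eLpNorm_link_le {X : Space n → Ω → ℝ} {q Λ : ℝ≥0∞}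
    (hΛ : ∀ s t, eLpNorm (fun ω => X s ω - X t ω) q P ≤ Λ * ‖s - t‖ₑ) (scale : ℝ≥0) {k : ℕ}
    {p : Space n × Space n} (hp : p ∈ gridLinks n k) :
    eLpNorm (fun ω => X (scale • p.2) ω - X (scale • p.1) ω) q P ≤
      Λ * scale * n / 4 ^ k := by
  have hlen : ‖p.2 - p.1‖ₑ ≤ n / 4 ^ k := by
    rw [← ofReal_norm]
    refine (ENNReal.ofReal_le_ofReal (Finset.mem_filter.1 hp).2).trans_eq ?_
    rw [ENNReal.ofReal_div_of_pos (by positivity), ENNReal.ofReal_natCast,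
      ENNReal.ofReal_pow (by norm_num), ENNReal.ofReal_ofNat]
  calc eLpNorm (fun ω => X (scale • p.2) ω - X (scale • p.1) ω) q P
      ≤ Λ * ‖scale • p.2 - scale • p.1‖ₑ := hΛ _ _
    _ = Λ * scale * ‖p.2 - p.1‖ₑ := by
        rw [← smul_sub, NNReal.smul_def, enorm_smul, NNReal.enorm_eq, mul_assoc]
    _ ≤ Λ * scale * (n / 4 ^ k) := by gcongr
    _ = Λ * scale * n / 4 ^ k := (mul_div_assoc _ _ _).symm

theorem tsum_card_gridLinks_rpow_mul_le (n : ℕ) (c : ℝ≥0∞) :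
    ∑' k, ((gridLinks n k).card : ℝ≥0∞) ^ (chainingExponent n : ℝ)⁻¹ * (c / 4 ^ k) ≤ 8 * c :=
  (ENNReal.tsum_le_tsum fun k => mul_le_mul_left (card_gridLinks_rpow_le n k) _).trans_eq
    (tsum_two_pow_mul_div_four_pow c)

variable [IsProbabilityMeasure P]

theorem lintegral_gridMajorant_le {X : Space n → Ω → ℝ} (hX : ∀ s, AEMeasurable (X s) P)
    {Λ : ℝ≥0∞}
    (hΛ : ∀ s t, eLpNorm (fun ω => X s ω - X t ω) (chainingExponent n) P ≤ Λ * ‖s - t‖ₑ)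
    (scale : ℝ≥0) :
    ∫⁻ ω, gridMajorant scale (X · ω) ∂P ≤ 8 * (Λ * scale * n) :=
  (lintegral_chainMajorant_le (fun t => hX (scale • t)) (chainingExponent_ne_zero n)
    fun _ _ => eLpNorm_link_le hΛ scale).trans (tsum_card_gridLinks_rpow_mul_le n _)

theorem tendsto_lintegral_gridMajorant {X : ℕ → Space n → Ω → ℝ}
    (hX : ∀ m s, AEMeasurable (X m s) P) {Λ : ℝ≥0∞} (hΛ_top : Λ ≠ ∞)
    (hΛ : ∀ m s t, eLpNorm (fun ω => X m s ω - X m t ω) (chainingExponent n) P ≤ Λ * ‖s - t‖ₑ)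
    (hlim : ∀ s t,
      Tendsto (fun m => eLpNorm (fun ω => X m s ω - X m t ω) (chainingExponent n) P) atTop (𝓝 0))
    (scale : ℝ≥0) :
    Tendsto (fun m => ∫⁻ ω, gridMajorant scale (X m · ω) ∂P) atTop (𝓝 0) := by
  refine tendsto_lintegral_chainMajorant (fun m t => hX m (scale • t))
    (chainingExponent_ne_zero n) (fun m _ _ => eLpNorm_link_le (hΛ m) scale) ?_ fun s t => hlim _ _
  refine ne_top_of_le_ne_top ?_ (tsum_card_gridLinks_rpow_mul_le n _)
  finiteness

end Grid

section AverageBounds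

variable {E : Type*} {b : ℕ → E} {m : ℕ} {φ ψ w : E → ℝ}

theorem average_mono (h : ∀ z, φ z ≤ ψ z) : average b m φ ≤ average b m ψ := by
  unfold average
  gcongr with i _
  exact h (b i)

theorem average_mul_add_const (hm : m ≠ 0) (b : ℕ → E) (φ : E → ℝ) (c d : ℝ) :
    average b m (fun z => c * φ z + d) = c * average b m φ + d := by
  have hm' : (m : ℝ) ≠ 0 := Nat.cast_ne_zero.2 hm
  simp only [average, Finset.sum_add_distrib, ← Finset.mul_sum, Finset.sum_const,
    Finset.card_range, nsmul_eq_mul]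
  field_simp

theorem abs_average_sub_le (h : ∀ z, |φ z - ψ z| ≤ w z) :
    |average b m φ - average b m ψ| ≤ average b m w := by
  rw [← average_sub, average, abs_mul, abs_of_nonneg (by positivity), average]
  gcongr
  exact (Finset.abs_sum_le_sum_abs _ _).trans (Finset.sum_le_sum fun i _ => h (b i))

end AverageBounds

section NullDiscontinuity

variable {E : Type*} [MetricSpace E] {x : E}

/-- A continuous cutoff vanishing at `x` and equal to `1` at distance at least `1 / (k + 1)`
from `x`. -/
def cutoff (x : E) (k : ℕ) (z : E) : ℝ := min 1 ((k + 1) * dist z x)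

theorem cutoff_nonneg (x : E) (k : ℕ) (z : E) : 0 ≤ cutoff x k z :=
  le_min zero_le_one (by positivity)

theorem cutoff_le_one (x : E) (k : ℕ) (z : E) : cutoff x k z ≤ 1 := min_le_left _ _

theorem continuous_cutoff (x : E) (k : ℕ) : Continuous (cutoff x k) := by
  unfold cutoff
  fun_prop

theorem eventually_cutoff_eq_one {z : E} (hz : z ≠ x) : ∀ᶠ k in atTop, cutoff x k z = 1 := by
  have hlim : Tendsto (fun k : ℕ => ((k : ℝ) + 1) * dist z x) atTop atTop :=
    (tendsto_atTop_add_const_right _ _ tendsto_natCast_atTop_atTop).atTop_mul_const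
      (dist_pos.2 hz)
  filter_upwards [hlim.eventually_ge_atTop 1] with k hk
  exact min_eq_left hk

theorem continuous_mul_cutoff {φ : E → ℝ} {C : ℝ} (hφC : ∀ z, |φ z| ≤ C)
    (hφ : ∀ z, z ≠ x → ContinuousAt φ z) (k : ℕ) : Continuous fun z => φ z * cutoff x k z := by
  refine continuous_iff_continuousAt.2 fun z => ?_
  rcases ne_or_eq z x with hz | rfl
  · exact (hφ z hz).mul (continuous_cutoff x k).continuousAt
  have hzero : cutoff z k z = 0 := by simp [cutoff]
  have hlim : Tendsto (cutoff z k) (𝓝 z) (𝓝 0) := hzero ▸ (continuous_cutoff z k).tendsto z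
  rw [ContinuousAt, hzero, mul_zero]
  exact bdd_le_mul_tendsto_zero' C (.of_forall hφC) hlim

variable [MeasurableSpace E] [BorelSpace E] {μ : Measure E}

theorem aestronglyMeasurable_of_continuousAt_compl (hμ : μ {x} = 0) {φ : E → ℝ}
    (hφ : ∀ z, z ≠ x → ContinuousAt φ z) : AEStronglyMeasurable φ μ := by
  rw [← Measure.restrict_eq_self_of_ae_mem (compl_mem_ae_iff.2 hμ)]
  exact ContinuousOn.aestronglyMeasurable (fun z hz => (hφ z hz).continuousWithinAt)
    (measurableSet_singleton x).compl

variable [IsFiniteMeasure μ]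

theorem tendsto_integral_one_sub_cutoff (hμ : μ {x} = 0) :
    Tendsto (fun k => ∫ z, (1 - cutoff x k z) ∂μ) atTop (𝓝 0) := by
  rw [← integral_zero E ℝ (μ := μ)]
  refine tendsto_integral_of_dominated_convergence (fun _ => 1) (fun k => ?_)
    (integrable_const 1) (fun k => ae_of_all _ fun z => ?_) ?_
  · exact (continuous_const.sub (continuous_cutoff x k)).aestronglyMeasurable
  · rw [Real.norm_eq_abs, abs_le]
    constructor <;> linarith [cutoff_nonneg x k z, cutoff_le_one x k z]
  · filter_upwards [compl_mem_ae_iff.2 hμ] with z hz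
    refine tendsto_const_nhds.congr' ((eventually_cutoff_eq_one hz).mono fun k hk => ?_)
    exact (sub_eq_zero.2 hk.symm).symm

variable [ProperSpace E] {b : ℕ → E}

theorem IsEquidistributed.tendsto_average_of_approx (hb : IsEquidistributed b μ) {φ : E → ℝ}
    (hφ : Integrable φ μ)
    (happrox : ∀ ε > 0, ∃ ψ w : E → ℝ, Continuous ψ ∧ Continuous w ∧
      (∀ z, |φ z - ψ z| ≤ w z) ∧ ∫ z, w z ∂μ < ε) :
    Tendsto (fun m => average b m φ) atTop (𝓝 (∫ z, φ z ∂μ)) := by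
  refine Metric.tendsto_nhds.2 fun ε hε => ?_
  obtain ⟨ψ, w, hψ, hw, hle, hsmall⟩ := happrox (ε / 3) (by positivity)
  have hintegral : |∫ z, ψ z ∂μ - ∫ z, φ z ∂μ| ≤ ∫ z, w z ∂μ := by
    have hψ' := hb.integrable_of_continuous hψ
    rw [← integral_sub hψ' hφ]
    refine abs_integral_le_integral_abs.trans
      (integral_mono (hψ'.sub hφ).abs (hb.integrable_of_continuous hw) fun z => ?_)
    simpa only [abs_sub_comm] using hle z
  filter_upwards [Metric.tendsto_nhds.1 (hb.tendsto_average hψ) (ε / 3) (by positivity),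
    (hb.tendsto_average hw).eventually_lt_const hsmall] with m hψm hwm
  rw [Real.dist_eq] at hψm ⊢
  calc |average b m φ - ∫ z, φ z ∂μ|
      = |(average b m φ - average b m ψ) + (average b m ψ - ∫ z, ψ z ∂μ) +
          (∫ z, ψ z ∂μ - ∫ z, φ z ∂μ)| := by congr 1; ring
    _ ≤ _ := abs_add_three _ _ _
    _ < ε := by linarith [abs_average_sub_le (b := b) (m := m) hle]

theorem IsEquidistributed.tendsto_average_of_continuousAt_compl (hb : IsEquidistributed b μ)
    (hμ : μ {x} = 0) {φ : E → ℝ} {C : ℝ} (hφC : ∀ z, |φ z| ≤ C)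
    (hφ : ∀ z, z ≠ x → ContinuousAt φ z) :
    Tendsto (fun m => average b m φ) atTop (𝓝 (∫ z, φ z ∂μ)) := by
  refine hb.tendsto_average_of_approx (.of_bound
    (aestronglyMeasurable_of_continuousAt_compl hμ hφ) C (ae_of_all _ hφC)) fun ε hε => ?_
  have hlim : Tendsto (fun k => ∫ z, C * (1 - cutoff x k z) ∂μ) atTop (𝓝 0) := by
    simpa only [integral_const_mul, mul_zero] using
      (tendsto_integral_one_sub_cutoff hμ).const_mul C
  obtain ⟨k, hk⟩ := (hlim.eventually_lt_const hε).exists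
  refine ⟨_, _, continuous_mul_cutoff hφC hφ k,
    continuous_const.mul (continuous_const.sub (continuous_cutoff x k)), fun z => ?_, hk⟩
  have hnonneg : 0 ≤ 1 - cutoff x k z := sub_nonneg.2 (cutoff_le_one x k z)
  rw [← mul_one_sub, abs_mul, abs_of_nonneg hnonneg]
  exact mul_le_mul_of_nonneg_right (hφC z) hnonneg

end NullDiscontinuity

/-! ### First-order expansion of the range differences -/

section Expansion

variable {n : ℕ} {xo : Space n}

/-- The gradient at `xo` of the range difference `rangeDiff z`; at the singularity `z = xo` the
first term is the junk value `0`. -/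
def rangeDiffGrad (xo z : Space n) : Space n := ‖xo - z‖⁻¹ • (xo - z) - ‖xo‖⁻¹ • xo

/-- The increment of the range difference `rangeDiff z` from `xo` to `xo + h`. -/
def rangeDiffIncr (xo z h : Space n) : ℝ := rangeDiff z (xo + h) - rangeDiff z xo

/-- The remainder of the first-order expansion at `xo` of the range difference `rangeDiff z`. -/
def rangeDiffRem (xo z h : Space n) : ℝ := rangeDiffIncr xo z h - inner ℝ (rangeDiffGrad xo z) h

theorem norm_rangeDiffGrad_le (xo z : Space n) : ‖rangeDiffGrad xo z‖ ≤ 2 := by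
  have hunit (y : Space n) : ‖‖y‖⁻¹ • y‖ ≤ 1 := by
    rw [norm_smul, norm_inv, norm_norm]
    exact inv_mul_le_one
  exact (norm_sub_le _ _).trans (by linarith [hunit (xo - z), hunit xo])

theorem abs_inner_rangeDiffGrad_le (xo z h : Space n) :
    |inner ℝ (rangeDiffGrad xo z) h| ≤ 2 * ‖h‖ :=
  (abs_real_inner_le_norm _ _).trans
    (mul_le_mul_of_nonneg_right (norm_rangeDiffGrad_le xo z) (norm_nonneg h))

theorem abs_rangeDiffIncr_sub_le (xo z h h' : Space n) :
    |rangeDiffIncr xo z h - rangeDiffIncr xo z h'| ≤ 2 * ‖h - h'‖ := by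
  simpa [rangeDiffIncr] using abs_rangeDiff_sub_right_le z (xo + h) (xo + h')

@[simp]
theorem rangeDiffIncr_zero (xo z : Space n) : rangeDiffIncr xo z 0 = 0 := by
  simp [rangeDiffIncr]

@[simp]
theorem rangeDiffRem_zero (xo z : Space n) : rangeDiffRem xo z 0 = 0 := by
  simp [rangeDiffRem]

theorem abs_rangeDiffRem_sub_le (xo z h h' : Space n) :
    |rangeDiffRem xo z h - rangeDiffRem xo z h'| ≤ 4 * ‖h - h'‖ := by
  have hsplit : rangeDiffRem xo z h - rangeDiffRem xo z h' =
      (rangeDiffIncr xo z h - rangeDiffIncr xo z h') -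
        inner ℝ (rangeDiffGrad xo z) (h - h') := by
    rw [rangeDiffRem, rangeDiffRem, inner_sub_right]
    ring
  rw [hsplit]
  refine (abs_sub _ _).trans ?_
  linarith [abs_rangeDiffIncr_sub_le xo z h h', abs_inner_rangeDiffGrad_le xo z (h - h')]

theorem abs_rangeDiffRem_le (xo z h : Space n) : |rangeDiffRem xo z h| ≤ 4 * ‖h‖ := by
  simpa using abs_rangeDiffRem_sub_le xo z h 0

theorem abs_rangeDiffRem_le_sq {z : Space n} (hxo : xo ≠ 0) (hz : z ≠ xo) (h : Space n) :
    |rangeDiffRem xo z h| ≤ (1 / (2 * ‖xo - z‖) + 1 / (2 * ‖xo‖)) * ‖h‖ ^ 2 := by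
  have hsplit : rangeDiffRem xo z h =
      (‖xo - z + h‖ - ‖xo - z‖ - inner ℝ (xo - z) h / ‖xo - z‖) -
        (‖xo + h‖ - ‖xo‖ - inner ℝ xo h / ‖xo‖) := by
    rw [rangeDiffRem, rangeDiffIncr, rangeDiff, rangeDiff, rangeDiffGrad, inner_sub_left,
      real_inner_smul_left, real_inner_smul_left, norm_sub_rev z (xo + h), norm_sub_rev z xo,
      show xo + h - z = xo - z + h by abel]
    ring
  rw [hsplit]
  refine (abs_sub _ _).trans ((add_le_add
    (abs_norm_add_sub_norm_sub_inner_div_le (sub_ne_zero.2 hz.symm) h)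
    (abs_norm_add_sub_norm_sub_inner_div_le hxo h)).trans_eq ?_)
  ring

theorem hasFDerivAt_rangeDiff {z : Space n} (hxo : xo ≠ 0) (hz : z ≠ xo) :
    HasFDerivAt (rangeDiff z) (innerSL ℝ (rangeDiffGrad xo z)) xo := by
  rw [hasFDerivAt_iff_isLittleO_nhds_zero]
  have hquadratic : (fun h => rangeDiff z (xo + h) - rangeDiff z xo -
      innerSL ℝ (rangeDiffGrad xo z) h) =O[𝓝 0] fun h => ‖h‖ ^ 2 :=
    Asymptotics.IsBigO.of_bound (1 / (2 * ‖xo - z‖) + 1 / (2 * ‖xo‖)) (.of_forall fun h => by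
      simpa [rangeDiffRem, rangeDiffIncr] using abs_rangeDiffRem_le_sq hxo hz h)
  exact hquadratic.trans_isLittleO (Asymptotics.isLittleO_norm_pow_id one_lt_two)

theorem partialRangeDiff_eq {a : ℕ → Space n} {i : ℕ} (hxo : xo ≠ 0) (hz : a i ≠ xo)
    (j : Fin n) : partialRangeDiff a xo j i = rangeDiffGrad xo (a i) j := by
  rw [partialRangeDiff, (hasFDerivAt_rangeDiff hxo hz).fderiv]
  simp [EuclideanSpace.inner_single_right]

theorem continuousAt_rangeDiffGrad {z : Space n} (hz : z ≠ xo) :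
    ContinuousAt (rangeDiffGrad xo) z := by
  have : ‖xo - z‖ ≠ 0 := norm_ne_zero_iff.2 (sub_ne_zero.2 hz.symm)
  unfold rangeDiffGrad
  fun_prop (disch := assumption)

theorem abs_rangeDiffRem_le_of_half_lt_cutoff (hxo : xo ≠ 0) {k : ℕ} {z : Space n}
    (hz : 1 / 2 < cutoff xo k z) (h : Space n) :
    |rangeDiffRem xo z h| ≤ (k + 1 + 1 / (2 * ‖xo‖)) * ‖h‖ ^ 2 := by
  have hfar : 1 / 2 < (k + 1) * ‖xo - z‖ := by
    rw [norm_sub_rev, ← dist_eq_norm]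
    exact hz.trans_le (min_le_right _ _)
  have hne : z ≠ xo := by
    rintro rfl
    norm_num at hfar
  have hpos : 0 < ‖xo - z‖ := norm_pos_iff.2 (sub_ne_zero.2 hne.symm)
  refine (abs_rangeDiffRem_le_sq hxo hne h).trans ?_
  gcongr
  rw [div_le_iff₀ (by positivity)]
  linarith

theorem rangeDiffRem_sq_le_cutoff (hxo : xo ≠ 0) (k : ℕ) (z h : Space n) :
    rangeDiffRem xo z h ^ 2 ≤ 32 * ‖h‖ ^ 2 * (1 - cutoff xo k z) +
      ((k + 1 + 1 / (2 * ‖xo‖)) * ‖h‖ ^ 2) ^ 2 := by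
  have hnonneg : 0 ≤ 1 - cutoff xo k z := sub_nonneg.2 (cutoff_le_one xo k z)
  rcases le_or_gt (cutoff xo k z) (1 / 2) with hnear | hfar
  · have hsq : rangeDiffRem xo z h ^ 2 ≤ (4 * ‖h‖) ^ 2 :=
      sq_le_sq.2 ((abs_rangeDiffRem_le xo z h).trans (le_abs_self _))
    nlinarith [sq_nonneg ‖h‖, sq_nonneg ((k + 1 + 1 / (2 * ‖xo‖)) * ‖h‖ ^ 2)]
  · have hsq : rangeDiffRem xo z h ^ 2 ≤ ((k + 1 + 1 / (2 * ‖xo‖)) * ‖h‖ ^ 2) ^ 2 :=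
      sq_le_sq.2 ((abs_rangeDiffRem_le_of_half_lt_cutoff hxo hfar h).trans (le_abs_self _))
    linarith [show 0 ≤ 32 * ‖h‖ ^ 2 * (1 - cutoff xo k z) by positivity]

theorem IsEquidistributed.exists_average_rangeDiffRem_sq_le {b : ℕ → Space n}
    {μ : Measure (Space n)} [IsFiniteMeasure μ] (hb : IsEquidistributed b μ) (hμ : μ {xo} = 0)
    (hxo : xo ≠ 0) {ε : ℝ} (hε : 0 < ε) :
    ∃ δ > 0, ∀ᶠ m in atTop, ∀ h : Space n, ‖h‖ ≤ δ →
      average b m (fun z => rangeDiffRem xo z h ^ 2) ≤ ε * ‖h‖ ^ 2 := by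
  obtain ⟨k, hk⟩ := ((tendsto_integral_one_sub_cutoff hμ).eventually_lt_const
    (show 0 < ε / 64 by positivity)).exists
  set D : ℝ := k + 1 + 1 / (2 * ‖xo‖)
  have hD : 0 < D := by positivity
  refine ⟨√(ε / 2) / D, by positivity, ?_⟩
  have hcutoff : Tendsto (fun m => average b m fun z => 1 - cutoff xo k z) atTop
      (𝓝 (∫ z, (1 - cutoff xo k z) ∂μ)) :=
    hb.tendsto_average (continuous_const.sub (continuous_cutoff xo k))
  filter_upwards [hcutoff.eventually_lt_const hk, eventually_ne_atTop 0] with m hm hm0 h hh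
  have hfar : (D * ‖h‖ ^ 2) ^ 2 ≤ ε / 2 * ‖h‖ ^ 2 := by
    have hDh : D * ‖h‖ ≤ √(ε / 2) := by rwa [le_div_iff₀ hD, mul_comm] at hh
    calc (D * ‖h‖ ^ 2) ^ 2 = (D * ‖h‖) ^ 2 * ‖h‖ ^ 2 := by ring
      _ ≤ √(ε / 2) ^ 2 * ‖h‖ ^ 2 := by gcongr
      _ = ε / 2 * ‖h‖ ^ 2 := by rw [Real.sq_sqrt (by positivity)]
  calc average b m (fun z => rangeDiffRem xo z h ^ 2)
      ≤ average b m (fun z => 32 * ‖h‖ ^ 2 * (1 - cutoff xo k z) + (D * ‖h‖ ^ 2) ^ 2) :=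
        average_mono fun z => rangeDiffRem_sq_le_cutoff hxo k z h
    _ = 32 * ‖h‖ ^ 2 * average b m (fun z => 1 - cutoff xo k z) + (D * ‖h‖ ^ 2) ^ 2 :=
        average_mul_add_const hm0 _ _ _ _
    _ ≤ 32 * ‖h‖ ^ 2 * (ε / 64) + ε / 2 * ‖h‖ ^ 2 := by gcongr
    _ = ε * ‖h‖ ^ 2 := by ring

end Expansion

/-! ### The Gram matrix of the gradients -/

section Gram

variable {n : ℕ} {b : ℕ → Space n} {μ : Measure (Space n)} {xo : Space n}

/-- The matrix of second moments under `μ` of the gradient at `xo` of the range difference: the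
matrix `M(xo)` of the limit theorem. -/
def gramMatrix (μ : Measure (Space n)) (xo : Space n) : Matrix (Fin n) (Fin n) ℝ :=
  Matrix.of fun j k => ∫ z, rangeDiffGrad xo z j * rangeDiffGrad xo z k ∂μ

/-- The operator on `Space n` with matrix `gramMatrix μ xo`. -/
def gramOperator (μ : Measure (Space n)) (xo : Space n) : Space n →L[ℝ] Space n :=
  Matrix.toEuclideanCLM (𝕜 := ℝ) (gramMatrix μ xo)

theorem average_inner_rangeDiffGrad_sq (m : ℕ) (h : Space n) :
    average b m (fun z => inner ℝ (rangeDiffGrad xo z) h ^ 2) =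
      inner ℝ h (Matrix.toEuclideanCLM (𝕜 := ℝ) (Matrix.of fun j k =>
        average b m fun z => rangeDiffGrad xo z j * rangeDiffGrad xo z k) h) := by
  have hsq (z : Space n) : inner ℝ (rangeDiffGrad xo z) h ^ 2 =
      ∑ j, ∑ k, h j * (rangeDiffGrad xo z j * rangeDiffGrad xo z k * h k) := by
    rw [sq, PiLp.inner_apply, Finset.sum_mul_sum]
    refine Finset.sum_congr rfl fun j _ => Finset.sum_congr rfl fun k _ => ?_
    simp only [RCLike.inner_apply, conj_trivial]
    ring
  simp only [Matrix.inner_toEuclideanCLM, dotProduct, Matrix.mulVec, Matrix.of_apply, average, hsq]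
  rw [Finset.sum_comm, Finset.mul_sum]
  refine Finset.sum_congr rfl fun j _ => ?_
  rw [Finset.sum_comm, Finset.mul_sum, Finset.mul_sum]
  refine Finset.sum_congr rfl fun k _ => ?_
  rw [← Finset.mul_sum, ← Finset.sum_mul]
  ring

variable [IsFiniteMeasure μ]

theorem IsEquidistributed.tendsto_average_rangeDiffGrad_mul (hb : IsEquidistributed b μ)
    (hμ : μ {xo} = 0) (j k : Fin n) :
    Tendsto (fun m => average b m fun z => rangeDiffGrad xo z j * rangeDiffGrad xo z k) atTop
      (𝓝 (gramMatrix μ xo j k)) := by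
  have hbound (z : Space n) (j : Fin n) : |rangeDiffGrad xo z j| ≤ 2 :=
    (PiLp.norm_apply_le (rangeDiffGrad xo z) j).trans (norm_rangeDiffGrad_le xo z)
  refine hb.tendsto_average_of_continuousAt_compl hμ (C := 2 * 2) (fun z => ?_) fun z hz => ?_
  · rw [abs_mul]
    exact mul_le_mul (hbound z j) (hbound z k) (abs_nonneg _) (by norm_num)
  · have hcont (j : Fin n) : ContinuousAt (fun z => rangeDiffGrad xo z j) z :=
      (EuclideanSpace.proj (𝕜 := ℝ) j).continuous.continuousAt.comp
        (continuousAt_rangeDiffGrad hz)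
    exact (hcont j).mul (hcont k)

theorem IsEquidistributed.eventually_abs_average_inner_rangeDiffGrad_sq_sub_le
    (hb : IsEquidistributed b μ) (hμ : μ {xo} = 0) {ε : ℝ} (hε : 0 < ε) :
    ∀ᶠ m in atTop, ∀ h : Space n,
      |average b m (fun z => inner ℝ (rangeDiffGrad xo z) h ^ 2) -
        inner ℝ h (gramOperator μ xo h)| ≤ ε * ‖h‖ ^ 2 := by
  have hcont : Continuous (Matrix.toEuclideanCLM (n := Fin n) (𝕜 := ℝ)) :=
    LinearMap.continuous_of_finiteDimensional
      (Matrix.toEuclideanCLM (n := Fin n) (𝕜 := ℝ)).toAlgEquiv.toLinearMap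
  have hlim : Tendsto (fun m => Matrix.toEuclideanCLM (𝕜 := ℝ) (Matrix.of fun j k =>
      average b m fun z => rangeDiffGrad xo z j * rangeDiffGrad xo z k)) atTop
      (𝓝 (gramOperator μ xo)) :=
    (hcont.tendsto _).comp (tendsto_pi_nhds.2 fun j => tendsto_pi_nhds.2 fun k =>
      hb.tendsto_average_rangeDiffGrad_mul hμ j k)
  filter_upwards [Metric.tendsto_nhds.1 hlim ε hε] with m hm h
  rw [dist_eq_norm] at hm
  rw [average_inner_rangeDiffGrad_sq, ← inner_sub_right, ← sub_apply]
  calc _ ≤ ‖h‖ * (ε * ‖h‖) := (abs_real_inner_le_norm _ _).trans (mul_le_mul_of_nonneg_left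
        (ContinuousLinearMap.le_of_opNorm_le _ hm.le h) (norm_nonneg h))
    _ = ε * ‖h‖ ^ 2 := by ring

theorem abs_add_sq_sub_sq_le {t : ℝ} (ht : 0 < t) (p ρ : ℝ) :
    |(p + ρ) ^ 2 - p ^ 2| ≤ t * p ^ 2 + (1 + 1 / t) * ρ ^ 2 := by
  have hcross : |2 * p * ρ| ≤ t * p ^ 2 + 1 / t * ρ ^ 2 := by
    have hadd : 0 ≤ (t * p + ρ) ^ 2 / t := by positivity
    have hsub : 0 ≤ (t * p - ρ) ^ 2 / t := by positivity
    field_simp at hadd hsub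
    rw [abs_le]
    constructor <;> field_simp <;> linarith
  rw [show (p + ρ) ^ 2 - p ^ 2 = 2 * p * ρ + ρ ^ 2 by ring]
  refine (abs_add_le _ _).trans ?_
  rw [abs_of_nonneg (sq_nonneg ρ)]
  linarith

theorem IsEquidistributed.exists_abs_average_rangeDiffIncr_sq_sub_le
    (hb : IsEquidistributed b μ) (hμ : μ {xo} = 0) (hxo : xo ≠ 0) {ε : ℝ} (hε : 0 < ε) :
    ∃ δ > 0, ∀ᶠ m in atTop, ∀ h : Space n, ‖h‖ ≤ δ →
      |average b m (fun z => rangeDiffIncr xo z h ^ 2) - inner ℝ h (gramOperator μ xo h)| ≤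
        ε * ‖h‖ ^ 2 := by
  set t : ℝ := ε / 12
  have ht : 0 < t := by positivity
  obtain ⟨δ, hδ, hrem⟩ := hb.exists_average_rangeDiffRem_sq_le hμ hxo
    (show 0 < ε / 3 / (1 + 1 / t) by positivity)
  refine ⟨δ, hδ, ?_⟩
  filter_upwards [hrem, hb.eventually_abs_average_inner_rangeDiffGrad_sq_sub_le hμ
    (show 0 < ε / 3 by positivity), eventually_ne_atTop 0] with m hrem hgram hm h hh
  have hpoint (z : Space n) :
      |rangeDiffIncr xo z h ^ 2 - inner ℝ (rangeDiffGrad xo z) h ^ 2| ≤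
        (1 + 1 / t) * rangeDiffRem xo z h ^ 2 + ε / 3 * ‖h‖ ^ 2 := by
    have hgrad : inner ℝ (rangeDiffGrad xo z) h ^ 2 ≤ (2 * ‖h‖) ^ 2 :=
      sq_le_sq.2 ((abs_inner_rangeDiffGrad_le xo z h).trans (le_abs_self _))
    have hsplit := abs_add_sq_sub_sq_le ht (inner ℝ (rangeDiffGrad xo z) h) (rangeDiffRem xo z h)
    rw [rangeDiffRem, add_sub_cancel, ← rangeDiffRem] at hsplit
    linarith [mul_le_mul_of_nonneg_left hgrad ht.le,
      show t * (2 * ‖h‖) ^ 2 = ε / 3 * ‖h‖ ^ 2 by ring]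
  have hlinear := abs_average_sub_le (b := b) (m := m) hpoint
  rw [average_mul_add_const hm] at hlinear
  have hsmall : (1 + 1 / t) * average b m (fun z => rangeDiffRem xo z h ^ 2) ≤
      ε / 3 * ‖h‖ ^ 2 :=
    calc _ ≤ (1 + 1 / t) * (ε / 3 / (1 + 1 / t) * ‖h‖ ^ 2) := by gcongr; exact hrem h hh
      _ = ε / 3 * ‖h‖ ^ 2 := by field_simp
  refine (abs_sub_le _ (average b m fun z => inner ℝ (rangeDiffGrad xo z) h ^ 2) _).trans ?_
  linarith [hgram h]

theorem IsEquidistributed.tendsto_average_inner_rangeDiffGrad_sq (hb : IsEquidistributed b μ)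
    (hμ : μ {xo} = 0) (h : Space n) :
    Tendsto (fun m => average b m fun z => inner ℝ (rangeDiffGrad xo z) h ^ 2) atTop
      (𝓝 (inner ℝ h (gramOperator μ xo h))) := by
  refine Metric.tendsto_nhds.2 fun ε hε => ?_
  filter_upwards [hb.eventually_abs_average_inner_rangeDiffGrad_sq_sub_le hμ
    (show 0 < ε / (‖h‖ ^ 2 + 1) by positivity)] with m hm
  refine (hm h).trans_lt ?_
  rw [div_mul_eq_mul_div, div_lt_iff₀ (by positivity)]
  linarith

theorem abs_inner_rangeDiffGrad_sq_le (xo z h : Space n) :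
    |inner ℝ (rangeDiffGrad xo z) h ^ 2| ≤ (2 * ‖h‖) ^ 2 := by
  rw [abs_pow]
  gcongr
  exact abs_inner_rangeDiffGrad_le xo z h

theorem continuousAt_inner_rangeDiffGrad_sq {z : Space n} (hz : z ≠ xo) (h : Space n) :
    ContinuousAt (fun z => inner ℝ (rangeDiffGrad xo z) h ^ 2) z :=
  (ContinuousAt.inner (𝕜 := ℝ) (continuousAt_rangeDiffGrad hz) continuousAt_const).pow 2

theorem IsEquidistributed.inner_gramOperator_self (hb : IsEquidistributed b μ) (hμ : μ {xo} = 0)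
    (h : Space n) :
    inner ℝ h (gramOperator μ xo h) = ∫ z, inner ℝ (rangeDiffGrad xo z) h ^ 2 ∂μ :=
  tendsto_nhds_unique (hb.tendsto_average_inner_rangeDiffGrad_sq hμ h)
    (hb.tendsto_average_of_continuousAt_compl hμ (fun z => abs_inner_rangeDiffGrad_sq_le xo z h)
      fun _ hz => continuousAt_inner_rangeDiffGrad_sq hz h)

theorem inner_rangeDiffGrad_eq_zero_iff {z h : Space n} (hz : z ≠ xo) :
    inner ℝ (rangeDiffGrad xo z) h = 0 ↔
      inner ℝ h (xo - z) = inner ℝ h xo / ‖xo‖ * ‖xo - z‖ := by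
  have hz' : ‖xo - z‖ ≠ 0 := norm_ne_zero_iff.2 (sub_ne_zero.2 hz.symm)
  rw [rangeDiffGrad, inner_sub_left, real_inner_smul_left, real_inner_smul_left, sub_eq_zero,
    real_inner_comm, real_inner_comm h xo, inv_mul_eq_iff_eq_mul₀ hz', inv_mul_eq_div, mul_comm]

theorem IsEquidistributed.inner_gramOperator_self_pos {μ : Measure (Space n)}
    [IsProbabilityMeasure μ] (hb : IsEquidistributed b μ) (hn : 2 ≤ n) (hμ : μ {xo} = 0)
    (hxo : xo ≠ 0) (h_hyperplane : ∀ S : Set (Space n), IsHyperplane S → μ S ≠ 1)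
    (h_cone : ∀ S, IsConeWithVertex xo S → (0 : Space n) ∈ S → μ S ≠ 1)
    {h : Space n} (hh : h ≠ 0) : 0 < inner ℝ h (gramOperator μ xo h) := by
  rw [hb.inner_gramOperator_self hμ]
  refine (integral_nonneg fun z => sq_nonneg _).lt_of_ne' fun hzero => ?_
  have hint : Integrable (fun z => inner ℝ (rangeDiffGrad xo z) h ^ 2) μ :=
    .of_bound (aestronglyMeasurable_of_continuousAt_compl hμ fun _ hz =>
      continuousAt_inner_rangeDiffGrad_sq hz h)
      ((2 * ‖h‖) ^ 2) (ae_of_all _ fun z => abs_inner_rangeDiffGrad_sq_le xo z h)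
  rw [integral_eq_zero_iff_of_nonneg (fun z => sq_nonneg _) hint] at hzero
  have hh' : ‖h‖ ≠ 0 := norm_ne_zero_iff.2 hh
  refine not_ae_inner_eq_mul_norm (μ := μ) (xo := xo) hn h_hyperplane h_cone hxo
    (v := ‖h‖⁻¹ • h) (c := inner ℝ (‖h‖⁻¹ • h) xo / ‖xo‖) ?_ ?_ ?_
  · rw [norm_smul, norm_inv, norm_norm, inv_mul_cancel₀ hh']
  · rw [div_mul_cancel₀ _ (norm_ne_zero_iff.2 hxo)]
  · filter_upwards [hzero, compl_mem_ae_iff.2 hμ] with z hz hzx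
    rw [← inner_rangeDiffGrad_eq_zero_iff hzx, inner_smul_right,
      pow_eq_zero_iff two_ne_zero |>.1 hz, mul_zero]

end Gram

section PositiveOperator

variable {E : Type*} [NormedAddCommGroup E] [InnerProductSpace ℝ E] [FiniteDimensional ℝ E]

theorem exists_mul_norm_sq_le_inner {G : E →L[ℝ] E}
    (hG : ∀ h, h ≠ 0 → 0 < inner ℝ h (G h)) : ∃ c > 0, ∀ h, c * ‖h‖ ^ 2 ≤ inner ℝ h (G h) := by
  rcases subsingleton_or_nontrivial E with hE | hE
  · exact ⟨1, one_pos, fun h => by simp [Subsingleton.elim h 0]⟩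
  obtain ⟨y, hy, hmin⟩ := (isCompact_sphere (0 : E) 1).exists_isMinOn
    (NormedSpace.sphere_nonempty.2 zero_le_one) (f := fun h => inner ℝ h (G h)) (by fun_prop)
  have hy0 : y ≠ 0 := ne_zero_of_mem_unit_sphere ⟨y, hy⟩
  refine ⟨inner ℝ y (G y), hG y hy0, fun h => ?_⟩
  rcases eq_or_ne h 0 with rfl | hh
  · simp
  have hh' : ‖h‖ ≠ 0 := norm_ne_zero_iff.2 hh
  have hmem : ‖h‖⁻¹ • h ∈ Metric.sphere (0 : E) 1 := by
    rw [mem_sphere_zero_iff_norm, norm_smul, norm_inv, norm_norm, inv_mul_cancel₀ hh']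
  calc inner ℝ y (G y) * ‖h‖ ^ 2 ≤ inner ℝ (‖h‖⁻¹ • h) (G (‖h‖⁻¹ • h)) * ‖h‖ ^ 2 := by
        gcongr
        exact hmin hmem
    _ = inner ℝ h (G h) := by
        rw [map_smul, real_inner_smul_left, real_inner_smul_right]
        field_simp

end PositiveOperator

section GramInverse

variable {n : ℕ} {μ : Measure (Space n)} {xo : Space n}

theorem gramMatrix_isHermitian (μ : Measure (Space n)) (xo : Space n) :
    (gramMatrix μ xo).IsHermitian := by
  ext j k
  simp [gramMatrix, mul_comm]

theorem gramMatrix_posDef (hpos : ∀ h : Space n, h ≠ 0 → 0 < inner ℝ h (gramOperator μ xo h)) :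
    (gramMatrix μ xo).PosDef :=
  .of_dotProduct_mulVec_pos (gramMatrix_isHermitian μ xo) fun x hx => by
    simpa only [gramOperator, Matrix.inner_toEuclideanCLM, star_trivial] using
      hpos (WithLp.toLp 2 x) (by simpa using hx)

theorem isSelfAdjoint_gramOperator (μ : Measure (Space n)) (xo : Space n) :
    IsSelfAdjoint (gramOperator μ xo) :=
  IsSelfAdjoint.map (gramMatrix_isHermitian μ xo) Matrix.toEuclideanCLM

/-- The operator on `Space n` whose matrix is the inverse of `gramMatrix μ xo`. -/
def gramInverse (μ : Measure (Space n)) (xo : Space n) : Space n →L[ℝ] Space n :=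
  Matrix.toEuclideanCLM (𝕜 := ℝ) (gramMatrix μ xo)⁻¹

theorem gramOperator_gramInverse (hM : (gramMatrix μ xo).PosDef) (z : Space n) :
    gramOperator μ xo (gramInverse μ xo z) = z := by
  have hmul : gramOperator μ xo * gramInverse μ xo = 1 := by
    rw [gramOperator, gramInverse, ← map_mul,
      Matrix.mul_nonsing_inv _ ((Matrix.isUnit_iff_isUnit_det _).1 hM.isUnit), map_one]
  exact DFunLike.congr_fun hmul z

end GramInverse

section CompletingTheSquare

variable {E : Type*} [NormedAddCommGroup E] [InnerProductSpace ℝ E] [CompleteSpace E]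

theorem inner_sub_apply_sub_eq {G : E →L[ℝ] E} (hG : IsSelfAdjoint G) (s t : E) :
    inner ℝ (s - t) (G (s - t)) =
      (inner ℝ s (G s) - 2 * inner ℝ (G t) s) - (inner ℝ t (G t) - 2 * inner ℝ (G t) t) := by
  have hsymm : inner ℝ t (G s) = inner ℝ (G t) s := (hG.isSymmetric t s).symm
  rw [map_sub, inner_sub_left, inner_sub_right, inner_sub_right, hsymm,
    real_inner_comm (G t) s, real_inner_comm (G t) t]
  ring

theorem mul_norm_sub_sq_le_of_quadratic_approx {G : E →L[ℝ] E} (hG : IsSelfAdjoint G) {c κ : ℝ}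
    (hcoer : ∀ h, c * ‖h‖ ^ 2 ≤ inner ℝ h (G h)) {f : E → ℝ} {s t : E}
    (hs : |f s - (inner ℝ s (G s) - 2 * inner ℝ (G t) s)| ≤ κ)
    (ht : |f t - (inner ℝ t (G t) - 2 * inner ℝ (G t) t)| ≤ κ) (hle : f s ≤ f t) :
    c * ‖s - t‖ ^ 2 ≤ 2 * κ := by
  linarith [hcoer (s - t), inner_sub_apply_sub_eq hG s t, (abs_le.1 hs).1, (abs_le.1 ht).2]

end CompletingTheSquare

/-! ### Bounds in probability -/

section BoundedInProbability

variable {Ω : Type*} [MeasurableSpace Ω] {P : Measure Ω} {Y Z : ℕ → Ω → ℝ≥0∞}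

/-- Boundedness in probability (tightness, `Y m = O_P(1)`) of a sequence of extended nonnegative
random variables; only large indices matter, and no measurability is required. -/
def BoundedInProbability (P : Measure Ω) (Y : ℕ → Ω → ℝ≥0∞) : Prop :=
  ∀ θ : ℝ≥0∞, θ ≠ 0 → ∃ ρ : ℝ≥0, ∀ᶠ m in atTop, P {ω | ρ < Y m ω} ≤ θ

theorem BoundedInProbability.of_lintegral_le (hY : ∀ m, AEMeasurable (Y m) P) {C : ℝ≥0∞}
    (hC : C ≠ ∞) (hle : ∀ m, ∫⁻ ω, Y m ω ∂P ≤ C) : BoundedInProbability P Y := by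
  intro θ hθ
  have hlim : Tendsto (fun k : ℕ => C / k) atTop (𝓝 0) :=
    ENNReal.Tendsto.const_div ENNReal.tendsto_nat_nhds_top (.inr hC) |>.trans_eq (by simp)
  obtain ⟨k, hk, hk0⟩ := ((hlim.eventually_le_const (pos_iff_ne_zero.2 hθ)).and
    (eventually_gt_atTop 0)).exists
  refine ⟨k, .of_forall fun m => ?_⟩
  calc P {ω | ((k : ℝ≥0) : ℝ≥0∞) < Y m ω} ≤ P {ω | (k : ℝ≥0∞) ≤ Y m ω} :=
        measure_mono fun ω hω => by simpa using hω.le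
    _ ≤ (∫⁻ ω, Y m ω ∂P) / k :=
        meas_ge_le_lintegral_div (hY m) (by exact_mod_cast hk0.ne') (ENNReal.natCast_ne_top k)
    _ ≤ C / k := ENNReal.div_le_div_right (hle m) _
    _ ≤ θ := hk

theorem BoundedInProbability.of_imp (hY : BoundedInProbability P Y) {B : ℕ → Set Ω}
    (hB : Tendsto (fun m => P (B m)) atTop (𝓝 0))
    (himp : ∀ ρ : ℝ≥0, ∃ ρ' : ℝ≥0, ∀ᶠ m in atTop, ∀ ω ∉ B m, Y m ω ≤ ρ → Z m ω ≤ ρ') :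
    BoundedInProbability P Z := by
  intro θ hθ
  obtain ⟨ρ, hρ⟩ := hY (θ / 2) (ENNReal.half_pos hθ).ne'
  obtain ⟨ρ', hρ'⟩ := himp ρ
  refine ⟨ρ', ?_⟩
  filter_upwards [hρ, hρ', ENNReal.tendsto_nhds_zero.1 hB _ (ENNReal.half_pos hθ)]
    with m hYm himpm hBm
  calc P {ω | ρ' < Z m ω} ≤ P ({ω | ρ < Y m ω} ∪ B m) := measure_mono fun ω hω => by
        by_contra hout
        rw [Set.mem_union, not_or] at hout
        exact hω.not_ge (himpm ω hout.2 (not_lt.1 hout.1))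
    _ ≤ θ / 2 + θ / 2 := (measure_union_le _ _).trans (add_le_add hYm hBm)
    _ = θ := ENNReal.add_halves θ

theorem BoundedInProbability.of_le (hY : BoundedInProbability P Y) {c : ℝ≥0}
    (hle : ∀ m ω, Z m ω ≤ c * Y m ω) : BoundedInProbability P Z :=
  hY.of_imp (B := fun _ => ∅) (by simp) fun ρ => ⟨c * ρ, .of_forall fun m ω _ hω => by
    push_cast
    exact (hle m ω).trans (by gcongr)⟩

theorem BoundedInProbability.sup (hY : BoundedInProbability P Y) (hZ : BoundedInProbability P Z) :
    BoundedInProbability P fun m ω => max (Y m ω) (Z m ω) := by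
  intro θ hθ
  obtain ⟨ρ, hρ⟩ := hY (θ / 2) (ENNReal.half_pos hθ).ne'
  obtain ⟨ρ', hρ'⟩ := hZ (θ / 2) (ENNReal.half_pos hθ).ne'
  refine ⟨max ρ ρ', ?_⟩
  filter_upwards [hρ, hρ'] with m hYm hZm
  calc P {ω | ((max ρ ρ' : ℝ≥0) : ℝ≥0∞) < max (Y m ω) (Z m ω)}
      ≤ P ({ω | ρ < Y m ω} ∪ {ω | ρ' < Z m ω}) := measure_mono fun ω hω => by
        rw [Set.mem_ofPred_eq, ENNReal.coe_max] at hω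
        exact (lt_max_iff.1 hω).imp (le_max_left _ _).trans_lt (le_max_right _ _).trans_lt
    _ ≤ θ / 2 + θ / 2 := (measure_union_le _ _).trans (add_le_add hYm hZm)
    _ = θ := ENNReal.add_halves θ

theorem BoundedInProbability.tendsto_measure (hY : BoundedInProbability P Y) {A : ℕ → Set Ω}
    (hA : ∀ ρ : ℝ≥0, Tendsto (fun m => P (A m ∩ {ω | Y m ω ≤ ρ})) atTop (𝓝 0)) :
    Tendsto (fun m => P (A m)) atTop (𝓝 0) := by
  refine ENNReal.tendsto_nhds_zero.2 fun θ hθ => ?_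
  obtain ⟨ρ, hρ⟩ := hY (θ / 2) (ENNReal.half_pos hθ.ne').ne'
  filter_upwards [hρ, ENNReal.tendsto_nhds_zero.1 (hA ρ) _ (ENNReal.half_pos hθ.ne')]
    with m hYm hAm
  calc P (A m) ≤ P (A m ∩ {ω | Y m ω ≤ ρ} ∪ {ω | ρ < Y m ω}) := measure_mono fun ω hω =>
        (le_or_gt (Y m ω) ρ).imp (fun hle => ⟨hω, hle⟩) id
    _ ≤ θ / 2 + θ / 2 := (measure_union_le _ _).trans (add_le_add hAm hYm)
    _ = θ := ENNReal.add_halves θ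

theorem tendsto_measure_ge_of_tendsto_lintegral (hY : ∀ m, AEMeasurable (Y m) P)
    (hlim : Tendsto (fun m => ∫⁻ ω, Y m ω ∂P) atTop (𝓝 0)) {κ : ℝ≥0∞} (hκ : κ ≠ 0)
    (hκ_top : κ ≠ ∞) : Tendsto (fun m => P {ω | κ ≤ Y m ω}) atTop (𝓝 0) := by
  refine tendsto_of_tendsto_of_tendsto_of_le_of_le tendsto_const_nhds ?_ (fun _ => zero_le)
    fun m => meas_ge_le_lintegral_div (hY m) hκ hκ_top
  simpa using ENNReal.Tendsto.div_const hlim (.inr hκ)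

theorem tendsto_measure_lt_of_ae_eventually_le [IsFiniteMeasure P] {f g : ℕ → Ω → ℝ}
    (hf : ∀ m, AEMeasurable (f m) P) (hg : ∀ m, AEMeasurable (g m) P)
    (hle : ∀ᵐ ω ∂P, ∀ᶠ m in atTop, f m ω ≤ g m ω) :
    Tendsto (fun m => P {ω | g m ω < f m ω}) atTop (𝓝 0) := by
  have hind : TendstoInMeasure P (fun m => {ω | g m ω < f m ω}.indicator (1 : Ω → ℝ)) atTop 0 := by
    refine tendstoInMeasure_of_tendsto_ae (fun m => (aestronglyMeasurable_const
      (b := (1 : ℝ))).indicator₀ (nullMeasurableSet_lt (hg m) (hf m))) ?_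
    filter_upwards [hle] with ω hω
    exact tendsto_const_nhds.congr' (hω.mono fun m hm => by simp [hm.not_gt])
  refine (tendstoInMeasure_iff_norm.1 hind 1 one_pos).congr fun m => congrArg P ?_
  ext ω
  by_cases hω : g m ω < f m ω <;> simp [hω]

end BoundedInProbability

/-! ### Weighted noise on the local scale -/

section GrowthMajorant

variable {n : ℕ}

/-- A majorant controlling `f` at all scales `4 ^ j` simultaneously, weighted so that it
bounds the growth of `f` by `‖s‖ ^ (3 / 2)`. -/
def growthMajorant (f : Space n → ℝ) : ℝ≥0∞ := ∑' j : ℕ, 8⁻¹ ^ j * gridMajorant (4 ^ j) f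

theorem sq_le_of_growthMajorant_le {f : Space n → ℝ} (hf : Continuous f) (h0 : f 0 = 0) {τ : ℝ≥0}
    (hτ : growthMajorant f ≤ τ) {s : Space n} (hs : 1 ≤ ‖s‖) :
    f s ^ 2 ≤ 512 * τ ^ 2 * ‖s‖ ^ 3 := by
  obtain ⟨j, hj_le, hj_lt⟩ := exists_nat_pow_near (by linarith : 1 ≤ 2 * ‖s‖)
    (by norm_num : (1 : ℝ) < 4)
  have hbound : ‖f s‖ₑ ≤ 8 ^ (j + 1) * τ := by
    refine (enorm_le_gridMajorant (scale := 4 ^ (j + 1)) hf h0 (by exact_mod_cast hj_lt)).trans ?_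
    rw [← ENNReal.inv_mul_le_iff (by simp) (by finiteness), ENNReal.inv_pow]
    exact (ENNReal.le_tsum (j + 1)).trans hτ
  have hreal : |f s| ≤ 8 ^ (j + 1) * τ := by
    rw [← Real.norm_eq_abs, ← coe_nnnorm]
    rw [enorm_eq_nnnorm] at hbound
    exact_mod_cast hbound
  calc f s ^ 2 = |f s| ^ 2 := (sq_abs _).symm
    _ ≤ (8 ^ (j + 1) * τ) ^ 2 := by gcongr
    _ = 64 * (4 ^ j) ^ 3 * τ ^ 2 := by
        have hpow : ((8 : ℝ) ^ j) ^ 2 = (4 ^ j) ^ 3 := by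
          rw [pow_right_comm, pow_right_comm (4 : ℝ)]
          norm_num
        rw [← hpow, pow_succ]
        ring
    _ ≤ 64 * (2 * ‖s‖) ^ 3 * τ ^ 2 := by gcongr
    _ = 512 * τ ^ 2 * ‖s‖ ^ 3 := by ring

variable {Ω : Type*} [MeasurableSpace Ω] {P : Measure Ω} {X : Space n → Ω → ℝ}

theorem aemeasurable_growthMajorant (hX : ∀ s, AEMeasurable (X s) P) :
    AEMeasurable (fun ω => growthMajorant (X · ω)) P :=
  .tsum fun j => (aemeasurable_gridMajorant hX (4 ^ j)).const_mul _

theorem lintegral_growthMajorant_le [IsProbabilityMeasure P] (hX : ∀ s, AEMeasurable (X s) P)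
    {Λ : ℝ≥0∞}
    (hΛ : ∀ s t, eLpNorm (fun ω => X s ω - X t ω) (chainingExponent n) P ≤ Λ * ‖s - t‖ₑ) :
    ∫⁻ ω, growthMajorant (X · ω) ∂P ≤ 16 * (Λ * n) := by
  have hterm (j : ℕ) : ∫⁻ ω, 8⁻¹ ^ j * gridMajorant (4 ^ j) (X · ω) ∂P ≤
      8 * (Λ * n) * 2⁻¹ ^ j := by
    have hratio : (8⁻¹ : ℝ≥0∞) * 4 = 2⁻¹ := by
      rw [← ENNReal.toReal_eq_toReal_iff' (by finiteness) (by finiteness)]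
      norm_num
    rw [lintegral_const_mul'' _ (aemeasurable_gridMajorant hX (4 ^ j))]
    calc 8⁻¹ ^ j * ∫⁻ ω, gridMajorant (4 ^ j) (X · ω) ∂P
        ≤ 8⁻¹ ^ j * (8 * (Λ * (4 ^ j : ℝ≥0) * n)) := by
          gcongr
          exact lintegral_gridMajorant_le hX hΛ (4 ^ j)
      _ = 8 * (Λ * n) * (8⁻¹ * 4) ^ j := by
          rw [mul_pow]
          push_cast
          ring
      _ = 8 * (Λ * n) * 2⁻¹ ^ j := by rw [hratio]
  simp only [growthMajorant]
  rw [lintegral_tsum fun j => (aemeasurable_gridMajorant hX (4 ^ j)).const_mul _]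
  refine (ENNReal.tsum_le_tsum hterm).trans_eq ?_
  rw [ENNReal.tsum_mul_left, ENNReal.tsum_geometric, ENNReal.one_sub_inv_two, inv_inv]
  ring

end GrowthMajorant

section NoiseField

variable {n : ℕ} {Ω : Type*}

/-- The noise `ξ` weighted by the functions `ψ i`, as a random field of the local parameter `s`,
which is the displacement of the source magnified by `√m`. -/
def noiseField (ψ : ℕ → Space n → ℝ) (ξ : ℕ → Ω → ℝ) (m : ℕ) (s : Space n) (ω : Ω) : ℝ :=
  ∑ i ∈ Finset.range m, ψ i ((√(m : ℝ))⁻¹ • s) * ξ i ω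

variable {ψ : ℕ → Space n → ℝ} {ξ : ℕ → Ω → ℝ} {L : ℝ≥0}

theorem continuous_noiseField (hψ : ∀ i, Continuous (ψ i)) (m : ℕ) (ω : Ω) :
    Continuous fun s => noiseField ψ ξ m s ω := by
  unfold noiseField
  fun_prop

theorem noiseField_zero (hψ : ∀ i, ψ i 0 = 0) (m : ℕ) (ω : Ω) : noiseField ψ ξ m 0 ω = 0 := by
  simp [noiseField, hψ]

theorem sum_sub_sq_le_of_lipschitzWith (hψ : ∀ i, LipschitzWith L (ψ i)) (m : ℕ) (s t : Space n) :
    ∑ i ∈ Finset.range m, (ψ i ((√(m : ℝ))⁻¹ • s) - ψ i ((√(m : ℝ))⁻¹ • t)) ^ 2 ≤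
      (L * ‖s - t‖) ^ 2 := by
  rcases eq_or_ne m 0 with rfl | hm
  · simpa using sq_nonneg _
  have hm' : (m : ℝ) ≠ 0 := Nat.cast_ne_zero.2 hm
  have hterm (i : ℕ) : (ψ i ((√(m : ℝ))⁻¹ • s) - ψ i ((√(m : ℝ))⁻¹ • t)) ^ 2 ≤
      (m : ℝ)⁻¹ * (L * ‖s - t‖) ^ 2 := by
    have hlip := (hψ i).dist_le_mul ((√(m : ℝ))⁻¹ • s) ((√(m : ℝ))⁻¹ • t)
    rw [Real.dist_eq, dist_eq_norm, ← smul_sub, norm_smul, norm_inv,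
      Real.norm_of_nonneg (Real.sqrt_nonneg _)] at hlip
    calc _ ≤ (L * ((√(m : ℝ))⁻¹ * ‖s - t‖)) ^ 2 := sq_le_sq' (abs_le.1 hlip).1 (abs_le.1 hlip).2
      _ = _ := by
        rw [mul_left_comm, mul_pow, inv_pow, Real.sq_sqrt m.cast_nonneg]
  refine (Finset.sum_le_sum fun i _ => hterm i).trans_eq ?_
  rw [Finset.sum_const, Finset.card_range, nsmul_eq_mul, mul_inv_cancel_left₀ hm']

variable [MeasurableSpace Ω] {P : Measure Ω} {v : ℝ≥0}

theorem IsWhiteNoise.aemeasurable_noiseField (hξ : IsWhiteNoise ξ v P) (ψ : ℕ → Space n → ℝ)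
    (m : ℕ) (s : Space n) : AEMeasurable (noiseField ψ ξ m s) P :=
  hξ.aemeasurable_sum _ _

theorem IsWhiteNoise.eLpNorm_noiseField_sub (hξ : IsWhiteNoise ξ v P) (ψ : ℕ → Space n → ℝ)
    (q : ℝ≥0∞) (m : ℕ) (s t : Space n) :
    eLpNorm (fun ω => noiseField ψ ξ m s ω - noiseField ψ ξ m t ω) q P =
      ENNReal.ofReal
        √(∑ i ∈ Finset.range m, (ψ i ((√(m : ℝ))⁻¹ • s) - ψ i ((√(m : ℝ))⁻¹ • t)) ^ 2) *
        eLpNorm id q (gaussianReal 0 v) := by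
  rw [← hξ.eLpNorm_sum]
  simp only [noiseField, ← Finset.sum_sub_distrib, sub_mul]

theorem IsWhiteNoise.eLpNorm_noiseField_sub_le (hξ : IsWhiteNoise ξ v P)
    (hψ : ∀ i, LipschitzWith L (ψ i)) (q : ℝ≥0∞) (m : ℕ) (s t : Space n) :
    eLpNorm (fun ω => noiseField ψ ξ m s ω - noiseField ψ ξ m t ω) q P ≤
      L * eLpNorm id q (gaussianReal 0 v) * ‖s - t‖ₑ := by
  have hsqrt := Real.sqrt_le_iff.2
    ⟨by positivity, sum_sub_sq_le_of_lipschitzWith hψ m s t⟩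
  rw [hξ.eLpNorm_noiseField_sub]
  refine (mul_le_mul_left (ENNReal.ofReal_le_ofReal hsqrt) _).trans_eq ?_
  rw [ENNReal.ofReal_mul L.coe_nonneg, ENNReal.ofReal_coe_nnreal, ofReal_norm]
  ring

theorem eLpNorm_id_gaussianReal_natCast_ne_top (q : ℕ) (v : ℝ≥0) :
    eLpNorm id q (gaussianReal 0 v) ≠ ∞ :=
  (memLp_id_gaussianReal' q (by simp)).2.ne

variable [IsProbabilityMeasure P]

theorem IsWhiteNoise.boundedInProbability_gridMajorant (hξ : IsWhiteNoise ξ v P)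
    (hψ : ∀ i, LipschitzWith L (ψ i)) (scale : ℝ≥0) :
    BoundedInProbability P fun m ω => gridMajorant scale (noiseField ψ ξ m · ω) := by
  have htop := eLpNorm_id_gaussianReal_natCast_ne_top (chainingExponent n) v
  exact .of_lintegral_le (fun m => aemeasurable_gridMajorant (hξ.aemeasurable_noiseField ψ m) scale)
    (by finiteness) fun m => lintegral_gridMajorant_le (hξ.aemeasurable_noiseField ψ m)
      (hξ.eLpNorm_noiseField_sub_le hψ _ m) scale

theorem IsWhiteNoise.boundedInProbability_growthMajorant (hξ : IsWhiteNoise ξ v P)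
    (hψ : ∀ i, LipschitzWith L (ψ i)) :
    BoundedInProbability P fun m ω => growthMajorant (noiseField ψ ξ m · ω) := by
  have htop := eLpNorm_id_gaussianReal_natCast_ne_top (chainingExponent n) v
  exact .of_lintegral_le (fun m => aemeasurable_growthMajorant (hξ.aemeasurable_noiseField ψ m))
    (by finiteness) fun m => lintegral_growthMajorant_le (hξ.aemeasurable_noiseField ψ m)
      (hξ.eLpNorm_noiseField_sub_le hψ _ m)

theorem tendsto_sum_sub_sq_of_tendsto_sum_sq
    (hlim : ∀ s, Tendsto (fun m : ℕ => ∑ i ∈ Finset.range m, ψ i ((√(m : ℝ))⁻¹ • s) ^ 2) atTop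
      (𝓝 0)) (s t : Space n) :
    Tendsto (fun m : ℕ => ∑ i ∈ Finset.range m,
      (ψ i ((√(m : ℝ))⁻¹ • s) - ψ i ((√(m : ℝ))⁻¹ • t)) ^ 2) atTop (𝓝 0) := by
  refine squeeze_zero (fun m => Finset.sum_nonneg fun i _ => sq_nonneg _) (fun m => ?_)
    (by simpa using ((hlim s).const_mul 2).add ((hlim t).const_mul 2))
  rw [Finset.mul_sum, Finset.mul_sum, ← Finset.sum_add_distrib]
  gcongr with i _
  nlinarith [sq_nonneg (ψ i ((√(m : ℝ))⁻¹ • s) + ψ i ((√(m : ℝ))⁻¹ • t))]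

theorem IsWhiteNoise.tendsto_measure_gridMajorant_ge (hξ : IsWhiteNoise ξ v P)
    (hψ : ∀ i, LipschitzWith L (ψ i))
    (hlim : ∀ s, Tendsto (fun m : ℕ => ∑ i ∈ Finset.range m, ψ i ((√(m : ℝ))⁻¹ • s) ^ 2) atTop
      (𝓝 0)) (scale : ℝ≥0) {κ : ℝ≥0∞} (hκ : κ ≠ 0) (hκ_top : κ ≠ ∞) :
    Tendsto (fun m => P {ω | κ ≤ gridMajorant scale (noiseField ψ ξ m · ω)}) atTop (𝓝 0) := by
  have htop := eLpNorm_id_gaussianReal_natCast_ne_top (chainingExponent n) v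
  refine tendsto_measure_ge_of_tendsto_lintegral
    (fun m => aemeasurable_gridMajorant (hξ.aemeasurable_noiseField ψ m) scale)
    (tendsto_lintegral_gridMajorant (hξ.aemeasurable_noiseField ψ) ?_
      (fun m => hξ.eLpNorm_noiseField_sub_le hψ _ m) (fun s t => ?_) scale) hκ hκ_top
  · finiteness
  · simp only [hξ.eLpNorm_noiseField_sub]
    have hsqrt := ENNReal.tendsto_ofReal
      ((Real.continuous_sqrt.tendsto 0).comp (tendsto_sum_sub_sq_of_tendsto_sum_sq hlim s t))
    simpa using ENNReal.Tendsto.mul_const hsqrt (.inr htop)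

end NoiseField

/-! ### Local quadratic approximation of the objective -/

section LocalSignal

variable {n : ℕ} {b : ℕ → Space n} {μ : Measure (Space n)} {xo : Space n}

/-- The noise-free part of the objective at `xo + s / √m`, times `m`. -/
def localSignal (b : ℕ → Space n) (xo : Space n) (m : ℕ) (s : Space n) : ℝ :=
  ∑ i ∈ Finset.range m, rangeDiffIncr xo (b i) ((√(m : ℝ))⁻¹ • s) ^ 2

theorem norm_inv_sqrt_smul_sq (m : ℕ) (s : Space n) :
    ‖(√(m : ℝ))⁻¹ • s‖ ^ 2 = (m : ℝ)⁻¹ * ‖s‖ ^ 2 := by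
  rw [norm_smul, mul_pow, norm_inv, inv_pow, Real.norm_of_nonneg (Real.sqrt_nonneg _),
    Real.sq_sqrt m.cast_nonneg]

theorem tendsto_inv_sqrt_natCast : Tendsto (fun m : ℕ => (√(m : ℝ))⁻¹) atTop (𝓝 0) :=
  (Real.tendsto_sqrt_atTop.comp tendsto_natCast_atTop_atTop).inv_tendsto_atTop

theorem eventually_forall_norm_inv_sqrt_smul_le (ρ : ℝ≥0) {δ : ℝ} (hδ : 0 < δ) :
    ∀ᶠ m : ℕ in atTop, ∀ s : Space n, ‖s‖ ≤ ρ → ‖(√(m : ℝ))⁻¹ • s‖ ≤ δ := by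
  have hlim : Tendsto (fun m : ℕ => (√(m : ℝ))⁻¹ * ρ) atTop (𝓝 0) := by
    simpa using tendsto_inv_sqrt_natCast.mul_const (ρ : ℝ)
  filter_upwards [hlim.eventually_le_const hδ] with m hm s hs
  rw [norm_smul, norm_inv, Real.norm_of_nonneg (Real.sqrt_nonneg _)]
  exact (mul_le_mul_of_nonneg_left hs (by positivity)).trans hm

variable [IsFiniteMeasure μ]

theorem IsEquidistributed.exists_abs_localSignal_sub_le (hb : IsEquidistributed b μ)
    (hμ : μ {xo} = 0) (hxo : xo ≠ 0) {ε : ℝ} (hε : 0 < ε) :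
    ∃ δ > 0, ∀ᶠ m : ℕ in atTop, ∀ s : Space n, ‖(√(m : ℝ))⁻¹ • s‖ ≤ δ →
      |localSignal b xo m s - inner ℝ s (gramOperator μ xo s)| ≤ ε * ‖s‖ ^ 2 := by
  obtain ⟨δ, hδ, hincr⟩ := hb.exists_abs_average_rangeDiffIncr_sq_sub_le hμ hxo hε
  refine ⟨δ, hδ, ?_⟩
  filter_upwards [hincr, eventually_gt_atTop 0] with m hm hm0 s hs
  have hm' : 0 < (m : ℝ)⁻¹ := by positivity
  have hform : inner ℝ ((√(m : ℝ))⁻¹ • s) (gramOperator μ xo ((√(m : ℝ))⁻¹ • s)) =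
      (m : ℝ)⁻¹ * inner ℝ s (gramOperator μ xo s) := by
    rw [map_smul, real_inner_smul_left, real_inner_smul_right, ← mul_assoc, ← mul_inv,
      Real.mul_self_sqrt m.cast_nonneg]
  have hscaled := hm _ hs
  rw [hform, norm_inv_sqrt_smul_sq, average, ← mul_sub, abs_mul, abs_of_pos hm',
    mul_left_comm] at hscaled
  exact le_of_mul_le_mul_left hscaled hm'

theorem IsEquidistributed.eventually_abs_localSignal_sub_le (hb : IsEquidistributed b μ)
    (hμ : μ {xo} = 0) (hxo : xo ≠ 0) (ρ : ℝ≥0) {κ : ℝ} (hκ : 0 < κ) :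
    ∀ᶠ m in atTop, ∀ s : Space n, ‖s‖ ≤ ρ →
      |localSignal b xo m s - inner ℝ s (gramOperator μ xo s)| ≤ κ := by
  obtain ⟨δ, hδ, hsignal⟩ := hb.exists_abs_localSignal_sub_le hμ hxo
    (show 0 < κ / (ρ ^ 2 + 1) by positivity)
  filter_upwards [hsignal, eventually_forall_norm_inv_sqrt_smul_le ρ hδ] with m hm hsmall s hs
  calc _ ≤ κ / (ρ ^ 2 + 1) * ‖s‖ ^ 2 := hm s (hsmall s hs)
    _ ≤ κ / (ρ ^ 2 + 1) * (ρ ^ 2 + 1) := by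
        gcongr
        exact (pow_le_pow_left₀ (norm_nonneg s) hs 2).trans (le_add_of_nonneg_right zero_le_one)
    _ = κ := div_mul_cancel₀ _ (by positivity)

theorem IsEquidistributed.exists_mul_norm_sq_le_localSignal (hb : IsEquidistributed b μ)
    (hμ : μ {xo} = 0) (hxo : xo ≠ 0)
    (hpos : ∀ h : Space n, h ≠ 0 → 0 < inner ℝ h (gramOperator μ xo h)) :
    ∃ c > 0, ∃ δ > 0, ∀ᶠ m : ℕ in atTop, ∀ s : Space n, ‖(√(m : ℝ))⁻¹ • s‖ ≤ δ →
      c * ‖s‖ ^ 2 ≤ localSignal b xo m s := by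
  obtain ⟨c, hc, hcoer⟩ := exists_mul_norm_sq_le_inner hpos
  obtain ⟨δ, hδ, hsignal⟩ := hb.exists_abs_localSignal_sub_le hμ hxo (half_pos hc)
  refine ⟨c / 2, half_pos hc, δ, hδ, ?_⟩
  filter_upwards [hsignal] with m hm s hs
  linarith [(abs_le.1 (hm s hs)).1, hcoer s]

theorem IsEquidistributed.tendsto_sum_rangeDiffRem_sq (hb : IsEquidistributed b μ)
    (hμ : μ {xo} = 0) (hxo : xo ≠ 0) (s : Space n) :
    Tendsto (fun m : ℕ => ∑ i ∈ Finset.range m, rangeDiffRem xo (b i) ((√(m : ℝ))⁻¹ • s) ^ 2)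
      atTop (𝓝 0) := by
  refine Metric.tendsto_nhds.2 fun ε hε => ?_
  obtain ⟨δ, hδ, hrem⟩ := hb.exists_average_rangeDiffRem_sq_le hμ hxo
    (show 0 < ε / (‖s‖ ^ 2 + 1) by positivity)
  filter_upwards [hrem, eventually_forall_norm_inv_sqrt_smul_le ‖s‖₊ hδ, eventually_gt_atTop 0]
    with m hm hsmall hm0
  have hscaled := hm _ (hsmall s (coe_nnnorm s).ge)
  rw [average, norm_inv_sqrt_smul_sq, mul_left_comm] at hscaled
  rw [Real.dist_0_eq_abs, abs_of_nonneg (Finset.sum_nonneg fun _ _ => sq_nonneg _)]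
  calc _ ≤ ε / (‖s‖ ^ 2 + 1) * ‖s‖ ^ 2 := le_of_mul_le_mul_left hscaled (by positivity)
    _ < ε / (‖s‖ ^ 2 + 1) * (‖s‖ ^ 2 + 1) := by gcongr; exact lt_add_one _
    _ = ε := div_mul_cancel₀ _ (by positivity)

end LocalSignal

section LocalExcess

variable {n : ℕ} {Ω : Type*} {b : ℕ → Space n} {xo : Space n} {ξ : ℕ → Ω → ℝ}

/-- The score: the gradient at `s = 0` of the noise term of `localExcess`, up to the factor `-2`.
It is the centre of the quadratic approximation of `localExcess`. -/
def score (b : ℕ → Space n) (xo : Space n) (ξ : ℕ → Ω → ℝ) (m : ℕ) (ω : Ω) : Space n :=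
  ∑ i ∈ Finset.range m, ((√(m : ℝ))⁻¹ * ξ i ω) • rangeDiffGrad xo (b i)

/-- The excess of the objective at `xo + s / √m` over its value at `xo`, times `m`. -/
def localExcess (b : ℕ → Space n) (xo : Space n) (ξ : ℕ → Ω → ℝ) (m : ℕ) (s : Space n) (ω : Ω) :
    ℝ := localSignal b xo m s - 2 * noiseField (fun i => rangeDiffIncr xo (b i)) ξ m s ω

/-- The quadratic approximation of `localExcess`. -/
def localQuadratic (μ : Measure (Space n)) (b : ℕ → Space n) (xo : Space n) (ξ : ℕ → Ω → ℝ)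
    (m : ℕ) (s : Space n) (ω : Ω) : ℝ :=
  inner ℝ s (gramOperator μ xo s) - 2 * inner ℝ (score b xo ξ m ω) s

theorem lipschitzWith_rangeDiffIncr (xo z : Space n) : LipschitzWith 2 (rangeDiffIncr xo z) :=
  .of_dist_le_mul fun h h' => by
    simpa [Real.dist_eq, dist_eq_norm] using abs_rangeDiffIncr_sub_le xo z h h'

theorem lipschitzWith_rangeDiffRem (xo z : Space n) : LipschitzWith 4 (rangeDiffRem xo z) :=
  .of_dist_le_mul fun h h' => by
    simpa [Real.dist_eq, dist_eq_norm] using abs_rangeDiffRem_sub_le xo z h h'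

theorem lipschitzWith_inner_rangeDiffGrad (xo z : Space n) :
    LipschitzWith 2 fun h : Space n => (inner ℝ (rangeDiffGrad xo z) h : ℝ) :=
  .of_dist_le_mul fun h h' => by
    simpa [Real.dist_eq, dist_eq_norm, inner_sub_right] using
      abs_inner_rangeDiffGrad_le xo z (h - h')

theorem noiseField_inner_rangeDiffGrad (m : ℕ) (s : Space n) (ω : Ω) :
    noiseField (fun i h => inner ℝ (rangeDiffGrad xo (b i)) h) ξ m s ω =
      inner ℝ (score b xo ξ m ω) s := by
  rw [noiseField, score, sum_inner]
  refine Finset.sum_congr rfl fun i _ => ?_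
  rw [real_inner_smul_left, real_inner_smul_right]
  ring

theorem localExcess_sub_localQuadratic (μ : Measure (Space n)) (m : ℕ) (s : Space n) (ω : Ω) :
    localExcess b xo ξ m s ω - localQuadratic μ b xo ξ m s ω =
      (localSignal b xo m s - inner ℝ s (gramOperator μ xo s)) -
        2 * noiseField (fun i => rangeDiffRem xo (b i)) ξ m s ω := by
  have hnoise : noiseField (fun i => rangeDiffRem xo (b i)) ξ m s ω =
      noiseField (fun i => rangeDiffIncr xo (b i)) ξ m s ω - inner ℝ (score b xo ξ m ω) s := by
    rw [← noiseField_inner_rangeDiffGrad]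
    simp only [noiseField, rangeDiffRem, sub_mul, Finset.sum_sub_distrib]
  rw [hnoise, localExcess, localQuadratic]
  ring

theorem norm_le_of_localExcess_nonpos {m : ℕ} {s : Space n} {ω : Ω} {c : ℝ} (hc : 0 < c)
    (hsignal : c * ‖s‖ ^ 2 ≤ localSignal b xo m s) {τ : ℝ≥0}
    (hτ : growthMajorant (noiseField (fun i => rangeDiffIncr xo (b i)) ξ m · ω) ≤ τ)
    (hle : localExcess b xo ξ m s ω ≤ 0) : ‖s‖ ≤ max 1 (2048 * τ ^ 2 / c ^ 2) := by
  rcases le_total ‖s‖ 1 with hs | hs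
  · exact hs.trans (le_max_left _ _)
  have hnoise := sq_le_of_growthMajorant_le
    (continuous_noiseField (fun i => (lipschitzWith_rangeDiffIncr xo (b i)).continuous) m ω)
    (noiseField_zero (fun i => rangeDiffIncr_zero xo (b i)) m ω) hτ hs
  set ν := noiseField (fun i => rangeDiffIncr xo (b i)) ξ m s ω
  have hdom : c * ‖s‖ ^ 2 ≤ 2 * ν := by
    rw [localExcess] at hle
    linarith
  have hsq : (c * ‖s‖ ^ 2) ^ 2 ≤ (2 * ν) ^ 2 := pow_le_pow_left₀ (by positivity) hdom 2
  refine le_max_of_le_right ((le_div_iff₀ (by positivity)).2 ?_)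
  refine le_of_mul_le_mul_right ?_ (show 0 < ‖s‖ ^ 3 by positivity)
  calc ‖s‖ * c ^ 2 * ‖s‖ ^ 3 = (c * ‖s‖ ^ 2) ^ 2 := by ring
    _ ≤ (2 * ν) ^ 2 := hsq
    _ ≤ 2048 * τ ^ 2 * ‖s‖ ^ 3 := by linarith

theorem mul_norm_sub_gramInverse_score_sq_le {μ : Measure (Space n)}
    (hM : (gramMatrix μ xo).PosDef) {c κ : ℝ}
    (hcoer : ∀ h, c * ‖h‖ ^ 2 ≤ inner ℝ h (gramOperator μ xo h)) {m : ℕ} {s : Space n} {ω : Ω}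
    (hs : |localExcess b xo ξ m s ω - localQuadratic μ b xo ξ m s ω| ≤ κ)
    (ht : |localExcess b xo ξ m (gramInverse μ xo (score b xo ξ m ω)) ω -
      localQuadratic μ b xo ξ m (gramInverse μ xo (score b xo ξ m ω)) ω| ≤ κ)
    (hle : localExcess b xo ξ m s ω ≤
      localExcess b xo ξ m (gramInverse μ xo (score b xo ξ m ω)) ω) :
    c * ‖s - gramInverse μ xo (score b xo ξ m ω)‖ ^ 2 ≤ 2 * κ := by
  refine mul_norm_sub_sq_le_of_quadratic_approx (isSelfAdjoint_gramOperator μ xo) hcoer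
    (f := fun s => localExcess b xo ξ m s ω) ?_ ?_ hle
  · simpa only [localQuadratic, gramOperator_gramInverse hM] using hs
  · simpa only [localQuadratic, gramOperator_gramInverse hM] using ht

theorem enorm_score_le_gridMajorant (m : ℕ) (ω : Ω) :
    ‖score b xo ξ m ω‖ₑ ≤ gridMajorant 3
      (noiseField (fun i h => inner ℝ (rangeDiffGrad xo (b i)) h) ξ m · ω) := by
  set Z := score b xo ξ m ω with hZ
  rcases eq_or_ne Z 0 with h0 | h0
  · simp [h0]
  have hZ0 : ‖Z‖ ≠ 0 := norm_ne_zero_iff.2 h0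
  have hunit : ‖‖Z‖⁻¹ • Z‖ = 1 := by rw [norm_smul, norm_inv, norm_norm, inv_mul_cancel₀ hZ0]
  have hle := enorm_le_gridMajorant (scale := 3) (s := ‖Z‖⁻¹ • Z)
    (continuous_noiseField (ψ := fun i h => inner ℝ (rangeDiffGrad xo (b i)) h) (ξ := ξ)
      (fun i => (lipschitzWith_inner_rangeDiffGrad xo (b i)).continuous) m ω)
    (noiseField_zero (fun i => inner_zero_right _) m ω) (by rw [hunit]; norm_num)
  rw [noiseField_inner_rangeDiffGrad, ← hZ, real_inner_smul_right, real_inner_self_eq_norm_sq, sq,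
    inv_mul_cancel_left₀ hZ0, enorm_norm] at hle
  exact hle

variable [MeasurableSpace Ω] {P : Measure Ω} {v : ℝ≥0}

theorem aemeasurable_score (hξ : ∀ i, AEMeasurable (ξ i) P) (b : ℕ → Space n) (xo : Space n)
    (m : ℕ) : AEMeasurable (score b xo ξ m) P :=
  Finset.aemeasurable_fun_sum _ fun i _ => ((hξ i).const_mul _).smul_const _

theorem aemeasurable_localExcess (hξ : ∀ i, AEMeasurable (ξ i) P) (b : ℕ → Space n)
    (xo : Space n) (m : ℕ) {g : Ω → Space n} (hg : AEMeasurable g P) :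
    AEMeasurable (fun ω => localExcess b xo ξ m (g ω) ω) P := by
  have hincr (i : ℕ) :
      AEMeasurable (fun ω => rangeDiffIncr xo (b i) ((√(m : ℝ))⁻¹ • g ω)) P :=
    (lipschitzWith_rangeDiffIncr xo (b i)).continuous.measurable.comp_aemeasurable
      (hg.const_smul (√(m : ℝ))⁻¹)
  exact (Finset.aemeasurable_fun_sum _ fun i _ => (hincr i).pow_const 2).sub
    ((Finset.aemeasurable_fun_sum _ fun i _ => (hincr i).mul (hξ i)).const_mul 2)

variable [IsProbabilityMeasure P]

theorem IsWhiteNoise.boundedInProbability_score (hξ : IsWhiteNoise ξ v P) (b : ℕ → Space n)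
    (xo : Space n) : BoundedInProbability P fun m ω => ‖score b xo ξ m ω‖ₑ :=
  (hξ.boundedInProbability_gridMajorant
    (fun i => lipschitzWith_inner_rangeDiffGrad xo (b i)) 3).of_le (c := 1) fun m ω => by
      simpa using enorm_score_le_gridMajorant m ω

end LocalExcess

section Linearization

variable {n : ℕ} {Ω : Type*} [MeasurableSpace Ω] {P : Measure Ω} [IsProbabilityMeasure P]
  {b : ℕ → Space n} {μ : Measure (Space n)} [IsFiniteMeasure μ] {xo : Space n}
  {ξ : ℕ → Ω → ℝ} {v : ℝ≥0} {shat : ℕ → Ω → Space n}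

theorem IsWhiteNoise.tendsto_measure_localQuadratic_far (hξ : IsWhiteNoise ξ v P)
    (hb : IsEquidistributed b μ) (hμ : μ {xo} = 0) (hxo : xo ≠ 0) (ρ : ℝ≥0) {κ : ℝ}
    (hκ : 0 < κ) :
    Tendsto (fun m => P {ω | ∃ s, ‖s‖ ≤ ρ ∧
      κ < |localExcess b xo ξ m s ω - localQuadratic μ b xo ξ m s ω|}) atTop (𝓝 0) := by
  have hrem := hξ.tendsto_measure_gridMajorant_ge (fun i => lipschitzWith_rangeDiffRem xo (b i))
    (hb.tendsto_sum_rangeDiffRem_sq hμ hxo) (2 * ρ + 1)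
    (κ := ENNReal.ofReal (κ / 4)) (by simpa using hκ) ENNReal.ofReal_ne_top
  refine tendsto_of_tendsto_of_tendsto_of_le_of_le' tendsto_const_nhds hrem
    (.of_forall fun _ => zero_le) ?_
  filter_upwards [hb.eventually_abs_localSignal_sub_le hμ hxo ρ (half_pos hκ)] with m hm
  refine measure_mono fun ω ⟨s, hs, hfar⟩ => ?_
  have hnoise := enorm_le_gridMajorant (scale := 2 * ρ + 1) (s := s)
    (continuous_noiseField (fun i => (lipschitzWith_rangeDiffRem xo (b i)).continuous) m ω)
    (noiseField_zero (ξ := ξ) (fun i => rangeDiffRem_zero xo (b i)) m ω)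
    (by push_cast; linarith)
  refine le_trans ?_ hnoise
  rw [← ofReal_norm, Real.norm_eq_abs]
  refine ENNReal.ofReal_le_ofReal ?_
  rw [localExcess_sub_localQuadratic] at hfar
  have htri := abs_sub (localSignal b xo m s - inner ℝ s (gramOperator μ xo s))
    (2 * noiseField (fun i => rangeDiffRem xo (b i)) ξ m s ω)
  rw [abs_mul, abs_two] at htri
  linarith [hm s hs]

theorem IsWhiteNoise.boundedInProbability_of_localExcess_nonpos (hξ : IsWhiteNoise ξ v P)
    (hb : IsEquidistributed b μ) (hμ : μ {xo} = 0) (hxo : xo ≠ 0)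
    (hpos : ∀ h : Space n, h ≠ 0 → 0 < inner ℝ h (gramOperator μ xo h))
    (hmeas : ∀ m, AEMeasurable (shat m) P)
    (hsmall : ∀ᵐ ω ∂P, Tendsto (fun m : ℕ => (√(m : ℝ))⁻¹ • shat m ω) atTop (𝓝 0))
    (hle : ∀ᵐ ω ∂P, ∀ᶠ m in atTop, localExcess b xo ξ m (shat m ω) ω ≤ 0) :
    BoundedInProbability P fun m ω => ‖shat m ω‖ₑ := by
  obtain ⟨c, hc, δ, hδ, hsignal⟩ := hb.exists_mul_norm_sq_le_localSignal hμ hxo hpos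
  have hfar : Tendsto (fun m : ℕ => P {ω | δ < ‖(√(m : ℝ))⁻¹ • shat m ω‖}) atTop (𝓝 0) := by
    refine tendsto_measure_lt_of_ae_eventually_le
      (fun m => ((hmeas m).const_smul (√(m : ℝ))⁻¹).norm) (fun _ => aemeasurable_const) ?_
    filter_upwards [hsmall] with ω hω
    exact (tendsto_zero_iff_norm_tendsto_zero.1 hω).eventually_le_const hδ
  have hpositive : Tendsto (fun m => P {ω | 0 < localExcess b xo ξ m (shat m ω) ω}) atTop (𝓝 0) :=
    tendsto_measure_lt_of_ae_eventually_le
      (fun m => aemeasurable_localExcess hξ.aemeasurable b xo m (hmeas m))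
      (fun _ => aemeasurable_const) hle
  have hbad := tendsto_of_tendsto_of_tendsto_of_le_of_le tendsto_const_nhds
    (by simpa using hfar.add hpositive) (fun _ => zero_le) fun m => measure_union_le _ _
  refine (hξ.boundedInProbability_growthMajorant
    fun i => lipschitzWith_rangeDiffIncr xo (b i)).of_imp hbad fun τ =>
      ⟨(max 1 (2048 * τ ^ 2 / c ^ 2)).toNNReal, ?_⟩
  filter_upwards [hsignal] with m hm ω hω hτ
  simp only [Set.mem_union, Set.mem_ofPred_eq, not_or, not_lt] at hω
  rw [← ofReal_norm]
  exact ENNReal.ofReal_le_ofReal (norm_le_of_localExcess_nonpos hc (hm _ hω.1) hτ hω.2)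

theorem IsWhiteNoise.tendstoInMeasure_sub_gramInverse_score (hξ : IsWhiteNoise ξ v P)
    (hb : IsEquidistributed b μ) (hμ : μ {xo} = 0) (hxo : xo ≠ 0)
    (hpos : ∀ h : Space n, h ≠ 0 → 0 < inner ℝ h (gramOperator μ xo h))
    (hmeas : ∀ m, AEMeasurable (shat m) P)
    (hsmall : ∀ᵐ ω ∂P, Tendsto (fun m : ℕ => (√(m : ℝ))⁻¹ • shat m ω) atTop (𝓝 0))
    (hle_source : ∀ᵐ ω ∂P, ∀ᶠ m in atTop, localExcess b xo ξ m (shat m ω) ω ≤ 0)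
    (hle_score : ∀ᵐ ω ∂P, ∀ᶠ m in atTop, localExcess b xo ξ m (shat m ω) ω ≤
      localExcess b xo ξ m (gramInverse μ xo (score b xo ξ m ω)) ω) :
    TendstoInMeasure P (fun m ω => shat m ω - gramInverse μ xo (score b xo ξ m ω)) atTop 0 := by
  obtain ⟨c, hc, hcoer⟩ := exists_mul_norm_sq_le_inner hpos
  set t : ℕ → Ω → Space n := fun m ω => gramInverse μ xo (score b xo ξ m ω)
  have ht_meas (m : ℕ) : AEMeasurable (t m) P :=
    (gramInverse μ xo).continuous.measurable.comp_aemeasurable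
      (aemeasurable_score hξ.aemeasurable b xo m)
  have ht_bdd : BoundedInProbability P fun m ω => ‖t m ω‖ₑ :=
    (hξ.boundedInProbability_score b xo).of_le fun m ω => (gramInverse μ xo).le_opENorm _
  have hworse : Tendsto (fun m => P {ω | localExcess b xo ξ m (t m ω) ω <
      localExcess b xo ξ m (shat m ω) ω}) atTop (𝓝 0) :=
    tendsto_measure_lt_of_ae_eventually_le
      (fun m => aemeasurable_localExcess hξ.aemeasurable b xo m (hmeas m))
      (fun m => aemeasurable_localExcess hξ.aemeasurable b xo m (ht_meas m)) hle_score
  refine tendstoInMeasure_iff_norm.2 fun ε hε => ?_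
  refine ((hξ.boundedInProbability_of_localExcess_nonpos hb hμ hxo hpos hmeas hsmall
    hle_source).sup ht_bdd).tendsto_measure fun ρ => ?_
  have hκ : 0 < c * ε ^ 2 / 4 := by positivity
  refine tendsto_of_tendsto_of_tendsto_of_le_of_le tendsto_const_nhds
    (by simpa using hworse.add (hξ.tendsto_measure_localQuadratic_far hb hμ hxo ρ hκ))
    (fun _ => zero_le) fun m => (measure_mono fun ω hω => ?_).trans (measure_union_le _ _)
  obtain ⟨hsep : ε ≤ ‖shat m ω - t m ω - 0‖, hbdd⟩ := hω
  rw [sub_zero] at hsep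
  obtain ⟨hs, ht⟩ : ‖shat m ω‖ ≤ ρ ∧ ‖t m ω‖ ≤ ρ := by
    simpa [← ofReal_norm, ENNReal.ofReal_le_coe] using hbdd
  by_contra hgood
  simp only [Set.mem_union, Set.mem_ofPred_eq, not_or, not_exists, not_and, not_lt] at hgood
  obtain ⟨hle, happrox⟩ := hgood
  have hclose := mul_norm_sub_gramInverse_score_sq_le (gramMatrix_posDef hpos) hcoer
    (happrox _ hs) (happrox _ ht) hle
  have hsep_sq : c * ε ^ 2 ≤ c * ‖shat m ω - t m ω‖ ^ 2 := by gcongr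
  linarith

end Linearization

/-! ### Asymptotic normality of the linearized estimates -/

section Distribution

theorem charFun_map_of_hasLaw_inner {Ω E : Type*} [MeasurableSpace Ω] {P : Measure Ω}
    [NormedAddCommGroup E] [InnerProductSpace ℝ E] [MeasurableSpace E] [BorelSpace E]
    {X : Ω → E} (hX : AEMeasurable X P) {t : E} {v : ℝ≥0}
    (hlaw : HasLaw (fun ω => inner ℝ (X ω) t) (gaussianReal 0 v) P) :
    charFun (P.map X) t = Complex.exp (-v / 2) := by
  have hmap : (P.map X).map (InnerProductSpace.toDualMap ℝ E t) = gaussianReal 0 v := by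
    rw [AEMeasurable.map_map_of_aemeasurable (by fun_prop) hX, ← hlaw.map_eq]
    congr 1
    ext ω
    exact real_inner_comm _ _
  rw [charFun_eq_charFunDual_toDualMap, charFunDual_eq_charFun_map_one, hmap,
    charFun_gaussianReal]
  congr 1
  simp [neg_div]

variable {n : ℕ} {Ω : Type*} [MeasurableSpace Ω] {P : Measure Ω} {b : ℕ → Space n}
  {xo : Space n} {ξ : ℕ → Ω → ℝ} {v : ℝ≥0} {μ : Measure (Space n)}

theorem IsWhiteNoise.ae_tendsto_inv_sqrt_smul_score (hξ : IsWhiteNoise ξ v P) :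
    ∀ᵐ ω ∂P, Tendsto (fun m : ℕ => (√(m : ℝ))⁻¹ • score b xo ξ m ω) atTop (𝓝 0) := by
  have hcoord : ∀ᵐ ω ∂P, ∀ j, Tendsto (fun m : ℕ => (m : ℝ)⁻¹ *
      ∑ i ∈ Finset.range m, rangeDiffGrad xo (b i) j * ξ i ω) atTop (𝓝 0) :=
    ae_all_iff.2 fun j => hξ.ae_tendsto_average_mul fun i =>
      (PiLp.norm_apply_le (rangeDiffGrad xo (b i)) j).trans (norm_rangeDiffGrad_le xo (b i))
  filter_upwards [hcoord] with ω hω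
  have hinv (m : ℕ) : (m : ℝ)⁻¹ = (√(m : ℝ))⁻¹ * (√(m : ℝ))⁻¹ := by
    rw [← mul_inv, Real.mul_self_sqrt m.cast_nonneg]
  refine (((PiLp.continuous_toLp 2 fun _ : Fin n => ℝ).tendsto 0).comp
    (tendsto_pi_nhds.2 hω)).congr fun m => ?_
  ext j
  simp only [Function.comp_apply, score, PiLp.smul_apply, smul_eq_mul, WithLp.ofLp_sum,
    WithLp.ofLp_smul, Finset.sum_apply, Pi.smul_apply, Finset.mul_sum]
  refine Finset.sum_congr rfl fun i _ => ?_
  rw [hinv]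
  ring

theorem isSelfAdjoint_gramInverse (μ : Measure (Space n)) (xo : Space n) :
    IsSelfAdjoint (gramInverse μ xo) :=
  IsSelfAdjoint.map (gramMatrix_isHermitian μ xo).inv Matrix.toEuclideanCLM

theorem IsWhiteNoise.hasLaw_inner_score (hξ : IsWhiteNoise ξ v P) (m : ℕ) (w : Space n) :
    HasLaw (fun ω => inner ℝ (score b xo ξ m ω) w)
      (gaussianReal 0
        ((average b m fun z => inner ℝ (rangeDiffGrad xo z) w ^ 2).toNNReal * v)) P := by
  have hvar : ∑ i ∈ Finset.range m, inner ℝ (rangeDiffGrad xo (b i)) ((√(m : ℝ))⁻¹ • w) ^ 2 =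
      average b m fun z => inner ℝ (rangeDiffGrad xo z) w ^ 2 := by
    simp only [average, Finset.mul_sum, real_inner_smul_right, mul_pow, inv_pow,
      Real.sq_sqrt m.cast_nonneg]
  simp only [← noiseField_inner_rangeDiffGrad, ← hvar]
  exact hξ.hasLaw_sum (Finset.range m) fun i =>
    inner ℝ (rangeDiffGrad xo (b i)) ((√(m : ℝ))⁻¹ • w)

theorem IsWhiteNoise.charFun_gramInverse_score (hξ : IsWhiteNoise ξ v P) (m : ℕ) (t : Space n) :
    charFun (P.map fun ω => gramInverse μ xo (score b xo ξ m ω)) t =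
      Complex.exp (-((average b m fun z =>
        inner ℝ (rangeDiffGrad xo z) (gramInverse μ xo t) ^ 2) * v : ℝ) / 2) := by
  have hnonneg : 0 ≤ average b m fun z => inner ℝ (rangeDiffGrad xo z) (gramInverse μ xo t) ^ 2 :=
    mul_nonneg (by positivity) (Finset.sum_nonneg fun _ _ => sq_nonneg _)
  have hlaw := (hξ.hasLaw_inner_score (b := b) (xo := xo) m (gramInverse μ xo t)).congr
    (.of_forall fun ω => (isSelfAdjoint_gramInverse μ xo).isSymmetric (score b xo ξ m ω) t)
  rw [charFun_map_of_hasLaw_inner (X := fun ω => gramInverse μ xo (score b xo ξ m ω))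
    ((gramInverse μ xo).continuous.measurable.comp_aemeasurable
      (aemeasurable_score hξ.aemeasurable b xo m)) hlaw]
  push_cast [Real.coe_toNNReal _ hnonneg]
  rfl

theorem dotProduct_smul_gramMatrix_inv_mulVec (hM : (gramMatrix μ xo).PosDef) (c : ℝ)
    (t : Space n) :
    t.ofLp ⬝ᵥ (c • (gramMatrix μ xo)⁻¹).mulVec t.ofLp =
      inner ℝ (gramInverse μ xo t) (gramOperator μ xo (gramInverse μ xo t)) * c := by
  rw [gramOperator_gramInverse hM, real_inner_comm, gramInverse, Matrix.inner_toEuclideanCLM,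
    Matrix.smul_mulVec, dotProduct_smul, smul_eq_mul, mul_comm]

variable [IsProbabilityMeasure P] [IsFiniteMeasure μ]

theorem IsWhiteNoise.tendstoInDistribution_gramInverse_score (hξ : IsWhiteNoise ξ v P)
    (hb : IsEquidistributed b μ) (hμ : μ {xo} = 0) (hM : (gramMatrix μ xo).PosDef) :
    TendstoInDistribution (fun m ω => gramInverse μ xo (score b xo ξ m ω)) atTop
      (id : Space n → Space n) (fun _ => P)
      (multivariateGaussian 0 ((v : ℝ) • (gramMatrix μ xo)⁻¹)) := by
  refine ⟨fun m => (gramInverse μ xo).continuous.measurable.comp_aemeasurable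
    (aemeasurable_score hξ.aemeasurable b xo m), aemeasurable_id,
    ProbabilityMeasure.tendsto_of_tendsto_charFun fun t => ?_⟩
  change Tendsto (fun m => charFun (P.map fun ω => gramInverse μ xo (score b xo ξ m ω)) t) atTop
    (𝓝 (charFun ((multivariateGaussian 0 ((v : ℝ) • (gramMatrix μ xo)⁻¹)).map id) t))
  rw [Measure.map_id, charFun_multivariateGaussian (hM.inv.posSemidef.smul v.coe_nonneg)]
  simp only [hξ.charFun_gramInverse_score, dotProduct_smul_gramMatrix_inv_mulVec hM]
  have hlim := (hb.tendsto_average_inner_rangeDiffGrad_sq hμ (gramInverse μ xo t)).mul_const (v : ℝ)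
  refine (Complex.continuous_exp.tendsto _).comp ?_
  simpa [neg_div] using ((Complex.continuous_ofReal.tendsto _).comp hlim).neg.div_const 2

end Distribution

/-! ### The least-squares objective -/

section Objective

variable {n : ℕ}

theorem sum_Icc_one_eq_sum_range (f : ℕ → ℝ) (m : ℕ) :
    ∑ i ∈ Finset.Icc 1 m, f i = ∑ i ∈ Finset.range m, f (i + 1) := by
  rw [Finset.range_eq_Ico, Finset.sum_Ico_add' f 0 m 1]
  rfl

theorem objective_measurement_eq (a : ℕ → Space n) (xo : Space n) (r : ℕ → ℝ) (m : ℕ)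
    (x : Space n) :
    objective a (measurement a xo r) m x = (m : ℝ)⁻¹ * ∑ i ∈ Finset.range m,
      (r (i + 1) + (rangeDiff (a (i + 1)) xo - rangeDiff (a (i + 1)) x)) ^ 2 := by
  rw [objective, sum_Icc_one_eq_sum_range, one_div]
  congr 1
  refine Finset.sum_congr rfl fun i _ => ?_
  rw [measurement, rangeDiff, rangeDiff]
  ring

theorem objective_sub_objective (a : ℕ → Space n) (xo : Space n) (r : ℕ → ℝ) (m : ℕ)
    (x : Space n) :
    objective a (measurement a xo r) m x - objective a (measurement a xo r) m xo =
      average (fun i => a (i + 1)) m (fun z => (rangeDiff z xo - rangeDiff z x) ^ 2) +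
        2 * ((m : ℝ)⁻¹ * ∑ i ∈ Finset.range m,
          (rangeDiff (a (i + 1)) xo - rangeDiff (a (i + 1)) x) * r (i + 1)) := by
  rw [objective_measurement_eq, objective_measurement_eq, average, ← mul_sub,
    ← Finset.sum_sub_distrib, mul_left_comm, ← mul_add, Finset.mul_sum _ _ (2 : ℝ),
    ← Finset.sum_add_distrib]
  congr 1
  exact Finset.sum_congr rfl fun i _ => by ring

theorem localExcess_sqrt_smul_sub {Ω : Type*} (a : ℕ → Space n) (xo : Space n)
    (r : ℕ → Ω → ℝ) {m : ℕ} (hm : m ≠ 0) (x : Space n) (ω : Ω) :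
    localExcess (fun i => a (i + 1)) xo (fun i => r (i + 1)) m (√(m : ℝ) • (x - xo)) ω =
      m * (objective a (measurement a xo fun i => r i ω) m x -
        objective a (measurement a xo fun i => r i ω) m xo) := by
  have hm' : (m : ℝ) ≠ 0 := Nat.cast_ne_zero.2 hm
  have hscale : (√(m : ℝ))⁻¹ • √(m : ℝ) • (x - xo) = x - xo :=
    inv_smul_smul₀ (Real.sqrt_ne_zero'.2 (by positivity)) _
  rw [objective_sub_objective, localExcess, localSignal, noiseField, average, hscale, mul_add,
    mul_left_comm (m : ℝ) 2, mul_inv_cancel_left₀ hm', mul_inv_cancel_left₀ hm', sub_eq_add_neg,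
    ← mul_neg, ← Finset.sum_neg_distrib]
  simp only [rangeDiffIncr, add_sub_cancel]
  congr 1
  · exact Finset.sum_congr rfl fun i _ => by ring
  · congr 1
    exact Finset.sum_congr rfl fun i _ => by ring

theorem average_indicator_eq_sampleDistribution (a : ℕ → Space n) (m : ℕ) (z : Space n) :
    average (fun i => a (i + 1)) m ({y | ∀ j, y j ≤ z j}.indicator 1) =
      sampleDistribution a m z := by
  classical
  rw [average, sampleDistribution, div_eq_inv_mul,
    ← sum_Icc_one_eq_sum_range fun i => {y : Space n | ∀ j, y j ≤ z j}.indicator 1 (a i),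
    Finset.natCast_card_filter]
  congr 1
  exact Finset.sum_congr rfl fun i _ => by simp [Set.indicator_apply]

theorem isEquidistributed_of_tendsto_sampleDistribution {a : ℕ → Space n} {μ : Measure (Space n)}
    [IsProbabilityMeasure μ] (ha : Bornology.IsBounded (Set.range a))
    (hμ : ∀ z, Tendsto (fun m => sampleDistribution a m z) atTop (𝓝 (distributionFunction μ z))) :
    IsEquidistributed (fun i => a (i + 1)) μ :=
  isEquidistributed_of_tendsto_distributionFunction
    (ha.subset (Set.range_comp_subset_range (· + 1) a)) fun z =>
      (hμ z).congr fun m => (average_indicator_eq_sampleDistribution a m z).symm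

theorem IsEquidistributed.isTailGram {a : ℕ → Space n} {xo : Space n} {μ : Measure (Space n)}
    [IsFiniteMeasure μ] (hb : IsEquidistributed (fun i => a (i + 1)) μ) (hμ : μ {xo} = 0)
    (hxo : xo ≠ 0) (ha : ∀ i, a i ≠ xo) : IsTailGram a xo (gramMatrix μ xo) := fun j k => by
  simpa only [HasTailProduct, average, sum_Icc_one_eq_sum_range,
    partialRangeDiff_eq hxo (ha _)] using hb.tendsto_average_rangeDiffGrad_mul hμ j k

end Objective

/-! ### Maximum likelihood estimates -/

section Estimates

variable {n : ℕ} {Ω : Type*} {a : ℕ → Space n} {xo : Space n} {μ : Measure (Space n)}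
  {r : ℕ → Ω → ℝ} {v : ℝ≥0} {Θ : Set (Space n)} {xhat : ℕ → Ω → Space n}

theorem localExcess_le_of_isMLEstimate {m : ℕ} (hm : m ≠ 0) {x y : Space n} {ω : Ω}
    (h : IsMLEstimate Θ a (measurement a xo fun i => r i ω) m x) (hy : y ∈ Θ) :
    localExcess (fun i => a (i + 1)) xo (fun i => r (i + 1)) m (√(m : ℝ) • (x - xo)) ω ≤
      localExcess (fun i => a (i + 1)) xo (fun i => r (i + 1)) m (√(m : ℝ) • (y - xo)) ω := by
  rw [localExcess_sqrt_smul_sub a xo r hm, localExcess_sqrt_smul_sub a xo r hm]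
  gcongr
  exact h.2 y hy

theorem tendsto_inv_sqrt_smul_sqrt_smul_sub {x : ℕ → Space n} (hx : Tendsto x atTop (𝓝 xo)) :
    Tendsto (fun m : ℕ => (√(m : ℝ))⁻¹ • √(m : ℝ) • (x m - xo)) atTop (𝓝 0) := by
  rw [← sub_self xo]
  refine (hx.sub_const xo).congr' ?_
  filter_upwards [eventually_gt_atTop 0] with m hm
  exact (inv_smul_smul₀ (Real.sqrt_ne_zero'.2 (by positivity)) _).symm

theorem eventually_localExcess_le_gramInverse_score {ω : Ω} (hint : xo ∈ interior Θ)
    (hscore : Tendsto (fun m : ℕ => (√(m : ℝ))⁻¹ •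
      score (fun i => a (i + 1)) xo (fun i => r (i + 1)) m ω) atTop (𝓝 0))
    (hxhat : ∀ᶠ m in atTop, IsMLEstimate Θ a (measurement a xo fun i => r i ω) m (xhat m ω)) :
    ∀ᶠ m : ℕ in atTop,
      localExcess (fun i => a (i + 1)) xo (fun i => r (i + 1)) m (√(m : ℝ) • (xhat m ω - xo)) ω ≤
        localExcess (fun i => a (i + 1)) xo (fun i => r (i + 1)) m
          (gramInverse μ xo (score (fun i => a (i + 1)) xo (fun i => r (i + 1)) m ω)) ω := by
  have hlim : Tendsto (fun m : ℕ => xo + gramInverse μ xo ((√(m : ℝ))⁻¹ •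
      score (fun i => a (i + 1)) xo (fun i => r (i + 1)) m ω)) atTop (𝓝 xo) := by
    simpa using (((gramInverse μ xo).continuous.tendsto 0).comp hscore).const_add xo
  filter_upwards [hxhat, hlim.eventually (mem_interior_iff_mem_nhds.1 hint),
    eventually_ne_atTop 0] with m hm hmem hm0
  simpa only [add_sub_cancel_left, map_smul,
    smul_inv_smul₀ (Real.sqrt_ne_zero'.2 (show 0 < (m : ℝ) by positivity))] using
    localExcess_le_of_isMLEstimate hm0 hm hmem

variable [MeasurableSpace Ω] {P : Measure Ω} [IsFiniteMeasure μ]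

theorem ae_tendsto_of_isMLEstimate (hξ : IsWhiteNoise (fun i => r (i + 1)) v P)
    (hb : IsEquidistributed (fun i => a (i + 1)) μ)
    (hfin : ∀ x, x ≠ xo → ¬ ∀ᵐ z ∂μ, rangeDiff z xo = rangeDiff z x)
    (hinf : Bornology.IsBounded Θ ∨
      ∀ u : Space n, ‖u‖ = 1 → ¬ ∀ᵐ z ∂μ, rangeDiff z xo = -inner ℝ u z)
    (hxo : xo ∈ Θ)
    (hxhat : ∀ᵐ ω ∂P, ∀ᶠ m in atTop,
      IsMLEstimate Θ a (measurement a xo fun i => r i ω) m (xhat m ω)) :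
    ∀ᵐ ω ∂P, Tendsto (fun m => xhat m ω) atTop (𝓝 xo) := by
  obtain ⟨A, hA⟩ := hξ.exists_ae_eventually_average_abs_le
  filter_upwards [hxhat, hA, hξ.ae_forall_tendsto_average_mul
    hb.isBounded_range.isCompact_closure fun i => subset_closure (Set.mem_range_self i)]
    with ω hml habs hlaw
  refine hb.tendsto_of_average_rangeDiff_sq_add_le hfin (hinf.imp_left fun hΘ => ?_) habs hlaw ?_
  · obtain ⟨C, hC⟩ := hΘ.exists_norm_le
    exact ⟨C, hml.mono fun m hm => hC _ hm.1⟩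
  · filter_upwards [hml] with m hm
    rw [← objective_sub_objective a xo (fun i => r i ω)]
    exact sub_nonpos.2 (hm.2 xo hxo)

theorem tendstoInDistribution_of_isMLEstimate [IsProbabilityMeasure P]
    (hξ : IsWhiteNoise (fun i => r (i + 1)) v P)
    (hb : IsEquidistributed (fun i => a (i + 1)) μ) (hμ : μ {xo} = 0) (hxo : xo ≠ 0)
    (hpos : ∀ h : Space n, h ≠ 0 → 0 < inner ℝ h (gramOperator μ xo h))
    (hint : xo ∈ interior Θ) (hmeas : ∀ m, AEMeasurable (xhat m) P)
    (hxhat : ∀ᵐ ω ∂P, ∀ᶠ m in atTop,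
      IsMLEstimate Θ a (measurement a xo fun i => r i ω) m (xhat m ω))
    (hlim : ∀ᵐ ω ∂P, Tendsto (fun m => xhat m ω) atTop (𝓝 xo)) :
    TendstoInDistribution (fun (m : ℕ) ω => √(m : ℝ) • (xhat m ω - xo)) atTop
      (id : Space n → Space n) (fun _ => P)
      (multivariateGaussian 0 ((v : ℝ) • (gramMatrix μ xo)⁻¹)) := by
  have hmeas' (m : ℕ) : AEMeasurable (fun ω => √(m : ℝ) • (xhat m ω - xo)) P :=
    ((hmeas m).sub_const xo).fun_const_smul _
  refine tendstoInDistribution_of_tendstoInMeasure_sub _ _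
    (hξ.tendstoInDistribution_gramInverse_score hb hμ (gramMatrix_posDef hpos))
    (hξ.tendstoInMeasure_sub_gramInverse_score hb hμ hxo hpos hmeas'
      (hlim.mono fun ω hω => tendsto_inv_sqrt_smul_sqrt_smul_sub hω) ?_ ?_) hmeas'
  · filter_upwards [hxhat] with ω hω
    filter_upwards [hω, eventually_ne_atTop 0] with m hm hm0
    simpa [localExcess, localSignal, noiseField] using
      localExcess_le_of_isMLEstimate hm0 hm (interior_subset hint)
  · filter_upwards [hxhat, hξ.ae_tendsto_inv_sqrt_smul_score (b := fun i => a (i + 1)) (xo := xo)]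
      with ω hω hscore
    exact eventually_localExcess_le_gramInverse_score hint hscore hω

end Estimates

end TDOA

end

theorem theorem1_general {n : ℕ} (hn : 2 ≤ n)
    {Ω : Type*} [MeasurableSpace Ω] (P : Measure Ω) [IsProbabilityMeasure P]
    (xo : TDOA.Space n) (a : ℕ → TDOA.Space n) (ha0 : a 0 = 0)
    (ha_bdd : Bornology.IsBounded (Set.range a)) (ha_ne : ∀ i, a i ≠ xo)
    (μ : Measure (TDOA.Space n)) [IsProbabilityMeasure μ]
    (hμ : ∀ z, Tendsto (fun m => TDOA.sampleDistribution a m z) atTop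
      (𝓝 (TDOA.distributionFunction μ z)))
    (h_hyperboloid : ∀ S, TDOA.IsHyperboloidWithFocus xo S → a 0 ∈ S → μ S ≠ 1)
    (h_hyperplane : ∀ S : Set (TDOA.Space n), TDOA.IsHyperplane S → μ S ≠ 1)
    (σ : ℝ≥0) (r : ℕ → Ω → ℝ)
    (hr_indep : iIndepFun (fun i => r (i + 1)) P)
    (hr_law : ∀ i, 1 ≤ i → HasLaw (r i) (gaussianReal 0 (σ ^ 2)) P)
    (Θ : Set (TDOA.Space n)) (hxo : xo ∈ Θ)
    (hΘ : Bornology.IsBounded Θ ∨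
      ∀ S, TDOA.IsParaboloidWithFocus xo S → a 0 ∈ S → μ S ≠ 1)
    (xhat : ℕ → Ω → TDOA.Space n) (hxhat_meas : ∀ m, AEMeasurable (xhat m) P)
    (hxhat : ∀ᵐ ω ∂P, ∀ᶠ m in atTop,
      TDOA.IsMLEstimate Θ a (TDOA.measurement a xo fun i => r i ω) m (xhat m ω)) :
    (∀ᵐ ω ∂P, Tendsto (fun m => xhat m ω) atTop (𝓝 xo)) ∧
    (xo ∈ interior Θ → μ {xo} = 0 →
      (∀ S, TDOA.IsConeWithVertex xo S → a 0 ∈ S → μ S ≠ 1) →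
      ∃ M : Matrix (Fin n) (Fin n) ℝ, TDOA.IsTailGram a xo M ∧ M.PosDef ∧
        TendstoInDistribution (fun (m : ℕ) ω => √(m : ℝ) • (xhat m ω - xo)) atTop
          (id : TDOA.Space n → TDOA.Space n) (fun _ => P)
          (multivariateGaussian 0 ((σ : ℝ) ^ 2 • M⁻¹))) := by
  have hxo0 : xo ≠ 0 := fun h => ha_ne 0 (ha0.trans h.symm)
  rw [ha0] at h_hyperboloid hΘ ⊢
  have hξ : TDOA.IsWhiteNoise (fun i => r (i + 1)) (σ ^ 2) P :=
    ⟨hr_indep, fun i => hr_law (i + 1) i.succ_pos⟩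
  have hb := TDOA.isEquidistributed_of_tendsto_sampleDistribution ha_bdd hμ
  have hlim : ∀ᵐ ω ∂P, Tendsto (fun m => xhat m ω) atTop (𝓝 xo) :=
    TDOA.ae_tendsto_of_isMLEstimate hξ hb
      (fun _ => TDOA.not_ae_rangeDiff_eq hn h_hyperboloid h_hyperplane)
      (hΘ.imp_right fun h_paraboloid _ =>
        TDOA.not_ae_rangeDiff_eq_neg_inner hn h_hyperplane h_paraboloid) hxo hxhat
  refine ⟨hlim, fun hint hμxo h_cone => ?_⟩
  have hpos (h : TDOA.Space n) (hh : h ≠ 0) : 0 < inner ℝ h (TDOA.gramOperator μ xo h) :=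
    hb.inner_gramOperator_self_pos hn hμxo hxo0 h_hyperplane h_cone hh
  refine ⟨TDOA.gramMatrix μ xo, hb.isTailGram hμxo hxo0 ha_ne, TDOA.gramMatrix_posDef hpos, ?_⟩
  rw [← NNReal.coe_pow]
  exact TDOA.tendstoInDistribution_of_isMLEstimate hξ hb hμxo hxo0 hpos hint hxhat_meas hxhat hlim

theorem theorem1 {n : ℕ} (hn : n = 2 ∨ n = 3)
    {Ω : Type*} [MeasurableSpace Ω] (P : Measure Ω) [IsProbabilityMeasure P]
    -- the source, the sensors (the reference sensor `a 0` being the origin), the limit measure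
    (xo : TDOA.Space n) (a : ℕ → TDOA.Space n) (ha0 : a 0 = 0)
    (ha_bdd : Bornology.IsBounded (Set.range a)) (ha_ne : ∀ i, a i ≠ xo)
    (μ : Measure (TDOA.Space n)) [IsProbabilityMeasure μ]
    (hμ : ∀ z, Tendsto (fun m => TDOA.sampleDistribution a m z) atTop
      (𝓝 (TDOA.distributionFunction μ z)))
    (h_hyperboloid : ∀ S, TDOA.IsHyperboloidWithFocus xo S → a 0 ∈ S → μ S ≠ 1)
    (h_hyperplane : ∀ S : Set (TDOA.Space n), TDOA.IsHyperplane S → μ S ≠ 1)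
    -- the noise
    (σ : ℝ≥0) (r : ℕ → Ω → ℝ)
    (hr_indep : iIndepFun (fun i => r (i + 1)) P)
    (hr_law : ∀ i, 1 ≤ i → HasLaw (r i) (gaussianReal 0 (σ ^ 2)) P)
    -- the parameter set: compact, or all of `ℝⁿ`
    (Θ : Set (TDOA.Space n)) (hxo : xo ∈ Θ)
    (hΘ : IsCompact Θ ∨
      (Θ = Set.univ ∧ ∀ S, TDOA.IsParaboloidWithFocus xo S → a 0 ∈ S → μ S ≠ 1))
    -- the maximum likelihood estimates
    (xhat : ℕ → Ω → TDOA.Space n) (hxhat_meas : ∀ m, AEMeasurable (xhat m) P)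
    (hxhat : ∀ᵐ ω ∂P, ∀ᶠ m in atTop,
      TDOA.IsMLEstimate Θ a (TDOA.measurement a xo fun i => r i ω) m (xhat m ω)) :
    (∀ᵐ ω ∂P, Tendsto (fun m => xhat m ω) atTop (𝓝 xo)) ∧
    (xo ∈ interior Θ → μ {xo} = 0 →
      (∀ S, TDOA.IsConeWithVertex xo S → a 0 ∈ S → μ S ≠ 1) →
      ∃ M : Matrix (Fin n) (Fin n) ℝ, TDOA.IsTailGram a xo M ∧ M.PosDef ∧
        TendstoInDistribution (fun (m : ℕ) ω => √(m : ℝ) • (xhat m ω - xo)) atTop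
          (id : TDOA.Space n → TDOA.Space n) (fun _ => P)
          (multivariateGaussian 0 ((σ : ℝ) ^ 2 • M⁻¹))) :=
  theorem1_general (by omega) P xo a ha0 ha_bdd ha_ne μ hμ h_hyperboloid h_hyperplane σ r hr_indep
    hr_law Θ hxo (hΘ.imp IsCompact.isBounded And.right) xhat hxhat_meas hxhat
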